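/- Let $n\ge 3$ and let $M^n$ be a connected smooth manifold with a distinguished end, i.e. a smooth chart identifying an open subset of $M$ with $\{x\in\mathbb R^n: |x|>R\}$, where $x\to\infty$ means leaving all compact subsets of $M$. Let $\mathcal S$ be the class of nonempty compact smooth hypersurfaces $\Sigma=\partial\Omega$, where the open set $\Omega$ (the *outside* of $\Sigma$) contains a neighbourhood of infinity of the distinguished end, has compact closure apart from it, and lies locally on one side of $\Sigma$. We say that $\Sigma'$ *encloses* $\Sigma$ if the outside of $\Sigma'$ is contained in that of $\Sigma$. Let $(M,g_t,\Sigma(t))_{t\ge0}$ be a conformal flow: $\Sigma(t)\in\mathcal S$; $g_t$ is a Riemannian metric, locally Lipschitz in $t$, $C^1$ in $x$, and smooth with nonnegative scalar curvature outside $\Sigma(t)$; $\Sigma(t)$ is an outer minimizing minimal hypersurface in $(M,g_t)$; $\Sigma(t)$ encloses $\Sigma(s)$ for $s\le t$; and $g_t=u_t^{4/(n-2)}g_0$ with $u_t>0$ and, for almost every $t$, $\frac{d}{dt}u_t=v_t$ on $M$, where for every $t$ the function $v_t$ is continuous, $v_t=0$ on and inside $\Sigma(t)$, $\Delta_{g_0}v_t=0$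 outside $\Sigma(t)$, and $v_t\to-e^{-t}$ at infinity in the distinguished end. Suppose that $g_0$ is harmonically flat at infinity: $(g_0)_{ij}=\mathcal U_0^{4/(n-2)}\delta_{ij}$ in the chart of the end, where $\mathcal U_0>0$ is harmonic on $\{|x|>R\}$ and $\mathcal U_0\to1$ at infinity. The mass of the end for a metric $g$ is the ADM mass $$\frac1{2(n-1)\omega_{n-1}}\lim_{\sigma\to\infty}\int_{S_\sigma}\sum_{i,j}(\partial_i g_{ij}-\partial_j g_{ii})\nu_j\,d\mu ,$$ where $\omega_{n-1}$ is the area of the unit sphere, computed after rescaling the coordinates by a constant so that $g_{ij}\to\delta_{ij}$ at infinity. For $S\in\mathcal S$ and a time $t$, let $\bar M_S$ be the two-ended double obtained by gluing two copies of the closed outside region of $S$ along $S$, with the metric $\bar g_t$ equal to $g_t$ on both copies. Let $\omega$ be the $\bar g_t$-harmonic function on $\bar M_S$ tending to $1$ at the distinguished end of the first copy and to $0$ at that of the second: $\omega$ is continuous, $C^2$ and $g_t$-harmonic on each open copy, and $C^1$ up to $S$ from both sides, with normal derivatives, both taken in the direction of the same normal vector of $S$ in $M$, adding up to $0$. The mass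 of the double conformally closed at the second end is the mass of the first end for the metric $\omega^{4/(n-2)}\bar g_t$. For $S\in\mathcal S$ say that $\Sigma(s)\to S$ if, for each neighbourhood $N$ of $S$, the outsides of $\Sigma(s)$ and of $S$ eventually agree off $N$. Call $t\ge 0$ a *jump time* if $\Sigma(s)\not\to\Sigma(t)$ as $s\to t$, $s\ge 0$. Then: 1. The mass $m(t)$ of the distinguished end of $(M,g_t)$ exists for every $t\ge0$. 2. If $t\ge0$ is not a jump time and $\tilde m(t)$ denotes the mass of the double of $(M,g_t)$ through $\Sigma(t)$, conformally closed at one end by a function $\omega$ as above, then this mass exists and $$m'(t)=-2\tilde m(t)$$ (a right derivative if $t=0$). 3. If $t\ge 0$ and $\Sigma(s)\to\Sigma^+(t)\in\mathcal S$ as $s\to t^+$, respectively $t>0$ and $\Sigma(s)\to\Sigma^-(t)\in\mathcal S$ as $s\to t^-$ (in particular if $t$ is a jump time and $\Sigma^\pm(t)$ are the hypersurfaces before and after the jump), let $\tilde m^{\pm}(t)$ be the mass of the double of $(M,g_t)$ through $\Sigma^{\pm}(t)$, conformally closed at one end by a function $\omega$ as above. Then this mass exists, the one-sided derivative of $m$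 at $t$ exists and equals $-2\tilde m^{\pm}(t)$, and also $$\lim_{s\to t^{\pm}}m'(s)=-2\tilde m^{\pm}(t),$$ the limit being taken over the times $s$ at which $m$ is differentiable. -/

import Mathlib

open Set Filter Topology MeasureTheory Bundle
open scoped Manifold ContDiff ENNReal

noncomputable section

namespace ConfFlow

/-! ### Riemannian geometry in coordinates -/

/-- Euclidean space `ℝⁿ`. -/
abbrev Eu (n : ℕ) : Type := EuclideanSpace ℝ (Fin n)

/-- The partial derivative `∂ᵢ f` at `y`. -/
def pd {n : ℕ} (i : Fin n) (f : Eu n → ℝ) (y : Eu n) : ℝ :=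
  fderiv ℝ f y (EuclideanSpace.single i 1)

/-- The Laplace-Beltrami operator `(det G)^(-1/2) ∂ᵢ ((det G)^(1/2) G^{ij} ∂ⱼ f)` of the metric
with coefficients `G`. -/
def coordLaplacian {n : ℕ} (G : Eu n → Matrix (Fin n) (Fin n) ℝ) (f : Eu n → ℝ) (y : Eu n) : ℝ :=
  (√(G y).det)⁻¹ *
    ∑ i, pd i (fun z => √(G z).det * ∑ j, (G z)⁻¹ i j * pd j f z) y

/-- The squared length `G^{ij} ∂ᵢ f ∂ⱼ f` of the gradient of `f`. -/
def coordGradSq {n : ℕ} (G : Eu n → Matrix (Fin n) (Fin n) ℝ) (f : Eu n → ℝ) (y : Eu n) : ℝ :=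
  ∑ i, ∑ j, (G y)⁻¹ i j * pd i f y * pd j f y

/-- The mean curvature `div (∇f / |∇f|)` of the level set of `f` through `y`. -/
def coordMeanCurvature {n : ℕ} (G : Eu n → Matrix (Fin n) (Fin n) ℝ) (f : Eu n → ℝ)
    (y : Eu n) : ℝ :=
  (√(G y).det)⁻¹ *
    ∑ i, pd i (fun z => √(G z).det * (∑ j, (G z)⁻¹ i j * pd j f z) / √(coordGradSq G f z)) y

/-- The Christoffel symbol `Γᵏᵢⱼ`. -/
def christoffel {n : ℕ} (G : Eu n → Matrix (Fin n) (Fin n) ℝ) (k i j : Fin n) (y : Eu n) : ℝ :=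
  (1 / 2) * ∑ l, (G y)⁻¹ k l *
    (pd i (fun z => G z j l) y + pd j (fun z => G z i l) y - pd l (fun z => G z i j) y)

/-- The Ricci curvature `Rᵢⱼ`. -/
def coordRicci {n : ℕ} (G : Eu n → Matrix (Fin n) (Fin n) ℝ) (i j : Fin n) (y : Eu n) : ℝ :=
  ∑ k, (pd k (christoffel G k i j) y - pd j (christoffel G k i k) y) +
    ∑ k, ∑ l, (christoffel G k k l y * christoffel G l i j y -
      christoffel G k j l y * christoffel G l i k y)

/-- The scalar curvature. -/
def coordScalar {n : ℕ} (G : Eu n → Matrix (Fin n) (Fin n) ℝ) (y : Eu n) : ℝ :=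
  ∑ i, ∑ j, (G y)⁻¹ i j * coordRicci G i j y

/-! ### ADM mass in an end chart -/

/-- The flux `∫_{S_σ} (G_{ij,i} - G_{ii,j}) νⱼ dμ` through the coordinate sphere of radius `σ`;
`dμ` is the Euclidean area element, which is `σ^(n-1)` times that of the unit sphere. -/
def admFlux {n : ℕ} (G : Eu n → Matrix (Fin n) (Fin n) ℝ) (σ : ℝ) : ℝ :=
  σ ^ (n - 1) * ∫ θ : Metric.sphere (0 : Eu n) 1,
    (∑ i, ∑ j, (pd i (fun z => G z i j) (σ • (θ : Eu n)) -
      pd j (fun z => G z i i) (σ • (θ : Eu n))) * (θ : Eu n) j)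
    ∂((volume : Measure (Eu n)).toSphere)

/-- The coefficients, in the coordinates `y = lam x`, of the metric which has the coefficients `G`
in the coordinates `x`. -/
def rescale {n : ℕ} (lam : ℝ) (G : Eu n → Matrix (Fin n) (Fin n) ℝ) :
    Eu n → Matrix (Fin n) (Fin n) ℝ :=
  fun y => (lam ^ 2)⁻¹ • G (lam⁻¹ • y)

/-- `μ` is the ADM mass of an end on which the metric has coefficients `G`. The mass is
computed in coordinates in which the metric tends to the Euclidean one; when `G` tends to another
multiple of the identity, the coordinates are first rescaled (the factor `lam` is then unique).
The area of the unit sphere is the total mass of `volume.toSphere`. -/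
def IsCoordADMMass {n : ℕ} (G : Eu n → Matrix (Fin n) (Fin n) ℝ) (μ : ℝ) : Prop :=
  ∃ lam : ℝ, 0 < lam ∧
    (∀ i j, Tendsto (fun y => rescale lam G y i j) (Bornology.cobounded (Eu n))
      (𝓝 ((1 : Matrix (Fin n) (Fin n) ℝ) i j))) ∧
    Tendsto (fun σ => 1 / (2 * ((n : ℝ) - 1) * ((volume : Measure (Eu n)).toSphere.real univ)) *
      admFlux (rescale lam G) σ) atTop (𝓝 μ)

/-! ### Metrics and charts on a manifold -/

section Manifold

variable {n : ℕ} {M : Type*} [TopologicalSpace M] [ChartedSpace (Eu n) M]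

variable (n M) in
/-- A field of bilinear forms on the tangent spaces. -/
abbrev FormField : Type _ :=
  ∀ x : M, TangentSpace (𝓡 n) x →L[ℝ] TangentSpace (𝓡 n) x →L[ℝ] ℝ

variable (n M) in
/-- A Riemannian metric of class `C¹` on `M`. -/
abbrev C1Metric [IsManifold (𝓡 n) ∞ M] : Type _ :=
  ContMDiffRiemannianMetric (𝓡 n) 1 (Eu n) (fun x : M => TangentSpace (𝓡 n) x)

/-- The conformally changed form `φ^(4/(n-2)) h`. -/
def conformal (φ : M → ℝ) (h : FormField n M) : FormField n M :=
  fun x => (φ x ^ (4 / ((n : ℝ) - 2))) • h x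

/-- The coefficients of `h` in the chart `e`. -/
def coeff (h : FormField n M) (e : OpenPartialHomeomorph M (Eu n)) :
    Eu n → Matrix (Fin n) (Fin n) ℝ :=
  fun y => Matrix.of fun i j =>
    h (e.symm y) (mfderiv 𝓘(ℝ, Eu n) (𝓡 n) e.symm y (EuclideanSpace.single i (1 : ℝ)))
      (mfderiv 𝓘(ℝ, Eu n) (𝓡 n) e.symm y (EuclideanSpace.single j (1 : ℝ)))

/-- `Δ_h f = 0` on `Ω`, in every smooth chart. -/
def IsHarmonicOn (h : FormField n M) (f : M → ℝ) (Ω : Set M) : Prop :=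
  ∀ e ∈ IsManifold.maximalAtlas (𝓡 n) ∞ M, ∀ x ∈ e.source ∩ Ω,
    coordLaplacian (coeff h e) (f ∘ e.symm) (e x) = 0

/-- The scalar curvature of `h` is nonnegative on `Ω`. -/
def ScalarNonnegOn (h : FormField n M) (Ω : Set M) : Prop :=
  ∀ e ∈ IsManifold.maximalAtlas (𝓡 n) ∞ M, ∀ x ∈ e.source ∩ Ω, 0 ≤ coordScalar (coeff h e) (e x)

/-- The length of the path `γ|[0,1]`. -/
def pathLength (h : FormField n M) (γ : ℝ → M) : ℝ≥0∞ :=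
  ∫⁻ s in Icc (0 : ℝ) 1, ENNReal.ofReal
    √(h (γ s) (mfderiv 𝓘(ℝ, ℝ) (𝓡 n) γ s (1 : ℝ)) (mfderiv 𝓘(ℝ, ℝ) (𝓡 n) γ s (1 : ℝ)))

/-- The Riemannian distance. -/
def riemDist (h : FormField n M) (x y : M) : ℝ≥0∞ :=
  ⨅ (γ : ℝ → M) (_ : ContMDiffOn 𝓘(ℝ, ℝ) (𝓡 n) 1 γ (Icc 0 1)) (_ : γ 0 = x) (_ : γ 1 = y),
    pathLength h γ

/-- The diameter for the Riemannian distance. -/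
def riemDiam (h : FormField n M) (A : Set M) : ℝ≥0∞ :=
  ⨆ (x ∈ A) (y ∈ A), riemDist h x y

/-- The area of a hypersurface: its `(n-1)`-dimensional Hausdorff measure for the Riemannian
distance (up to the usual constant factor depending on `n`). -/
def area (h : FormField n M) (A : Set M) : ℝ≥0∞ :=
  ⨆ (δ : ℝ≥0∞) (_ : 0 < δ),
    ⨅ (C : ℕ → Set M) (_ : A ⊆ ⋃ k, C k) (_ : ∀ k, riemDiam h (C k) ≤ δ),
      ∑' k, riemDiam h (C k) ^ (n - 1)

variable (n M) in
/-- A distinguished end of `M`: a smooth chart from an open subset of `M` onto the exterior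
`{|y| > R}` of a ball, under which `|y| → ∞` means leaving every compact subset of `M`. -/
structure DistinguishedEnd where
  chart : OpenPartialHomeomorph M (Eu n)
  smooth : chart ∈ IsManifold.maximalAtlas (𝓡 n) ∞ M
  R : ℝ
  R_pos : 0 < R
  target_eq : chart.target = {y | R < ‖y‖}
  proper : Tendsto chart.symm (Bornology.cobounded (Eu n)) (cocompact M)

namespace DistinguishedEnd

variable (E : DistinguishedEnd n M)

/-- The part `|y| > r` of the end. -/
def beyond (r : ℝ) : Set M := E.chart.symm '' {y | r < ‖y‖}

/-- `f x → a` as `x → ∞` in the end. -/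
def HasLimit (f : M → ℝ) (a : ℝ) : Prop :=
  Tendsto (fun y => f (E.chart.symm y)) (Bornology.cobounded (Eu n)) (𝓝 a)

/-- The ADM mass of the end, for the metric `h`, is `μ`. -/
def IsADMMass (h : FormField n M) (μ : ℝ) : Prop := IsCoordADMMass (coeff h E.chart) μ

/-- In the end chart `h = U^(4/(n-2)) δ` with a positive Euclidean harmonic function `U`
which is normalized to tend to `1` at infinity. -/
def IsHarmonicallyFlat (h : FormField n M) : Prop :=
  ∃ U : Eu n → ℝ,
    InnerProductSpace.HarmonicOnNhd U {y | E.R < ‖y‖} ∧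
    (∀ y, E.R < ‖y‖ → 0 < U y) ∧
    Tendsto U (Bornology.cobounded (Eu n)) (𝓝 1) ∧
    ∀ y, E.R < ‖y‖ →
      coeff h E.chart y = (U y ^ (4 / ((n : ℝ) - 2))) • (1 : Matrix (Fin n) (Fin n) ℝ)

end DistinguishedEnd

/-! ### Hypersurfaces with an outside -/

/-- `f` is a local defining function at `p` of the smooth domain `Ω = {f > 0}`. -/
def IsDefiningFunction (Ω : Set M) (p : M) (f : M → ℝ) : Prop :=
  mfderiv (𝓡 n) 𝓘(ℝ, ℝ) f p ≠ 0 ∧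
    ∃ U ∈ 𝓝 p, ContMDiffOn (𝓡 n) 𝓘(ℝ, ℝ) ∞ f U ∧ ∀ x ∈ U, x ∈ Ω ↔ 0 < f x

/-- A hypersurface of the class `𝒮`: a smooth compact boundary separating the distinguished end
from all the other ends. It is given by its outside, an open set with smooth boundary whose closure
consists of a compact set and of a neighbourhood of infinity in the distinguished end. -/
structure Hypersurface (E : DistinguishedEnd n M) where
  outside : Set M
  isOpen : IsOpen outside
  nonempty : (frontier outside).Nonempty
  regular : ∀ p ∈ frontier outside, ∃ f : M → ℝ, IsDefiningFunction (n := n) outside p f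
  cocompact : ∃ r, E.R ≤ r ∧ E.beyond r ⊆ outside ∧ IsCompact (closure outside \ E.beyond r)

namespace Hypersurface

variable {E : DistinguishedEnd n M}

/-- The hypersurface as a set. -/
def surface (S : Hypersurface E) : Set M := frontier S.outside

/-- `S'` encloses `S`. -/
def Encloses (S' S : Hypersurface E) : Prop := S'.outside ⊆ S.outside

/-- `N` is `h`-normal to the hypersurface at its point `p`. -/
def IsNormal (S : Hypersurface E) (h : FormField n M) (p : M) (N : TangentSpace (𝓡 n) p) : Prop :=
  ∀ f : M → ℝ, IsDefiningFunction (n := n) S.outside p f →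
    ∀ w : TangentSpace (𝓡 n) p, mfderiv (𝓡 n) 𝓘(ℝ, ℝ) f p w = 0 → h p N w = 0

/-- A horizon: the mean curvature vanishes. -/
def IsHorizon (S : Hypersurface E) (h : FormField n M) : Prop :=
  ∀ p ∈ S.surface, ∀ f : M → ℝ, IsDefiningFunction (n := n) S.outside p f →
    ∀ e ∈ IsManifold.maximalAtlas (𝓡 n) ∞ M, p ∈ e.source →
      coordMeanCurvature (coeff h e) (f ∘ e.symm) (e p) = 0

/-- Outer minimizing: no enclosing hypersurface has less area. -/
def IsOuterMinimizing (S : Hypersurface E) (h : FormField n M) : Prop :=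
  ∀ S' : Hypersurface E, S'.Encloses S → area h S.surface ≤ area h S'.surface

/-- `Σ(s)` converges to `S` along the filter `l` (Hausdorff convergence, the sides being
respected): off any neighbourhood of `S`, the outside of `Σ(s)` is eventually that of `S`. -/
def ConvergesTo (Sig : ℝ → Hypersurface E) (l : Filter ℝ) (S : Hypersurface E) : Prop :=
  ∀ N : Set M, IsOpen N → S.surface ⊆ N →
    ∀ᶠ s in l, symmDiff (Sig s).outside S.outside ⊆ N

/-! ### Doubling through a hypersurface -/

/-- Two copies of the closed outside region are glued along the hypersurface. -/
def doubleSetoid (S : Hypersurface E) : Setoid (Bool × closure S.outside) where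
  r p q := p.2 = q.2 ∧ (p.1 = q.1 ∨ (p.2 : M) ∈ S.surface)
  iseqv :=
    { refl := fun _ => ⟨rfl, Or.inl rfl⟩
      symm := fun {p q} h => ⟨h.1.symm, h.2.elim (fun a => Or.inl a.symm)
        (fun a => Or.inr (by rw [← h.1]; exact a))⟩
      trans := fun {p q s} h k => ⟨h.1.trans k.1, by
        rcases h.2 with a | a
        · rcases k.2 with b | b
          · exact Or.inl (a.trans b)
          · exact Or.inr (by rw [h.1]; exact b)
        · exact Or.inr a⟩ }

/-- The doubled space, obtained by reflecting the outside region through the hypersurface. -/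
def Double (S : Hypersurface E) : Type _ := Quotient S.doubleSetoid

instance (S : Hypersurface E) : TopologicalSpace S.Double :=
  inferInstanceAs (TopologicalSpace (Quotient S.doubleSetoid))

open Classical in
/-- The restriction of a function on the double to one of its two sheets, as a function on the
closed outside region (with the value `0` elsewhere). -/
def sheet (S : Hypersurface E) (χ : S.Double → ℝ) (b : Bool) : M → ℝ := fun x =>
  if hx : x ∈ closure S.outside then χ (Quotient.mk S.doubleSetoid (b, ⟨x, hx⟩)) else 0

/-- The derivative of `f` in the direction `N` at the point `p` of the hypersurface, computed from
the outside. -/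
def boundaryDeriv (S : Hypersurface E) (f : M → ℝ) (p : M) (N : TangentSpace (𝓡 n) p) : ℝ :=
  mfderivWithin (𝓡 n) 𝓘(ℝ, ℝ) f (closure S.outside) p N

/-- `χ` is the harmonic function on the double (for the metric which is `h` on both sheets)
which tends to `1` at the end of the sheet `true` and to `0` at the end of the sheet `false`.
Harmonicity across the hypersurface, where the doubled metric is in general only Lipschitz, means
that `χ` is `C¹` there, i.e. `C¹` up to the hypersurface from both sheets and with
matching normal derivatives: the reflection reverses the normal, so these add up to zero. -/
structure IsClosingFunction (S : Hypersurface E) (h : FormField n M) (χ : S.Double → ℝ) :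
    Prop where
  continuous : Continuous χ
  contMDiffOn_two : ∀ b, ContMDiffOn (𝓡 n) 𝓘(ℝ, ℝ) 2 (S.sheet χ b) S.outside
  contMDiffOn_one : ∀ b, ContMDiffOn (𝓡 n) 𝓘(ℝ, ℝ) 1 (S.sheet χ b) (closure S.outside)
  harmonic : ∀ b, IsHarmonicOn h (S.sheet χ b) S.outside
  matching : ∀ p ∈ S.surface, ∀ N : TangentSpace (𝓡 n) p, S.IsNormal h p N →
    S.boundaryDeriv (S.sheet χ true) p N + S.boundaryDeriv (S.sheet χ false) p N = 0
  limit_one : E.HasLimit (S.sheet χ true) 1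
  limit_zero : E.HasLimit (S.sheet χ false) 0

/-- `μ` is the mass of the double of `(M, h)` through `S`, conformally closed at one end by `χ`:
the ADM mass of the remaining end, that of the sheet `true`, for the metric `χ^(4/(n-2)) h`. (The
point that is added at the end of the sheet `false` does not affect it.) -/
def IsClosedDoubleMass (S : Hypersurface E) (h : FormField n M) (χ : S.Double → ℝ) (μ : ℝ) :
    Prop :=
  E.IsADMMass (conformal (S.sheet χ true) h) μ

end Hypersurface

/-! ### The conformal flow -/

/-- `v` is the solution of the Dirichlet problem `Δ_h v = 0` outside `S`, `v = 0` on and inside `S`,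
`v → a` at infinity in the distinguished end. -/
structure IsDirichletSolution {E : DistinguishedEnd n M} (h : FormField n M) (S : Hypersurface E)
    (a : ℝ) (v : M → ℝ) : Prop where
  continuous : Continuous v
  smooth : ContMDiffOn (𝓡 n) 𝓘(ℝ, ℝ) ∞ v S.outside
  harmonic : IsHarmonicOn h v S.outside
  eq_zero : ∀ x ∉ S.outside, v x = 0
  limit : E.HasLimit v a

/-- A conformal flow `(M, g_t, Σ(t))`, `t ≥ 0`: `g_t = u_t^(4/(n-2)) g_0` and `d u_t / dt = v_t`,
where `v_t` is `g_0`-harmonic outside `Σ(t)`, zero at and inside `Σ(t)`, and tends to `-e^(-t)`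
at infinity. As the hypersurface may jump, the evolution equation is required for almost
every `t`. -/
structure ConformalFlow [IsManifold (𝓡 n) ∞ M] (E : DistinguishedEnd n M) where
  /-- the metrics `g_t`, of class `C¹` in `x` -/
  g : ℝ → C1Metric n M
  /-- the hypersurfaces `Σ(t)` -/
  Sig : ℝ → Hypersurface E
  u : ℝ → M → ℝ
  v : ℝ → M → ℝ
  lipschitz : ∀ (x : M) (w : TangentSpace (𝓡 n) x) (T : ℝ), ∃ K,
    LipschitzOnWith K (fun t => (g t).inner x w w) (Icc 0 T)
  smooth : ∀ t, 0 ≤ t → ContMDiffOn (𝓡 n) ((𝓡 n).prod 𝓘(ℝ, Eu n →L[ℝ] Eu n →L[ℝ] ℝ)) ∞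
    (fun x : M => TotalSpace.mk' (Eu n →L[ℝ] Eu n →L[ℝ] ℝ)
      (E := fun x : M => TangentSpace (𝓡 n) x →L[ℝ] TangentSpace (𝓡 n) x →L[ℝ] ℝ)
      x ((g t).inner x)) (Sig t).outside
  scalar_nonneg : ∀ t, 0 ≤ t → ScalarNonnegOn (g t).inner (Sig t).outside
  horizon : ∀ t, 0 ≤ t → (Sig t).IsHorizon (g t).inner
  outerMinimizing : ∀ t, 0 ≤ t → (Sig t).IsOuterMinimizing (g t).inner
  encloses : ∀ s t, 0 ≤ s → s ≤ t → (Sig t).Encloses (Sig s)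
  u_pos : ∀ t, 0 ≤ t → ∀ x, 0 < u t x
  conformal_eq : ∀ t, 0 ≤ t → (g t).inner = conformal (u t) (g 0).inner
  dirichlet : ∀ t, 0 ≤ t → IsDirichletSolution (g 0).inner (Sig t) (-Real.exp (-t)) (v t)
  evolution : ∀ᵐ t : ℝ, 0 < t → ∀ x, HasDerivAt (fun s => u s x) (v t x) t

/-- `t` is a jump time if `Σ(s)` does not converge to `Σ(t)` as `s → t`, `s ≥ 0`. -/
def ConformalFlow.IsJumpTime [IsManifold (𝓡 n) ∞ M] {E : DistinguishedEnd n M}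
    (F : ConformalFlow E) (t : ℝ) : Prop :=
  ¬ Hypersurface.ConvergesTo F.Sig (𝓝[Ici 0] t) (F.Sig t)

end Manifold

end ConfFlow

end

/-!
In the chart of the end `g_t = W_t^(4/(n-2)) δ` with `W_t = 𝒰₀ u_t`. By conformal covariance `𝒰₀ v_s`
is harmonic near infinity, and `u_t = 1 + ∫₀ᵗ v_s ds`, so that `W_t` is a uniform limit of harmonic
functions. Hence `W_t = e^{-t} + b(t) |y|^(2-n) + …`, where `b(t)` can be read off from the mean of `W_t`
over one fixed sphere (`IsHarmonicLimit.exists_sphereIntegral_eq`), and the mass is `m(t) = 2 e^{-t} b(t)`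
(`isCoordADMMass_of_isHarmonicLimit`).

Let `χ` be the closing function of the double through `S`. Its sum with its mirror image under the
reflection of the double has vanishing normal derivative on `S`, hence is `1` near infinity, by Hopf's
lemma (`IsClosingFunction.sheet_add_sheet`). The difference of `χ` and its mirror image, multiplied by
`-u_t`, is the *potential*: a `g_0`-harmonic function outside `S` which vanishes on `S` and tends to
`-e^{-t}`. Near infinity `χ u_t` is therefore half the difference of `u_t` and the potential. If the
potential has, after multiplication by `𝒰₀`, the expansion `-e^{-t} + c |y|^(2-n) + …`, the mass of the
closed double is `e^{-t} (b(t) - c)` (`ConformalFlow.isClosedDoubleMass`).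

When `Σ(s) → S` as `s` tends to `t` from one side, the velocities `v_s` converge to the potential,
uniformly outside `S` (`ConformalFlow.eventually_abs_v_sub_potential_le_right` and
`ConformalFlow.eventually_abs_v_sub_potential_le_left`). For `s ↓ t` the domains of the `v_s` increase to
that of the potential and the maximum principle suffices; for `s ↑ t` a barrier, which vanishes slightly
inside `S`, shows that `v_s` is small near `S`. It follows that the spherical means of `W_s` have a strict
one-sided derivative at `t`, so that `b` has the derivative `c`, and
`m' = 2 e^{-t} (c - b) = -2 e^{-t} (b - c)`. Strictness also gives the limits of `m'(s)`
(`tendsto_deriv_of_hasDerivAtFilter`).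

A point of technique: `u_t` is only known to be `C¹` and a uniform limit of harmonic functions. That the
potential is harmonic is therefore expressed in the viscosity sense (`isViscSubAt_mul`), and the strong
maximum principle and Hopf's lemma are proved for viscosity subsolutions.
-/

noncomputable section

namespace ConfFlow

set_option linter.unusedSectionVars false

/-! ### Partial derivatives and second order operators -/

section Local

variable {n : ℕ}

theorem fderiv_eq_sum_pd (f : Eu n → ℝ) (y w : Eu n) :
    fderiv ℝ f y w = ∑ i, w i * pd i f y := by
  have h : w = ∑ i, w i • EuclideanSpace.single i (1 : ℝ) := by
    ext j
    simp [Finset.sum_apply, Pi.single_apply]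
  conv_lhs => rw [h]
  simp [pd, map_sum]

theorem contDiffAt_pd {m : ℕ∞ω} {f : Eu n → ℝ} {x : Eu n} (i : Fin n)
    (h : ContDiffAt ℝ (m + 1) f x) : ContDiffAt ℝ m (pd i f) x :=
  (h.fderiv_right le_rfl).clm_apply contDiffAt_const

theorem contDiffAt_pd_one {f : Eu n → ℝ} {x : Eu n} (i : Fin n)
    (h : ContDiffAt ℝ 2 f x) : ContDiffAt ℝ 1 (pd i f) x :=
  contDiffAt_pd (m := 1) i (by simpa [one_add_one_eq_two] using h)

theorem continuousAt_pd {f : Eu n → ℝ} {x : Eu n} (i : Fin n)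
    (h : ContDiffAt ℝ 1 f x) : ContinuousAt (pd i f) x :=
  (contDiffAt_pd (m := 0) i (by simpa using h)).continuousAt

theorem continuousAt_pd_pd {f : Eu n → ℝ} {x : Eu n} (i j : Fin n)
    (h : ContDiffAt ℝ 2 f x) : ContinuousAt (pd i (pd j f)) x :=
  continuousAt_pd i (contDiffAt_pd_one j h)

theorem eventually_differentiableAt {f : Eu n → ℝ} {x : Eu n} {m : ℕ} (hm : m ≠ 0)
    (h : ContDiffAt ℝ m f x) : ∀ᶠ y in 𝓝 x, DifferentiableAt ℝ f y :=
  (h.eventually (by simp)).mono fun _ hy => hy.differentiableAt (by exact_mod_cast hm)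

theorem pd_congr {f g : Eu n → ℝ} {x : Eu n} (i : Fin n) (h : f =ᶠ[𝓝 x] g) :
    pd i f x = pd i g x := by
  simp only [pd, h.fderiv_eq]

theorem pd_add {f g : Eu n → ℝ} {x : Eu n} (i : Fin n) (hf : DifferentiableAt ℝ f x)
    (hg : DifferentiableAt ℝ g x) : pd i (fun y => f y + g y) x = pd i f x + pd i g x := by
  simp [pd, fderiv_fun_add hf hg]

theorem pd_const_mul {f : Eu n → ℝ} {x : Eu n} (i : Fin n) (c : ℝ) (hf : DifferentiableAt ℝ f x) :
    pd i (fun y => c * f y) x = c * pd i f x := by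
  simp [pd, fderiv_const_mul hf]

theorem pd_mul {f g : Eu n → ℝ} {x : Eu n} (i : Fin n) (hf : DifferentiableAt ℝ f x)
    (hg : DifferentiableAt ℝ g x) :
    pd i (fun y => f y * g y) x = f x * pd i g x + pd i f x * g x := by
  simp [pd, fderiv_fun_mul hf hg, mul_comm]

theorem pd_sum {ι : Type*} {s : Finset ι} {f : ι → Eu n → ℝ} {x : Eu n} (i : Fin n)
    (hf : ∀ k ∈ s, DifferentiableAt ℝ (f k) x) :
    pd i (fun y => ∑ k ∈ s, f k y) x = ∑ k ∈ s, pd i (f k) x := by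
  simp [pd, fderiv_fun_sum hf]

/-- The second order operator `aᵢⱼ ∂ᵢ∂ⱼ f + bᵢ ∂ᵢ f`. -/
def ellOp (a : Eu n → Matrix (Fin n) (Fin n) ℝ) (b : Eu n → Fin n → ℝ) (f : Eu n → ℝ)
    (y : Eu n) : ℝ :=
  ∑ i, ∑ j, a y i j * pd i (pd j f) y + ∑ i, b y i * pd i f y

variable {a : Eu n → Matrix (Fin n) (Fin n) ℝ} {b : Eu n → Fin n → ℝ}

theorem pd_pd_add {f g : Eu n → ℝ} {x : Eu n} (i j : Fin n) (hf : ContDiffAt ℝ 2 f x)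
    (hg : ContDiffAt ℝ 2 g x) :
    pd i (pd j fun y => f y + g y) x = pd i (pd j f) x + pd i (pd j g) x := by
  have h : pd j (fun y => f y + g y) =ᶠ[𝓝 x] fun y => pd j f y + pd j g y := by
    filter_upwards [eventually_differentiableAt two_ne_zero hf,
      eventually_differentiableAt two_ne_zero hg] with y h1 h2 using pd_add j h1 h2
  rw [pd_congr i h, pd_add i ((contDiffAt_pd_one j hf).differentiableAt one_ne_zero)
    ((contDiffAt_pd_one j hg).differentiableAt one_ne_zero)]

theorem pd_pd_const_mul {f : Eu n → ℝ} {x : Eu n} (i j : Fin n) (c : ℝ)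
    (hf : ContDiffAt ℝ 2 f x) :
    pd i (pd j fun y => c * f y) x = c * pd i (pd j f) x := by
  have h : pd j (fun y => c * f y) =ᶠ[𝓝 x] fun y => c * pd j f y := by
    filter_upwards [eventually_differentiableAt two_ne_zero hf] with y h1 using pd_const_mul j c h1
  rw [pd_congr i h, pd_const_mul i c ((contDiffAt_pd_one j hf).differentiableAt one_ne_zero)]

theorem pd_pd_mul {f g : Eu n → ℝ} {x : Eu n} (i j : Fin n) (hf : ContDiffAt ℝ 2 f x)
    (hg : ContDiffAt ℝ 2 g x) :
    pd i (pd j fun y => f y * g y) x = f x * pd i (pd j g) x + pd i f x * pd j g x +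
      pd j f x * pd i g x + pd i (pd j f) x * g x := by
  have h : pd j (fun y => f y * g y) =ᶠ[𝓝 x] fun y => f y * pd j g y + pd j f y * g y := by
    filter_upwards [eventually_differentiableAt two_ne_zero hf,
      eventually_differentiableAt two_ne_zero hg] with y h1 h2 using pd_mul j h1 h2
  have hf1 := hf.differentiableAt two_ne_zero
  have hg1 := hg.differentiableAt two_ne_zero
  have hf2 := (contDiffAt_pd_one j hf).differentiableAt one_ne_zero
  have hg2 := (contDiffAt_pd_one j hg).differentiableAt one_ne_zero
  rw [pd_congr i h, pd_add i (hf1.fun_mul hg2) (hf2.fun_mul hg1), pd_mul i hf1 hg2, pd_mul i hf2 hg1]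
  ring

theorem ellOp_add {f g : Eu n → ℝ} {x : Eu n} (hf : ContDiffAt ℝ 2 f x)
    (hg : ContDiffAt ℝ 2 g x) :
    ellOp a b (fun y => f y + g y) x = ellOp a b f x + ellOp a b g x := by
  simp only [ellOp, pd_pd_add _ _ hf hg, pd_add _ (hf.differentiableAt two_ne_zero)
    (hg.differentiableAt two_ne_zero), mul_add, Finset.sum_add_distrib]
  ring

theorem ellOp_const_mul {f : Eu n → ℝ} {x : Eu n} (c : ℝ) (hf : ContDiffAt ℝ 2 f x) :
    ellOp a b (fun y => c * f y) x = c * ellOp a b f x := by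
  simp only [ellOp, pd_pd_const_mul _ _ _ hf, pd_const_mul _ _ (hf.differentiableAt two_ne_zero),
    mul_add, Finset.mul_sum]
  congr 1
  · exact Finset.sum_congr rfl fun i _ => Finset.sum_congr rfl fun j _ => by ring
  · exact Finset.sum_congr rfl fun i _ => by ring

theorem ellOp_mul {f g : Eu n → ℝ} {x : Eu n} (ha : (a x).IsSymm) (hf : ContDiffAt ℝ 2 f x)
    (hg : ContDiffAt ℝ 2 g x) :
    ellOp a b (fun y => f y * g y) x = f x * ellOp a b g x +
      2 * (∑ i, ∑ j, a x i j * pd i f x * pd j g x) + g x * ellOp a b f x := by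
  have e1 : ∑ i, ∑ j, a x i j * (pd j f x * pd i g x) = ∑ i, ∑ j, a x i j * pd i f x * pd j g x := by
    rw [Finset.sum_comm]
    refine Finset.sum_congr rfl fun i _ => Finset.sum_congr rfl fun j _ => ?_
    rw [ha.apply i j]; ring
  have e2 : ∑ i, ∑ j, a x i j * (pd i f x * pd j g x) = ∑ i, ∑ j, a x i j * pd i f x * pd j g x :=
    Finset.sum_congr rfl fun i _ => Finset.sum_congr rfl fun j _ => by ring
  simp only [ellOp, pd_pd_mul _ _ hf hg, pd_mul _ (hf.differentiableAt two_ne_zero)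
    (hg.differentiableAt two_ne_zero), mul_add, Finset.sum_add_distrib, e1, e2]
  have e3 : ∑ i, ∑ j, a x i j * (f x * pd i (pd j g) x) = f x * ∑ i, ∑ j, a x i j * pd i (pd j g) x := by
    simp only [Finset.mul_sum]
    exact Finset.sum_congr rfl fun i _ => Finset.sum_congr rfl fun j _ => by ring
  have e4 : ∑ i, ∑ j, a x i j * (pd i (pd j f) x * g x) = g x * ∑ i, ∑ j, a x i j * pd i (pd j f) x := by
    simp only [Finset.mul_sum]
    exact Finset.sum_congr rfl fun i _ => Finset.sum_congr rfl fun j _ => by ring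
  have e5 : ∑ i, b x i * (f x * pd i g x) = f x * ∑ i, b x i * pd i g x := by
    simp only [Finset.mul_sum]
    exact Finset.sum_congr rfl fun i _ => by ring
  have e6 : ∑ i, b x i * (pd i f x * g x) = g x * ∑ i, b x i * pd i f x := by
    simp only [Finset.mul_sum]
    exact Finset.sum_congr rfl fun i _ => by ring
  rw [e3, e4, e5, e6]; ring

theorem ellOp_const (c : ℝ) (x : Eu n) : ellOp a b (fun _ => c) x = 0 := by
  have : ∀ j : Fin n, pd j (fun _ : Eu n => c) = fun _ => 0 := fun j => by ext y; simp [pd]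
  simp only [ellOp, this, mul_zero, Finset.sum_const_zero, add_zero]
  simp [pd]

theorem pd_exp {F : Eu n → ℝ} {x : Eu n} (i : Fin n) (k : ℝ) (hF : DifferentiableAt ℝ F x) :
    pd i (fun y => Real.exp (k * F y)) x = k * (Real.exp (k * F x) * pd i F x) := by
  have h := (hF.const_mul k).hasFDerivAt.exp
  simp only [pd, h.fderiv, fderiv_const_mul hF]
  simp; ring

theorem contDiffAt_exp {F : Eu n → ℝ} {x : Eu n} (k : ℝ) (hF : ContDiffAt ℝ 2 F x) :
    ContDiffAt ℝ 2 (fun y => Real.exp (k * F y)) x :=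
  (contDiffAt_const.mul hF).exp

theorem ellOp_exp {F : Eu n → ℝ} {x : Eu n} (k : ℝ) (hF : ContDiffAt ℝ 2 F x) :
    ellOp a b (fun y => Real.exp (k * F y)) x = Real.exp (k * F x) *
      (k * (ellOp a b F x + k * ∑ i, ∑ j, a x i j * pd i F x * pd j F x)) := by
  have h1 : ∀ j, pd j (fun y => Real.exp (k * F y)) =ᶠ[𝓝 x]
      fun y => k * (Real.exp (k * F y) * pd j F y) := fun j => by
    filter_upwards [eventually_differentiableAt two_ne_zero hF] with y h1 using pd_exp j k h1
  have hd := hF.differentiableAt two_ne_zero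
  have hd2 := fun j => (contDiffAt_pd_one j hF).differentiableAt one_ne_zero
  have he : DifferentiableAt ℝ (fun y => Real.exp (k * F y)) x := (hd.const_mul k).exp
  have h2 : ∀ i j, pd i (pd j fun y => Real.exp (k * F y)) x = k * (Real.exp (k * F x) *
      pd i (pd j F) x + k * (Real.exp (k * F x) * pd i F x) * pd j F x) := fun i j => by
    rw [pd_congr i (h1 j), pd_const_mul i k (he.fun_mul (hd2 j)), pd_mul i he (hd2 j), pd_exp i k hd]
  simp only [ellOp, h2, pd_exp _ k hd]
  simp only [mul_add, Finset.mul_sum, Finset.sum_add_distrib]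
  rw [add_right_comm]
  congr 1
  · congr 1
    · exact Finset.sum_congr rfl fun i _ => Finset.sum_congr rfl fun j _ => by ring
    · exact Finset.sum_congr rfl fun i _ => by ring
  · exact Finset.sum_congr rfl fun i _ => Finset.sum_congr rfl fun j _ => by ring

theorem continuousAt_ellOp {f : Eu n → ℝ} {x : Eu n} {s : Set (Eu n)}
    (ha : ∀ i j, ContinuousWithinAt (fun y => a y i j) s x)
    (hb : ∀ i, ContinuousWithinAt (fun y => b y i) s x) (hf : ContDiffAt ℝ 2 f x) :
    ContinuousWithinAt (ellOp a b f) s x := by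
  unfold ellOp
  refine ContinuousWithinAt.add (tendsto_finsetSum _ fun i _ => tendsto_finsetSum _ fun j _ => ?_)
    (tendsto_finsetSum _ fun i _ => ?_)
  · exact (ha i j).mul (continuousAt_pd_pd i j hf).continuousWithinAt
  · exact (hb i).mul (continuousAt_pd i (hf.of_le one_le_two)).continuousWithinAt

/-! ### The maximum principle for viscosity subsolutions -/

/-- At a local maximum the Hessian is nonpositive. -/
theorem hessian_nonpos {f : Eu n → ℝ} {x : Eu n} (hf : ContDiffAt ℝ 2 f x) (hx : IsLocalMax f x)
    (w : Eu n) : ∑ i, ∑ j, w i * w j * pd i (pd j f) x ≤ 0 := by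
  by_contra! hpos
  set g : ℝ → ℝ := fun t => f (x + t • w) with hg
  set q : Eu n → ℝ := fun y => ∑ j, w j * pd j f y with hq
  have hline : ∀ t : ℝ, HasDerivAt (fun t : ℝ => x + t • w) w t := fun t => by
    simpa using ((hasDerivAt_id t).smul_const w).const_add x
  have hl0 : Tendsto (fun t : ℝ => x + t • w) (𝓝 0) (𝓝 x) := by
    simpa using (hline 0).continuousAt.tendsto
  have hd1 : deriv g =ᶠ[𝓝 0] fun t => q (x + t • w) := by
    filter_upwards [hl0.eventually (eventually_differentiableAt two_ne_zero hf)] with t ht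
    have := (ht.hasFDerivAt.comp_hasDerivAt t (hline t)).deriv
    exact this.trans (fderiv_eq_sum_pd _ _ _)
  have hqd : DifferentiableAt ℝ q x := DifferentiableAt.fun_sum fun j _ =>
    ((contDiffAt_pd_one j hf).differentiableAt one_ne_zero).const_mul _
  have hd2 : deriv (deriv g) 0 = ∑ i, ∑ j, w i * w j * pd i (pd j f) x := by
    rw [hd1.deriv_eq]
    have h0 : x + (0 : ℝ) • w = x := by simp
    have h1 : HasFDerivAt q (fderiv ℝ q x) (x + (0 : ℝ) • w) := by rw [h0]; exact hqd.hasFDerivAt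
    have := (h1.comp_hasDerivAt (0 : ℝ) (hline 0)).deriv
    have h2 : deriv (fun t : ℝ => q (x + t • w)) 0 = fderiv ℝ q x w := this
    rw [h2, fderiv_eq_sum_pd]
    refine Finset.sum_congr rfl fun i _ => ?_
    rw [hq, pd_sum i fun j _ => ((contDiffAt_pd_one j hf).differentiableAt one_ne_zero).const_mul _,
      Finset.mul_sum]
    refine Finset.sum_congr rfl fun j _ => ?_
    rw [pd_const_mul i _ ((contDiffAt_pd_one j hf).differentiableAt one_ne_zero)]
    ring
  have hgmax : IsLocalMax g 0 := by
    have : ∀ᶠ t in 𝓝 (0 : ℝ), f (x + t • w) ≤ f x := hl0.eventually hx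
    simpa [IsLocalMax, IsMaxFilter, hg] using this
  have hgc : ContinuousAt g 0 := by
    have h0 : x + (0 : ℝ) • w = x := by simp
    exact ContinuousAt.comp (g := f) (by rw [h0]; exact hf.continuousAt) (hline 0).continuousAt
  have hgmin := isLocalMin_of_deriv_deriv_pos (hd2 ▸ hpos) hgmax.deriv_eq_zero hgc
  have hconst : g =ᶠ[𝓝 0] fun _ => g 0 := by
    filter_upwards [hgmax, hgmin] with t h1 h2 using le_antisymm h1 h2
  have h3 : deriv g =ᶠ[𝓝 0] fun _ => 0 :=
    hconst.eventually_nhds.mono fun t ht => by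
      rw [Filter.EventuallyEq.deriv_eq ht]; simp
  rw [← hd2, h3.deriv_eq] at hpos
  simp at hpos

theorem pd_eq_zero_of_isLocalMax {f : Eu n → ℝ} {x : Eu n} (hx : IsLocalMax f x) (i : Fin n) :
    pd i f x = 0 := by
  simp [pd, hx.fderiv_eq_zero]

theorem ellOp_nonpos_of_isLocalMax {f : Eu n → ℝ} {x : Eu n} (ha : (a x).PosSemidef)
    (hf : ContDiffAt ℝ 2 f x) (hx : IsLocalMax f x) : ellOp a b f x ≤ 0 := by
  obtain ⟨m, B, hB⟩ := Matrix.posSemidef_iff_eq_sum_vecMulVec.mp ha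
  have h1 : ∑ i, b x i * pd i f x = 0 :=
    Finset.sum_eq_zero fun i _ => by rw [pd_eq_zero_of_isLocalMax hx, mul_zero]
  have h2 : ∑ i, ∑ j, a x i j * pd i (pd j f) x =
      ∑ k, ∑ i, ∑ j, B k i * B k j * pd i (pd j f) x := by
    simp only [hB, Matrix.sum_apply, Matrix.vecMulVec_apply, star_trivial,
      Finset.sum_mul]
    rw [Finset.sum_comm (s := Finset.univ (α := Fin m)) (t := Finset.univ (α := Fin n))
      (f := fun k i => ∑ j, B k i * B k j * pd i (pd j f) x)]
    exact Finset.sum_congr rfl fun i _ => Finset.sum_comm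
  rw [ellOp, h1, h2, add_zero]
  exact Finset.sum_nonpos fun k _ => by
    simpa using hessian_nonpos hf hx (WithLp.toLp 2 (B k))

/-- The exponential of a large multiple of a function without critical points is a strict
subsolution; all barriers below are of this form. -/
theorem exists_barrier {F : Eu n → ℝ} {K : Set (Eu n)} (hK : IsCompact K)
    (ha : ∀ i j, ContinuousOn (fun y => a y i j) K) (hb : ∀ i, ContinuousOn (fun y => b y i) K)
    (hpos : ∀ y ∈ K, (a y).PosDef) (hF : ∀ y ∈ K, ContDiffAt ℝ 2 F y)
    (hdF : ∀ y ∈ K, fderiv ℝ F y ≠ 0) :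
    ∃ k : ℝ, 0 < k ∧ ∀ y ∈ K, 0 < ellOp a b (fun z => Real.exp (k * F z)) y := by
  set Q : Eu n → ℝ := fun y => ∑ i, ∑ j, a y i j * pd i F y * pd j F y
  have hPc : ContinuousOn (ellOp a b F) K := fun y hy =>
    continuousAt_ellOp (fun i j => ha i j y hy) (fun i => hb i y hy) (hF y hy)
  have hQc : ContinuousOn Q K := fun y hy => by
    have hp := fun i => (continuousAt_pd i ((hF y hy).of_le one_le_two)).continuousWithinAt (s := K)
    exact tendsto_finsetSum _ fun i _ => tendsto_finsetSum _ fun j _ =>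
      ((ha i j y hy).mul (hp i)).mul (hp j)
  have hQpos : ∀ y ∈ K, 0 < Q y := fun y hy => by
    have hne : (fun i => pd i F y) ≠ 0 := by
      intro h0
      apply hdF y hy
      ext w
      rw [fderiv_eq_sum_pd]
      simp [funext_iff] at h0
      simp [h0]
    have := (hpos y hy).dotProduct_mulVec_pos hne
    simp only [dotProduct, Matrix.mulVec, star_trivial, Pi.star_apply, Finset.mul_sum] at this
    refine this.trans_eq (Finset.sum_congr rfl fun i _ => Finset.sum_congr rfl fun j _ => ?_)
    ring
  rcases K.eq_empty_or_nonempty with rfl | hne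
  · exact ⟨1, one_pos, by simp⟩
  obtain ⟨y0, hy0, hmin⟩ := hK.exists_isMinOn hne hQc
  obtain ⟨C, hC⟩ := hK.exists_bound_of_continuousOn hPc
  have hC0 : 0 ≤ C := (norm_nonneg _).trans (hC y0 hy0)
  refine ⟨(C + 1) / Q y0, div_pos (by linarith) (hQpos y0 hy0), fun y hy => ?_⟩
  rw [ellOp_exp _ (hF y hy)]
  have h1 : C + 1 ≤ (C + 1) / Q y0 * Q y := by
    rw [div_mul_eq_mul_div, le_div_iff₀ (hQpos y0 hy0)]
    exact mul_le_mul_of_nonneg_left (hmin hy) (by linarith)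
  have h2 := neg_le_of_abs_le (hC y hy)
  refine mul_pos (Real.exp_pos _) (mul_pos (div_pos (by linarith) (hQpos y0 hy0)) ?_)
  change 0 < ellOp a b F y + (C + 1) / Q y0 * Q y
  linarith

end Local

section Local
variable {n : ℕ} {a : Eu n → Matrix (Fin n) (Fin n) ℝ} {b : Eu n → Fin n → ℝ}

/-- `φ` is a viscosity subsolution at `x`: every `C²` function which touches `φ` from above at `x`,
written here as a constant minus `ψ`, is a subsolution there. -/
def IsViscSubAt (a : Eu n → Matrix (Fin n) (Fin n) ℝ) (b : Eu n → Fin n → ℝ) (φ : Eu n → ℝ)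
    (x : Eu n) : Prop :=
  ∀ ψ : Eu n → ℝ, ContDiffAt ℝ 2 ψ x → IsLocalMax (fun y => φ y + ψ y) x → ellOp a b ψ x ≤ 0

theorem IsViscSubAt.add {φ v : Eu n → ℝ} {x : Eu n} (h : IsViscSubAt a b φ x)
    (hv : ContDiffAt ℝ 2 v x) (hLv : 0 ≤ ellOp a b v x) :
    IsViscSubAt a b (fun y => φ y + v y) x := by
  intro ψ hψ hmax
  have := h (fun y => v y + ψ y) (hv.add hψ) (by simpa only [← add_assoc] using hmax)
  rw [ellOp_add hv hψ] at this
  linarith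

theorem isViscSubAt_of_contDiffAt {v : Eu n → ℝ} {x : Eu n} (ha : (a x).PosSemidef)
    (hv : ContDiffAt ℝ 2 v x) (hLv : 0 ≤ ellOp a b v x) : IsViscSubAt a b v x := by
  intro ψ hψ hmax
  have := ellOp_nonpos_of_isLocalMax (b := b) ha (hv.add hψ) hmax
  rw [ellOp_add hv hψ] at this
  linarith

theorem IsViscSubAt.congr {φ φ' : Eu n → ℝ} {x : Eu n} (h : IsViscSubAt a b φ x)
    (he : φ =ᶠ[𝓝 x] φ') : IsViscSubAt a b φ' x := by
  intro ψ hψ hmax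
  refine h ψ hψ (hmax.congr ?_)
  filter_upwards [he] with y hy
  rw [hy]

theorem contDiff_neg_normSq (p : Eu n) : ContDiff ℝ 2 fun y : Eu n => -‖y - p‖ ^ 2 :=
  ((contDiff_id.sub contDiff_const).norm_sq ℝ).neg

theorem fderiv_neg_normSq (p y w : Eu n) :
    fderiv ℝ (fun y : Eu n => -‖y - p‖ ^ 2) y w = -(2 * inner ℝ (y - p) w) := by
  have h : HasFDerivAt (fun y : Eu n => ‖y - p‖ ^ 2) (2 • (innerSL ℝ (y - p)).comp
    (ContinuousLinearMap.id ℝ (Eu n))) y := ((hasFDerivAt_id y).sub_const p).norm_sq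
  rw [show (fun y : Eu n => -‖y - p‖ ^ 2) = -fun y : Eu n => ‖y - p‖ ^ 2 from rfl, h.neg.fderiv]
  simp [inner_sub_left]

/-- The set where a viscosity subsolution attains its maximum is open (Hopf's strong maximum
principle): at a boundary point of this set with an interior sphere condition, adding a small
multiple of the Hopf barrier would produce an interior maximum. -/
theorem eventually_eq_of_isViscSubAt {O : Set (Eu n)} (hO : IsOpen O) {φ : Eu n → ℝ} {m : ℝ}
    (hφ : ContinuousOn φ O)
    (ha : ∀ i j, ContinuousOn (fun y => a y i j) O) (hb : ∀ i, ContinuousOn (fun y => b y i) O)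
    (hpos : ∀ y ∈ O, (a y).PosDef) (hsub : ∀ y ∈ O, IsViscSubAt a b φ y)
    (hle : ∀ y ∈ O, φ y ≤ m) {x₀ : Eu n} (hx₀ : x₀ ∈ O) (hm : φ x₀ = m) :
    ∀ᶠ y in 𝓝 x₀, φ y = m := by
  obtain ⟨r', hr', hball⟩ := Metric.isOpen_iff.mp hO x₀ hx₀
  obtain ⟨r, hr, rfl⟩ : ∃ r, 0 < r ∧ r' = 3 * r := ⟨r' / 3, by positivity, by ring⟩
  filter_upwards [Metric.ball_mem_nhds x₀ hr] with y hy
  by_contra hne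
  have hsubset : Metric.closedBall y (dist y x₀) ⊆ O := fun w hw => hball <| by
    have := dist_triangle w y x₀
    rw [Metric.mem_closedBall] at hw
    rw [Metric.mem_ball] at hy ⊢
    linarith
  have hyO : y ∈ O := hsubset (Metric.mem_closedBall_self dist_nonneg)
  -- the point of the maximum set closest to `y`
  obtain ⟨z, ⟨hzb, hzm⟩, hzmin⟩ : ∃ z ∈ Metric.closedBall y (dist y x₀) ∩ {w | φ w = m},
      ∀ w ∈ Metric.closedBall y (dist y x₀) ∩ {w | φ w = m}, dist z y ≤ dist w y := by
    have hcl : IsCompact (Metric.closedBall y (dist y x₀) ∩ {w | φ w = m}) := by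
      have := (hφ.mono hsubset).preimage_isClosed_of_isClosed Metric.isClosed_closedBall
        (isClosed_singleton (x := m))
      exact (isCompact_closedBall y (dist y x₀)).of_isClosed_subset this inter_subset_left
    exact hcl.exists_isMinOn ⟨x₀, by simp [dist_comm], hm⟩
      (f := fun w => dist w y) (by fun_prop)
  set ρ := dist z y with hρ
  have hρpos : 0 < ρ := dist_pos.mpr fun h => hne (h ▸ hzm)
  have hρle : ρ ≤ dist y x₀ := hzb
  have hlt : ∀ w, dist w y < ρ → φ w < m := fun w hw => by
    have hw' : w ∈ Metric.closedBall y (dist y x₀) := (hw.le.trans hρle)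
    exact lt_of_le_of_ne (hle w (hsubset hw')) fun h => absurd (hzmin w ⟨hw', h⟩) (not_le.mpr hw)
  -- a ball of half the radius, which touches the maximum set at `z` only
  set p : Eu n := midpoint ℝ y z
  have hpz : z - p = p - y := by
    have h2 : p + p = y + z := midpoint_add_self ℝ y z
    rw [sub_eq_sub_iff_add_eq_add, h2, add_comm]
  have hpy : ‖p - y‖ = ρ / 2 := by
    have : ρ = ‖(z - p) + (p - y)‖ := by rw [hρ, dist_eq_norm]; congr 1; abel
    rw [hpz, ← two_smul ℝ, norm_smul] at this
    norm_num at this; linarith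
  have hlt' : ∀ w, dist w p ≤ ρ / 2 → w ≠ z → φ w < m := fun w hw hwz => by
    refine hlt w (lt_of_not_ge fun hge => hwz ?_)
    rw [dist_eq_norm] at hw hge
    have hpar := parallelogram_law_with_norm ℝ (w - p) (p - y)
    rw [show w - p + (p - y) = w - y by abel, hpy] at hpar
    have : ‖w - p - (p - y)‖ = 0 := by
      nlinarith [norm_nonneg (w - p), norm_nonneg (w - p - (p - y))]
    rw [norm_eq_zero, ← hpz] at this
    simpa [sub_eq_zero] using this
  set K := Metric.closedBall z (ρ / 4)
  have hKO : K ⊆ O := fun w hw => hball <| by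
    have h1 := dist_triangle w z x₀
    have h2 := dist_triangle z y x₀
    have h3 : dist w z ≤ ρ / 4 := hw
    rw [Metric.mem_ball] at hy ⊢
    linarith
  obtain ⟨k, hk, hkL⟩ := exists_barrier (F := fun w => -‖w - p‖ ^ 2) (a := a) (b := b)
    (isCompact_closedBall z (ρ / 4)) (fun i j => (ha i j).mono hKO) (fun i => (hb i).mono hKO)
    (fun w hw => hpos w (hKO hw)) (fun w _ => (contDiff_neg_normSq p).contDiffAt) (by
      intro w hw h0
      have h1 := fderiv_neg_normSq p w (w - p)
      rw [h0, real_inner_self_eq_norm_sq] at h1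
      have h2 : ‖w - p‖ = 0 := by simpa using h1
      have h3 : dist w z ≤ ρ / 4 := hw
      rw [norm_eq_zero, sub_eq_zero] at h2
      rw [h2, dist_comm, dist_eq_norm, hpz, hpy] at h3
      linarith)
  set h : Eu n → ℝ := fun w => Real.exp (k * -‖w - p‖ ^ 2)
  have hcont : Continuous h := by fun_prop
  have hh1 : ∀ w, h w ≤ 1 := fun w => Real.exp_le_one_iff.mpr (by
    have := mul_nonneg hk.le (sq_nonneg ‖w - p‖); linarith)
  have hhz : h z = Real.exp (k * -(ρ / 2) ^ 2) := by simp only [h]; rw [hpz, hpy]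
  obtain ⟨δ, hδ, hδS⟩ : ∃ δ > 0, ∀ w ∈ Metric.sphere z (ρ / 4) ∩ Metric.closedBall p (ρ / 2),
      φ w ≤ m - δ := by
    have hc : IsCompact (Metric.sphere z (ρ / 4) ∩ Metric.closedBall p (ρ / 2)) :=
      (isCompact_sphere z (ρ / 4)).inter_right Metric.isClosed_closedBall
    rcases (Metric.sphere z (ρ / 4) ∩ Metric.closedBall p (ρ / 2)).eq_empty_or_nonempty with he | he
    · exact ⟨1, one_pos, by simp [he]⟩
    obtain ⟨w0, hw0, hmax⟩ := hc.exists_isMaxOn he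
      (hφ.mono fun w hw => hKO (Metric.sphere_subset_closedBall hw.1))
    refine ⟨m - φ w0, sub_pos.mpr (hlt' w0 hw0.2 ?_), fun w hw => by simpa using hmax hw⟩
    rintro rfl
    have : dist w0 w0 = ρ / 4 := hw0.1
    simp at this; linarith
  obtain ⟨w, hwK, hwmax⟩ := (isCompact_closedBall z (ρ / 4)).exists_isMaxOn
    ⟨z, Metric.mem_closedBall_self (by positivity)⟩
    ((hφ.mono hKO).add (hcont.const_mul (δ / 2) |>.continuousOn) :
      ContinuousOn (fun w => φ w + δ / 2 * h w) K)
  have hzw : φ z + δ / 2 * h z ≤ φ w + δ / 2 * h w :=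
    hwmax (Metric.mem_closedBall_self (by positivity : (0 : ℝ) ≤ ρ / 4))
  rw [show φ z = m from hzm] at hzw
  have hhzpos : 0 < h z := Real.exp_pos _
  have hint : w ∈ Metric.ball z (ρ / 4) := by
    refine lt_of_le_of_ne (Metric.mem_closedBall.mp hwK) fun hs => ?_
    by_cases hwp : dist w p ≤ ρ / 2
    · have h1 := hδS w ⟨hs, hwp⟩
      have h2 := hh1 w
      nlinarith
    · have h1 : h w < h z := by
        rw [hhz]
        refine Real.exp_lt_exp.mpr (mul_lt_mul_of_pos_left ?_ hk)
        rw [not_le, dist_eq_norm] at hwp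
        have : (ρ / 2) ^ 2 < ‖w - p‖ ^ 2 := pow_lt_pow_left₀ hwp (by positivity) two_ne_zero
        linarith
      have h2 := hle w (hKO hwK)
      nlinarith
  have hloc : IsLocalMax (fun w => φ w + δ / 2 * h w) w :=
    hwmax.isLocalMax (Filter.mem_of_superset (Metric.isOpen_ball.mem_nhds hint)
      Metric.ball_subset_closedBall)
  have hhC : ContDiffAt ℝ 2 h w := contDiffAt_exp k (contDiff_neg_normSq p).contDiffAt
  have h1 := hsub w (hKO hwK) _ (contDiffAt_const.mul hhC) hloc
  rw [ellOp_const_mul _ hhC] at h1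
  exact absurd h1 (not_le.mpr (mul_pos (by positivity) (hkL w hwK)))

/-- The product `κ u` of a `C²` function `κ` and a `C¹` function `u` is a viscosity subsolution if
`u L κ + 2 aᵢⱼ ∂ᵢu ∂ⱼκ = 0` and `u` is a uniform limit of solutions `ψ N`. The gradients of the `ψ N`
need not converge to that of `u`; but at a maximum of `κ ψ N + h` they are determined by the
vanishing of the gradient, and so they converge along these maxima. -/
theorem isViscSubAt_mul {O : Set (Eu n)} {x₀ : Eu n} (hO : O ∈ 𝓝 x₀) {κ u : Eu n → ℝ}
    {ψ : ℕ → Eu n → ℝ} (ha : ∀ i j, ContinuousAt (fun y => a y i j) x₀)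
    (hb : ∀ i, ContinuousAt (fun y => b y i) x₀)
    (hpos : ∀ y ∈ O, (a y).PosDef) (hκ : ContDiffAt ℝ 2 κ x₀) (hκ0 : κ x₀ ≠ 0)
    (hu : DifferentiableAt ℝ u x₀)
    (heq : u x₀ * ellOp a b κ x₀ + 2 * ∑ i, ∑ j, a x₀ i j * pd i u x₀ * pd j κ x₀ = 0)
    (hψ : ∀ N, ∀ y ∈ O, ContDiffAt ℝ 2 (ψ N) y) (hLψ : ∀ N, ∀ y ∈ O, ellOp a b (ψ N) y = 0)
    (hlim : TendstoUniformlyOn ψ u atTop O) (huc : ContinuousOn u O) :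
    IsViscSubAt a b (fun y => κ y * u y) x₀ := by
  intro h₀ hh₀ hmax₀
  have hq : ContDiffAt ℝ 2 (fun y : Eu n => -‖y - x₀‖ ^ 2) x₀ := (contDiff_neg_normSq x₀).contDiffAt
  -- it suffices to treat strict maxima
  suffices hs : ∀ δ > 0, ellOp a b h₀ x₀ + δ * ellOp a b (fun y : Eu n => -‖y - x₀‖ ^ 2) x₀ ≤ 0 by
    have ht : Tendsto (fun δ : ℝ => ellOp a b h₀ x₀ +
        δ * ellOp a b (fun y : Eu n => -‖y - x₀‖ ^ 2) x₀) (𝓝[>] 0) (𝓝 (ellOp a b h₀ x₀)) := by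
      have : ContinuousAt (fun δ : ℝ => ellOp a b h₀ x₀ +
        δ * ellOp a b (fun y : Eu n => -‖y - x₀‖ ^ 2) x₀) 0 := by fun_prop
      simpa [ContinuousAt] using this.tendsto.mono_left nhdsWithin_le_nhds
    exact le_of_tendsto ht (by filter_upwards [self_mem_nhdsWithin] with δ hδ using hs δ hδ)
  intro δ hδ
  set h : Eu n → ℝ := fun y => h₀ y + δ * -‖y - x₀‖ ^ 2
  have hh : ContDiffAt ℝ 2 h x₀ := hh₀.add (contDiffAt_const.mul hq)
  rw [← ellOp_const_mul δ hq, ← ellOp_add hh₀ (contDiffAt_const.mul hq)]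
  change ellOp a b h x₀ ≤ 0
  have hmax : IsLocalMax (fun y => κ y * u y + h y) x₀ := by
    filter_upwards [hmax₀] with y hy
    simp only [h, sub_self, norm_zero]
    have : 0 ≤ δ * ‖y - x₀‖ ^ 2 := by positivity
    linarith
  obtain ⟨ρ, hρ, hball⟩ : ∃ ρ > 0, Metric.closedBall x₀ ρ ⊆ {y | y ∈ O ∧ ContDiffAt ℝ 2 κ y ∧
      ContDiffAt ℝ 2 h y ∧ κ y ≠ 0 ∧ κ y * u y + h₀ y ≤ κ x₀ * u x₀ + h₀ x₀} := by
    refine Metric.nhds_basis_closedBall.mem_iff.mp ?_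
    filter_upwards [hO, hκ.eventually (by simp), hh.eventually (by simp),
      hκ.continuousAt.eventually_ne hκ0, hmax₀] with y h1 h2 h3 h4 h5 using ⟨h1, h2, h3, h4, h5⟩
  set B := Metric.closedBall x₀ ρ
  have hBc : IsCompact B := isCompact_closedBall x₀ ρ
  have hκc : ContinuousOn κ B := fun y hy => (hball hy).2.1.continuousAt.continuousWithinAt
  obtain ⟨C, hC⟩ := hBc.exists_bound_of_continuousOn hκc
  have hf : ∀ N, ContinuousOn (fun y => κ y * ψ N y + h y) B := fun N =>
    (hκc.mul fun y hy => (hψ N y (hball hy).1).continuousAt.continuousWithinAt).add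
      fun y hy => (hball hy).2.2.1.continuousAt.continuousWithinAt
  have hx₀B : x₀ ∈ B := Metric.mem_closedBall_self hρ.le
  choose y hyB hymax using fun N => hBc.exists_isMaxOn ⟨x₀, hx₀B⟩ (hf N)
  have hy : Tendsto y atTop (𝓝 x₀) := by
    rw [tendsto_iff_norm_sub_tendsto_zero]
    have hsq : Tendsto (fun N => ‖y N - x₀‖ ^ 2) atTop (𝓝 0) := by
      rw [Metric.tendsto_nhds]
      intro ε hε
      have hC0 : 0 ≤ C := (norm_nonneg _).trans (hC x₀ hx₀B)
      filter_upwards [Metric.tendstoUniformlyOn_iff.mp hlim (δ * ε / (4 * (C + 1)))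
        (by positivity)] with N hN
      have h1 : κ x₀ * ψ N x₀ + h x₀ ≤ κ (y N) * ψ N (y N) + h (y N) := hymax N hx₀B
      have h2 := (hball (hyB N)).2.2.2.2
      have key : ∀ z ∈ B, |κ z * (u z - ψ N z)| ≤ δ * ε / 4 := fun z hz => by
        rw [abs_mul]
        have e1 : |κ z| ≤ C + 1 := (hC z hz).trans (by linarith)
        have e2 := (hN z (hball hz).1).le
        rw [Real.dist_eq] at e2
        calc |κ z| * |u z - ψ N z| ≤ (C + 1) * (δ * ε / (4 * (C + 1))) := by gcongr
          _ = δ * ε / 4 := by field_simp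
      have e1 := abs_le.mp (key x₀ hx₀B)
      have e2 := abs_le.mp (key (y N) (hyB N))
      simp only [h, sub_self, norm_zero] at h1
      rw [Real.dist_eq, sub_zero, abs_of_nonneg (by positivity)]
      have : δ * ‖y N - x₀‖ ^ 2 < δ * ε := by nlinarith
      exact lt_of_mul_lt_mul_left this hδ.le
    have := hsq.sqrt
    simpa using this
  have hint : ∀ᶠ N in atTop, y N ∈ Metric.ball x₀ ρ := hy.eventually (Metric.ball_mem_nhds x₀ hρ)
  have huy : Tendsto (fun N => ψ N (y N)) atTop (𝓝 (u x₀)) := by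
    have h1 : Tendsto (fun N => u (y N)) atTop (𝓝 (u x₀)) := (huc.continuousAt hO).tendsto.comp hy
    have h2 : Tendsto (fun N => u (y N) - ψ N (y N)) atTop (𝓝 0) := by
      rw [Metric.tendsto_nhds]
      intro ε hε
      filter_upwards [Metric.tendstoUniformlyOn_iff.mp hlim ε hε] with N hN
      simpa [Real.dist_eq] using hN (y N) (hball (hyB N)).1
    simpa using h1.sub h2
  -- the operator at a maximum, after elimination of the gradient of `ψ N`
  set Θ : ℝ × Eu n → ℝ := fun p => p.1 * ellOp a b κ p.2 + 2 * (∑ i, ∑ j, a p.2 i j *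
    (-(p.1 * pd i κ p.2 + pd i h p.2) / κ p.2) * pd j κ p.2) + ellOp a b h p.2
  have hΘ : ContinuousAt Θ (u x₀, x₀) := by
    have hsnd : Tendsto (Prod.snd : ℝ × Eu n → Eu n) (𝓝 (u x₀, x₀)) (𝓝 x₀) :=
      continuous_snd.continuousAt
    have hfst : Tendsto (Prod.fst : ℝ × Eu n → ℝ) (𝓝 (u x₀, x₀)) (𝓝 (u x₀)) :=
      continuous_fst.continuousAt
    have c1 : ∀ f : Eu n → ℝ, ContDiffAt ℝ 2 f x₀ → Tendsto (fun p : ℝ × Eu n => ellOp a b f p.2)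
        (𝓝 (u x₀, x₀)) (𝓝 (ellOp a b f x₀)) := fun f hf => by
      have := continuousAt_ellOp (s := univ) (fun i j => (ha i j).continuousWithinAt)
        (fun i => (hb i).continuousWithinAt) hf
      rw [continuousWithinAt_univ] at this
      exact this.tendsto.comp hsnd
    have c2 : ∀ f : Eu n → ℝ, ContDiffAt ℝ 2 f x₀ → ∀ i, Tendsto (fun p : ℝ × Eu n => pd i f p.2)
        (𝓝 (u x₀, x₀)) (𝓝 (pd i f x₀)) := fun f hf i =>
      (continuousAt_pd i (hf.of_le one_le_two)).tendsto.comp hsnd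
    refine ((hfst.mul (c1 κ hκ)).add (Tendsto.const_mul 2 (tendsto_finsetSum _ fun i _ =>
      tendsto_finsetSum _ fun j _ => ?_))).add (c1 h hh)
    exact (((ha i j).tendsto.comp hsnd).mul ((((hfst.mul (c2 κ hκ i)).add (c2 h hh i)).neg).div
      (hκ.continuousAt.tendsto.comp hsnd) hκ0)).mul (c2 κ hκ j)
  have hΘN : ∀ᶠ N in atTop, Θ (ψ N (y N), y N) ≤ 0 := by
    filter_upwards [hint] with N hN
    obtain ⟨g1, g2, g3, g4, -⟩ := hball (hyB N)
    have g5 := hψ N _ g1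
    have hloc : IsLocalMax (fun z => κ z * ψ N z + h z) (y N) := (hymax N).isLocalMax
      (Filter.mem_of_superset (Metric.isOpen_ball.mem_nhds hN) Metric.ball_subset_closedBall)
    have hL := ellOp_nonpos_of_isLocalMax (b := b) (hpos _ g1).posSemidef ((g2.mul g5).add g3) hloc
    have hgrad : ∀ i, pd i (ψ N) (y N) =
        -(ψ N (y N) * pd i κ (y N) + pd i h (y N)) / κ (y N) := fun i => by
      have h1 := pd_eq_zero_of_isLocalMax hloc i
      rw [pd_add i ((g2.mul g5).differentiableAt two_ne_zero) (g3.differentiableAt two_ne_zero),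
        pd_mul i (g2.differentiableAt two_ne_zero) (g5.differentiableAt two_ne_zero)] at h1
      rw [eq_div_iff g4]
      linarith
    rw [ellOp_add (g2.mul g5) g3, show (fun z => κ z * ψ N z) = fun z => ψ N z * κ z by
      ext z; ring, ellOp_mul (by simpa using (hpos _ g1).isHermitian) g5 g2, hLψ N _ g1] at hL
    simp only [hgrad, mul_zero, add_zero] at hL
    exact hL
  have hfin : Θ (u x₀, x₀) ≤ 0 := le_of_tendsto (hΘ.tendsto.comp (huy.prodMk_nhds hy)) hΘN
  have hgrad : ∀ i, -(u x₀ * pd i κ x₀ + pd i h x₀) / κ x₀ = pd i u x₀ := fun i => by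
    have h1 := pd_eq_zero_of_isLocalMax hmax i
    rw [pd_add i ((hκ.differentiableAt two_ne_zero).fun_mul hu) (hh.differentiableAt two_ne_zero),
      pd_mul i (hκ.differentiableAt two_ne_zero) hu] at h1
    rw [div_eq_iff hκ0]
    linarith
  simp only [Θ, hgrad, heq, zero_add] at hfin
  exact hfin

end Local

/-! ### The Laplace-Beltrami operator in coordinates -/

section Laplacian

variable {n : ℕ} {G : Eu n → Matrix (Fin n) (Fin n) ℝ}

/-- The coefficients `√(det G) G^{ij}` of the divergence form of the Laplace-Beltrami operator. -/
def divCoeff (G : Eu n → Matrix (Fin n) (Fin n) ℝ) (i j : Fin n) (y : Eu n) : ℝ :=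
  √(G y).det * (G y)⁻¹ i j

/-- The first order coefficients of the Laplace-Beltrami operator. -/
def driftCoeff (G : Eu n → Matrix (Fin n) (Fin n) ℝ) (y : Eu n) (j : Fin n) : ℝ :=
  (√(G y).det)⁻¹ * ∑ i, pd i (divCoeff G i j) y

/-- The Laplace-Beltrami operator of `G` in nondivergence form. -/
abbrev lapOp (G : Eu n → Matrix (Fin n) (Fin n) ℝ) (f : Eu n → ℝ) (y : Eu n) : ℝ :=
  ellOp (fun z => (G z)⁻¹) (driftCoeff G) f y

theorem contDiffAt_det {y : Eu n} {m : ℕ∞ω} (hG : ∀ i j, ContDiffAt ℝ m (fun z => G z i j) y) :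
    ContDiffAt ℝ m (fun z => (G z).det) y := by
  simp only [Matrix.det_apply]
  exact ContDiffAt.sum fun σ _ => (contDiffAt_prod fun i _ => hG _ _).const_smul _

theorem contDiffAt_inv {y : Eu n} {m : ℕ∞ω} (hG : ∀ i j, ContDiffAt ℝ m (fun z => G z i j) y)
    (hdet : (G y).det ≠ 0) (i j : Fin n) : ContDiffAt ℝ m (fun z => (G z)⁻¹ i j) y := by
  simp only [Matrix.inv_def, Matrix.smul_apply, Ring.inverse_eq_inv', smul_eq_mul,
    Matrix.adjugate_apply]
  refine ((contDiffAt_det hG).inv hdet).mul (contDiffAt_det (G := fun z =>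
    (G z).updateRow j (Pi.single i 1)) fun k l => ?_)
  simp only [Matrix.updateRow_apply]
  split_ifs
  · exact contDiffAt_const
  · exact hG k l

theorem contDiffAt_divCoeff {y : Eu n} {m : ℕ∞ω}
    (hG : ∀ i j, ContDiffAt ℝ m (fun z => G z i j) y) (hdet : 0 < (G y).det) (i j : Fin n) :
    ContDiffAt ℝ m (divCoeff G i j) y :=
  ((contDiffAt_det hG).sqrt hdet.ne').mul (contDiffAt_inv hG hdet.ne' i j)

theorem continuousAt_driftCoeff {y : Eu n} (hG : ∀ i j, ContDiffAt ℝ 1 (fun z => G z i j) y)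
    (hdet : 0 < (G y).det) (j : Fin n) : ContinuousAt (fun z => driftCoeff G z j) y :=
  (((contDiffAt_det hG).sqrt hdet.ne').continuousAt.inv₀ (Real.sqrt_pos.mpr hdet).ne').mul
    (tendsto_finsetSum _ fun i _ => continuousAt_pd i (contDiffAt_divCoeff hG hdet i j))

theorem sum_pd_divCoeff {y : Eu n} (hG : ∀ i j, ContDiffAt ℝ 1 (fun z => G z i j) y)
    (hdet : 0 < (G y).det) {f : Eu n → ℝ} (hf : ContDiffAt ℝ 2 f y) :
    ∑ i, pd i (fun z => ∑ j, divCoeff G i j z * pd j f z) y = √(G y).det * lapOp G f y := by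
  have hs : √(G y).det ≠ 0 := (Real.sqrt_pos.mpr hdet).ne'
  have hd := fun i j => (contDiffAt_divCoeff hG hdet i j).differentiableAt one_ne_zero
  have hp := fun j => (contDiffAt_pd_one j hf).differentiableAt one_ne_zero
  have h1 : ∀ i, pd i (fun z => ∑ j, divCoeff G i j z * pd j f z) y =
      ∑ j, (divCoeff G i j y * pd i (pd j f) y + pd i (divCoeff G i j) y * pd j f y) := fun i => by
    rw [pd_sum i fun j _ => (hd i j).fun_mul (hp j)]
    exact Finset.sum_congr rfl fun j _ => pd_mul i (hd i j) (hp j)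
  simp only [h1, Finset.sum_add_distrib, lapOp, ellOp, mul_add]
  congr 1
  · simp only [divCoeff, Finset.mul_sum, mul_assoc]
  · rw [Finset.sum_comm, Finset.mul_sum]
    refine Finset.sum_congr rfl fun j _ => ?_
    rw [driftCoeff, ← mul_assoc, mul_inv_cancel_left₀ hs, Finset.sum_mul]

theorem coordLaplacian_eq_lapOp {y : Eu n} (hG : ∀ i j, ContDiffAt ℝ 1 (fun z => G z i j) y)
    (hdet : 0 < (G y).det) {f : Eu n → ℝ} (hf : ContDiffAt ℝ 2 f y) :
    coordLaplacian G f y = lapOp G f y := by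
  have h := sum_pd_divCoeff hG hdet hf
  simp only [divCoeff, mul_assoc, ← Finset.mul_sum] at h
  rw [coordLaplacian, h, inv_mul_cancel_left₀ (Real.sqrt_pos.mpr hdet).ne']

theorem divCoeff_conformal (hn : 3 ≤ n) {c : ℝ} (hc : 0 < c) {H : Matrix (Fin n) (Fin n) ℝ}
    (hdet : 0 < H.det) (i j : Fin n) :
    √((c ^ (4 / ((n : ℝ) - 2))) • H).det * ((c ^ (4 / ((n : ℝ) - 2))) • H)⁻¹ i j =
      c ^ 2 * (√H.det * H⁻¹ i j) := by
  have hn' : (0 : ℝ) < (n : ℝ) - 2 := by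
    have : (3 : ℝ) ≤ n := by exact_mod_cast hn
    linarith
  set q : ℝ := 4 / ((n : ℝ) - 2) with hq
  have hcq : 0 < c ^ q := Real.rpow_pos_of_pos hc q
  have h1 : √((c ^ q) • H).det = c ^ (q * n / 2) * √H.det := by
    rw [Matrix.det_smul, Fintype.card_fin, Real.sqrt_mul (by positivity)]
    congr 1
    rw [Real.sqrt_eq_rpow, ← Real.rpow_natCast, ← Real.rpow_mul hc.le, ← Real.rpow_mul hc.le]
    congr 1
    ring
  have h2 : ((c ^ q) • H)⁻¹ = (c ^ (-q)) • H⁻¹ := by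
    have : Invertible (c ^ q) := invertibleOfNonzero hcq.ne'
    rw [Matrix.inv_smul _ _ (isUnit_iff_ne_zero.mpr hdet.ne'), invOf_eq_inv, Real.rpow_neg hc.le]
  have h3 : c ^ (q * n / 2) * c ^ (-q) = c ^ 2 := by
    rw [← Real.rpow_add hc, ← Real.rpow_natCast]
    congr 1
    rw [hq]; field_simp; push_cast; ring
  rw [h1, h2, Matrix.smul_apply, smul_eq_mul, ← h3]
  ring

/-- Harmonicity with respect to the conformally changed metric `u^(4/(n-2)) G` is a linear equation in
which only first derivatives of `u` occur, so that `u` need not be of class `C²`. -/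
theorem lapOp_of_coordLaplacian_conformal (hn : 3 ≤ n) {y : Eu n}
    (hG : ∀ i j, ContDiffAt ℝ 1 (fun z => G z i j) y) (hdet : 0 < (G y).det) {u f : Eu n → ℝ}
    (hu : ContDiffAt ℝ 1 u y) (hupos : 0 < u y) {G' : Eu n → Matrix (Fin n) (Fin n) ℝ}
    (hG' : ∀ᶠ z in 𝓝 y, G' z = (u z ^ (4 / ((n : ℝ) - 2))) • G z)
    (hf : ContDiffAt ℝ 2 f y) (hLf : coordLaplacian G' f y = 0) :
    u y * lapOp G f y + 2 * ∑ i, ∑ j, (G y)⁻¹ i j * pd i u y * pd j f y = 0 := by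
  have hs : 0 < √(G y).det := Real.sqrt_pos.mpr hdet
  have hd := fun i j => (contDiffAt_divCoeff hG hdet i j).differentiableAt one_ne_zero
  have hp := fun j => (contDiffAt_pd_one j hf).differentiableAt one_ne_zero
  have hud := hu.differentiableAt one_ne_zero
  have hX : ∀ i, DifferentiableAt ℝ (fun z => ∑ j, divCoeff G i j z * pd j f z) y := fun i =>
    DifferentiableAt.fun_sum fun j _ => (hd i j).mul (hp j)
  have hev : ∀ i, (fun z => √(G' z).det * ∑ j, (G' z)⁻¹ i j * pd j f z) =ᶠ[𝓝 y]
      fun z => u z * u z * ∑ j, divCoeff G i j z * pd j f z := fun i => by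
    filter_upwards [hG', hu.continuousAt.eventually (lt_mem_nhds hupos),
      (contDiffAt_det hG).continuousAt.eventually (lt_mem_nhds hdet)] with z h1 h2 h3
    simp only [h1, Finset.mul_sum, ← mul_assoc, divCoeff_conformal hn h2 h3, divCoeff, pow_two]
  have hdet' : 0 < (G' y).det := by
    rw [hG'.self_of_nhds, Matrix.det_smul]
    exact mul_pos (pow_pos (Real.rpow_pos_of_pos hupos _) _) hdet
  rw [coordLaplacian, mul_eq_zero, or_iff_right (inv_ne_zero (Real.sqrt_pos.mpr hdet').ne')] at hLf
  have h4 : ∀ i, pd i (fun z => √(G' z).det * ∑ j, (G' z)⁻¹ i j * pd j f z) y =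
      u y * u y * pd i (fun z => ∑ j, divCoeff G i j z * pd j f z) y +
        2 * u y * (pd i u y * ∑ j, divCoeff G i j y * pd j f y) := fun i => by
    rw [pd_congr i (hev i), pd_mul i (hud.fun_mul hud) (hX i), pd_mul i hud hud]
    ring
  simp only [h4, Finset.sum_add_distrib, ← Finset.mul_sum] at hLf
  rw [sum_pd_divCoeff hG hdet hf] at hLf
  have h5 : ∑ i, pd i u y * ∑ j, divCoeff G i j y * pd j f y =
      √(G y).det * ∑ i, ∑ j, (G y)⁻¹ i j * pd i u y * pd j f y := by
    simp only [Finset.mul_sum, divCoeff]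
    exact Finset.sum_congr rfl fun i _ => Finset.sum_congr rfl fun j _ => by ring
  rw [h5] at hLf
  have h6 : (u y * √(G y).det) * (u y * lapOp G f y +
      2 * ∑ i, ∑ j, (G y)⁻¹ i j * pd i u y * pd j f y) = 0 := by linarith
  exact (mul_eq_zero.mp h6).resolve_left (mul_pos hupos hs).ne'

/-- The Euclidean Laplacian `∑ᵢ ∂ᵢ∂ᵢ f`. -/
def flatLap (f : Eu n → ℝ) (y : Eu n) : ℝ := ∑ i, pd i (pd i f) y

theorem lapOp_one (f : Eu n → ℝ) (y : Eu n) :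
    lapOp (fun _ => (1 : Matrix (Fin n) (Fin n) ℝ)) f y = flatLap f y := by
  have h : ∀ i j : Fin n, divCoeff (fun _ : Eu n => (1 : Matrix (Fin n) (Fin n) ℝ)) i j =
      fun _ => (1 : Matrix (Fin n) (Fin n) ℝ) i j := fun i j => by ext z; simp [divCoeff]
  have h2 : driftCoeff (fun _ : Eu n => (1 : Matrix (Fin n) (Fin n) ℝ)) = fun _ _ => 0 := by
    ext z j; simp only [driftCoeff, h]; simp [pd]
  simp only [lapOp, ellOp, h2, flatLap]
  simp [Matrix.one_apply]

/-- Conformal covariance: if `U` is harmonic and `f` is harmonic for `U^(4/(n-2)) δ`, then `U f` is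
harmonic. -/
theorem flatLap_mul_eq_zero (hn : 3 ≤ n) {y : Eu n} {U f : Eu n → ℝ} (hU : ContDiffAt ℝ 2 U y)
    (hUpos : 0 < U y) (hLU : flatLap U y = 0)
    (hG : ∀ᶠ z in 𝓝 y, G z = (U z ^ (4 / ((n : ℝ) - 2))) • (1 : Matrix (Fin n) (Fin n) ℝ))
    (hf : ContDiffAt ℝ 2 f y) (hLf : coordLaplacian G f y = 0) :
    flatLap (fun z => U z * f z) y = 0 := by
  have h := lapOp_of_coordLaplacian_conformal hn (G := fun _ => (1 : Matrix (Fin n) (Fin n) ℝ))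
    (fun i j => contDiffAt_const) (by simp) (hU.of_le one_le_two) hUpos hG hf hLf
  have h2 := ellOp_mul (a := fun _ : Eu n => (1 : Matrix (Fin n) (Fin n) ℝ)⁻¹)
    (b := driftCoeff fun _ => 1) (by simp) hU hf
  simp only [lapOp_one] at h
  change lapOp (fun _ => (1 : Matrix (Fin n) (Fin n) ℝ)) _ y = U y *
    lapOp (fun _ => (1 : Matrix (Fin n) (Fin n) ℝ)) _ y + _ + f y *
    lapOp (fun _ => (1 : Matrix (Fin n) (Fin n) ℝ)) _ y at h2
  simp only [lapOp_one] at h2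
  rw [h2, hLU, mul_zero, add_zero]
  exact h

end Laplacian

/-! ### Metrics and functions in charts -/

section Charts

variable {n : ℕ} {M : Type*} [TopologicalSpace M] [ChartedSpace (Eu n) M] [IsManifold (𝓡 n) ∞ M]
  {e : OpenPartialHomeomorph M (Eu n)}

theorem mdifferentiable_of_mem_maximalAtlas (he : e ∈ IsManifold.maximalAtlas (𝓡 n) ∞ M) :
    e.MDifferentiable (𝓡 n) (𝓡 n) :=
  have h1 : e ∈ IsManifold.maximalAtlas (𝓡 n) 1 M :=
    IsManifold.maximalAtlas_subset_of_le ENat.LEInfty.out he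
  ⟨fun _ hx => (mdifferentiableAt_of_mem_maximalAtlas h1 hx).mdifferentiableWithinAt,
    fun _ hx => (mdifferentiableAt_symm_of_mem_maximalAtlas h1 hx).mdifferentiableWithinAt⟩

theorem contMDiffOn_coordinateField (he : e ∈ IsManifold.maximalAtlas (𝓡 n) ∞ M) (w : Eu n) :
    ContMDiffOn (𝓡 n) (𝓡 n).tangent 1
      (fun y : Eu n => TotalSpace.mk' (Eu n) (E := fun x : M => TangentSpace (𝓡 n) x) (e.symm y)
        (mfderiv 𝓘(ℝ, Eu n) (𝓡 n) e.symm y w)) e.target := by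
  have h1 := (contMDiffOn_symm_of_mem_maximalAtlas he).contMDiffOn_tangentMapWithin (m := 1)
    (by rw [one_add_one_eq_two]; exact ENat.LEInfty.out) e.open_target.uniqueMDiffOn
  have h2 : ContMDiff (𝓡 n) (𝓡 n).tangent 1
      (fun y : Eu n => (TotalSpace.mk' (Eu n) y w : TangentBundle (𝓡 n) (Eu n))) :=
    contMDiff_vectorSpace_iff_contDiff.mpr contDiff_const
  have h3 := h1.comp h2.contMDiffOn (s := e.target) (fun y hy => hy)
  refine h3.congr fun y hy => ?_
  simp only [tangentMapWithin, Function.comp]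
  rw [mfderivWithin_of_isOpen e.open_target hy]

theorem contDiffAt_coeff (he : e ∈ IsManifold.maximalAtlas (𝓡 n) ∞ M) (g : C1Metric n M)
    {y : Eu n} (hy : y ∈ e.target) (i j : Fin n) :
    ContDiffAt ℝ 1 (fun z => coeff g.inner e z i j) y := by
  have hs : ContMDiffOn (𝓡 n) ((𝓡 n).prod 𝓘(ℝ, Eu n →L[ℝ] Eu n →L[ℝ] ℝ)) 1
      (fun y : Eu n => TotalSpace.mk' (Eu n →L[ℝ] Eu n →L[ℝ] ℝ)
        (E := fun x : M => TangentSpace (𝓡 n) x →L[ℝ] TangentSpace (𝓡 n) x →L[ℝ] ℝ)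
        (e.symm y) (g.inner (e.symm y))) e.target :=
    g.contMDiff.comp_contMDiffOn ((contMDiffOn_symm_of_mem_maximalAtlas he).of_le ENat.LEInfty.out)
  have h : ContMDiffOn (𝓡 n) ((𝓡 n).prod 𝓘(ℝ, ℝ)) 1
      (fun z => TotalSpace.mk' ℝ (E := Bundle.Trivial M ℝ) (e.symm z) (coeff g.inner e z i j))
      e.target :=
    ContMDiffOn.clm_bundle_apply₂ (F₁ := Eu n) (F₂ := Eu n) hs
      (contMDiffOn_coordinateField he _) (contMDiffOn_coordinateField he _)
  have h2 := (h y hy).contMDiffAt (e.open_target.mem_nhds hy)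
  rw [contMDiffAt_totalSpace] at h2
  exact h2.2.contDiffAt

theorem posDef_coeff (he : e ∈ IsManifold.maximalAtlas (𝓡 n) ∞ M) (g : C1Metric n M)
    {y : Eu n} (hy : y ∈ e.target) : (coeff g.inner e y).PosDef := by
  set D : Eu n →L[ℝ] TangentSpace (𝓡 n) (e.symm y) := mfderiv 𝓘(ℝ, Eu n) (𝓡 n) e.symm y
  have hinj : Function.Injective D := by
    have h := (mdifferentiable_of_mem_maximalAtlas he).comp_symm_deriv hy
    intro v w hvw
    have h1 := DFunLike.congr_fun h v
    have h2 := DFunLike.congr_fun h w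
    have h3 : mfderiv (𝓡 n) (𝓡 n) e (e.symm y) (D v) = mfderiv (𝓡 n) (𝓡 n) e (e.symm y) (D w) := by
      rw [hvw]
    exact (h1.symm.trans h3).trans h2
  refine Matrix.PosDef.of_dotProduct_mulVec_pos ?_ fun x hx => ?_
  · ext i j
    exact g.symm _ _ _
  · have hv : ∑ i, x i • EuclideanSpace.single i (1 : ℝ) = WithLp.toLp 2 x := by
      ext j; simp [Pi.single_apply]
    have h1 : D (WithLp.toLp 2 x) ≠ 0 := fun h0 => hx (by
      have := hinj (h0.trans (map_zero D).symm)
      simpa using this)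
    have h2 := g.pos _ _ h1
    rw [← hv] at h2
    simp only [map_sum, sum_apply, map_smul, smul_apply, smul_eq_mul] at h2
    refine h2.trans_eq ?_
    simp only [dotProduct, Matrix.mulVec, star_trivial, Finset.mul_sum]
    refine Finset.sum_congr rfl fun i _ => Finset.sum_congr rfl fun j _ => ?_
    rw [g.symm]
    change _ = x i * (g.inner _ (D _) (D _) * x j)
    ring

theorem coeff_conformal (φ : M → ℝ) (h : FormField n M) (e : OpenPartialHomeomorph M (Eu n))
    (y : Eu n) :
    coeff (conformal φ h) e y = (φ (e.symm y) ^ (4 / ((n : ℝ) - 2))) • coeff h e y := by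
  ext i j; rfl

theorem contDiffAt_comp_symm (he : e ∈ IsManifold.maximalAtlas (𝓡 n) ∞ M) {Ω : Set M}
    (hΩ : IsOpen Ω) {f : M → ℝ} {m : ℕ∞ω} (hm : m ≤ (∞ : ℕ∞ω))
    (hf : ContMDiffOn (𝓡 n) 𝓘(ℝ, ℝ) m f Ω) {y : Eu n} (hy : y ∈ e.target) (hyΩ : e.symm y ∈ Ω) :
    ContDiffAt ℝ m (fun z => f (e.symm z)) y := by
  have h1 : ContMDiffAt (𝓡 n) (𝓡 n) m e.symm y :=
    (contMDiffAt_symm_of_mem_maximalAtlas he hy).of_le hm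
  exact ((hf.contMDiffAt (hΩ.mem_nhds hyΩ)).comp y h1).contDiffAt

theorem continuousOn_comp_symm {Ω : Set M} {f : M → ℝ} (hf : ContinuousOn f Ω) :
    ContinuousOn (fun z => f (e.symm z)) (e.target ∩ e.symm ⁻¹' Ω) :=
  hf.comp (e.continuousOn_symm.mono inter_subset_left) fun _ hz => hz.2

end Charts

/-! ### The maximum principle outside a hypersurface -/

theorem isPreconnected_norm_mem {n : ℕ} (hn : 3 ≤ n) {I : Set ℝ} (hI : IsPreconnected I)
    (hpos : I ⊆ Ioi 0) : IsPreconnected {y : Eu n | ‖y‖ ∈ I} := by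
  have hrank : 1 < Module.rank ℝ (Eu n) := by
    rw [← Module.finrank_eq_rank]
    simp only [finrank_euclideanSpace, Fintype.card_fin]
    exact_mod_cast (by omega : 1 < n)
  have h := ((isPreconnected_sphere hrank (0 : Eu n) 1).prod hI).image
    (fun p : Eu n × ℝ => p.2 • p.1) (by fun_prop)
  convert h using 1
  ext y
  constructor
  · intro hy
    have hy0 : 0 < ‖y‖ := hpos hy
    refine ⟨(‖y‖⁻¹ • y, ‖y‖), ⟨?_, hy⟩, by simp [smul_smul, hy0.ne']⟩
    simp [norm_smul, hy0.ne']
  · rintro ⟨⟨θ, s⟩, ⟨hθ, hs⟩, rfl⟩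
    have hs0 : 0 < s := hpos hs
    have hθ' : ‖θ‖ = 1 := by simpa using hθ
    simpa [norm_smul, hθ', abs_of_pos hs0] using hs

section MaxPrinciple

variable {n : ℕ} {M : Type*} [TopologicalSpace M] [ChartedSpace (Eu n) M]

/-- `φ` is a viscosity subsolution of `Δ_h φ = 0` on `Ω`, in every smooth chart. -/
def IsViscSubOn (h : FormField n M) (φ : M → ℝ) (Ω : Set M) : Prop :=
  ∀ e ∈ IsManifold.maximalAtlas (𝓡 n) ∞ M, ∀ y ∈ e.target, e.symm y ∈ Ω →
    IsViscSubAt (fun z => (coeff h e z)⁻¹) (driftCoeff (coeff h e)) (fun z => φ (e.symm z)) y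

namespace DistinguishedEnd

variable (E : DistinguishedEnd n M)

theorem isOpen_beyond {r : ℝ} (hr : E.R ≤ r) : IsOpen (E.beyond r) := by
  have hsub : {y : Eu n | r < ‖y‖} ⊆ E.chart.target := by
    rw [E.target_eq]; exact fun y hy => hr.trans_lt hy
  exact E.chart.symm.isOpen_image_of_subset_source (isOpen_lt continuous_const continuous_norm) hsub

theorem mem_target {y : Eu n} (hy : E.R < ‖y‖) : y ∈ E.chart.target := by
  rw [E.target_eq]; exact hy

theorem symm_mem_beyond {r : ℝ} {y : Eu n} (hr : r < ‖y‖) : E.chart.symm y ∈ E.beyond r :=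
  ⟨y, hr, rfl⟩

theorem isCompact_shell {r ρ : ℝ} (hr : E.R < r) :
    IsCompact (E.chart.symm '' {y | r ≤ ‖y‖ ∧ ‖y‖ ≤ ρ}) := by
  have hsub : {y : Eu n | r ≤ ‖y‖ ∧ ‖y‖ ≤ ρ} ⊆ E.chart.target := fun y hy =>
    E.mem_target (hr.trans_le hy.1)
  refine IsCompact.image_of_continuousOn ?_ (E.chart.continuousOn_symm.mono hsub)
  refine (isCompact_closedBall (0 : Eu n) ρ).of_isClosed_subset
    ((isClosed_le continuous_const continuous_norm).inter
      (isClosed_le continuous_norm continuous_const)) fun y hy => by simpa using hy.2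

theorem beyond_nonempty (hn : 3 ≤ n) {r : ℝ} (hr : E.R ≤ r) : (E.beyond r).Nonempty := by
  refine ⟨_, EuclideanSpace.single ⟨0, by omega⟩ (r + 1), ?_, rfl⟩
  have : 0 < r + 1 := by linarith [E.R_pos]
  simp [abs_of_pos this]

end DistinguishedEnd

variable [T2Space M] [IsManifold (𝓡 n) ∞ M] [ConnectedSpace M] {E : DistinguishedEnd n M}

/-- The closed outside region consists of a compact set and of a neighbourhood of infinity that does
not touch the boundary of the chart of the end. When the region is only known to be compact off the
whole chart, a small shell at the inner boundary of the chart stays close to this compact set, for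
otherwise the chart would be open and closed. -/
theorem Hypersurface.exists_isCompact_diff (hn : 3 ≤ n) (S : Hypersurface E) :
    ∃ r, E.R < r ∧ E.beyond r ⊆ S.outside ∧
      ∀ ρ, r ≤ ρ → IsCompact (closure S.outside \ E.beyond ρ) := by
  obtain ⟨r, hr, hsub, hK⟩ := S.cocompact
  suffices h : ∃ r' C, E.R < r' ∧ r ≤ r' ∧ IsCompact C ∧
      ∀ x ∈ closure S.outside, x ∉ E.beyond r' → x ∈ C by
    obtain ⟨r', C, h1, h2, hC, h3⟩ := h
    refine ⟨r', h1, fun x hx => hsub (image_mono (fun y hy => h2.trans_lt hy) hx), fun ρ hρ => ?_⟩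
    refine (hC.union (E.isCompact_shell (r := r') (ρ := ρ) h1)).of_isClosed_subset
      (isClosed_closure.sdiff (E.isOpen_beyond (h1.le.trans hρ))) fun x hx => ?_
    by_cases hxb : x ∈ E.beyond r'
    · obtain ⟨y, hy, rfl⟩ := hxb
      refine Or.inr ⟨y, ⟨le_of_lt hy, not_lt.mp fun hlt => hx.2 ⟨y, hlt, rfl⟩⟩, rfl⟩
    · exact Or.inl (h3 x hx.1 hxb)
  rcases hr.lt_or_eq with hlt | heq
  · exact ⟨r, _, hlt, le_rfl, hK, fun x hx hxb => ⟨hx, hxb⟩⟩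
  subst heq
  have : LocallyCompactSpace M := ChartedSpace.locallyCompactSpace (Eu n) M
  obtain ⟨K', hK', hKK'⟩ := exists_compact_superset hK
  set B := E.beyond E.R with hB
  have hBo : IsOpen B := E.isOpen_beyond le_rfl
  set W := interior K'
  have hWK' : closure W ⊆ K' := closure_minimal interior_subset hK'.isClosed
  have hT : IsCompact (frontier W ∩ closure S.outside) :=
    hK'.of_isClosed_subset (isClosed_frontier.inter isClosed_closure)
      fun x hx => hWK' (frontier_subset_closure hx.1)
  have hTB : ∀ x ∈ frontier W ∩ closure S.outside, x ∈ B := fun x hx => by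
    by_contra hxB
    have h1 : x ∈ W := hKK' ⟨hx.2, hxB⟩
    have h2 := hx.1
    rw [isOpen_interior.frontier_eq] at h2
    exact h2.2 h1
  have hBs : B ⊆ E.chart.source := by
    rintro _ ⟨y, hy, rfl⟩; exact E.chart.map_target (E.mem_target hy)
  obtain ⟨δ, hδ, hδT⟩ : ∃ δ > 0, ∀ x ∈ frontier W ∩ closure S.outside,
      E.R + δ ≤ ‖E.chart x‖ := by
    rcases (frontier W ∩ closure S.outside).eq_empty_or_nonempty with he | he
    · exact ⟨1, one_pos, by simp [he]⟩
    obtain ⟨x0, hx0, hmin⟩ := hT.exists_isMinOn he (f := fun x => ‖E.chart x‖)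
      (E.chart.continuousOn.mono fun x hx => hBs (hTB x hx)).norm
    obtain ⟨y, hy, hyx⟩ := hTB x0 hx0
    refine ⟨‖E.chart x0‖ - E.R, ?_, fun x hx => by simpa using hmin hx⟩
    rw [← hyx, E.chart.right_inv (E.mem_target hy)]
    exact sub_pos.mpr hy
  set Sh := E.chart.symm '' {y | ‖y‖ ∈ Ioo E.R (E.R + δ)}
  have hShpre : IsPreconnected Sh :=
    (isPreconnected_norm_mem hn isPreconnected_Ioo fun s hs => E.R_pos.trans hs.1).image _
      (E.chart.continuousOn_symm.mono fun y hy => E.mem_target hy.1)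
  have hShf : ¬ (Sh ∩ frontier W).Nonempty := by
    rintro ⟨_, ⟨y, hy, rfl⟩, hyf⟩
    have := hδT _ ⟨hyf, subset_closure (hsub (E.symm_mem_beyond hy.1))⟩
    rw [E.chart.right_inv (E.mem_target hy.1)] at this
    exact absurd hy.2 (not_lt.mpr this)
  by_cases hcase : (Sh ∩ Wᶜ).Nonempty
  -- the shell cannot stay away from the compact set
  · exfalso
    have hdisj : ¬ (Sh ∩ W).Nonempty := fun h => by
      have hcl : ∀ x ∈ Sh, x ∉ W → x ∈ (closure W)ᶜ := fun x hx hxW hxc => hShf ⟨x, hx, by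
        rw [isOpen_interior.frontier_eq]; exact ⟨hxc, hxW⟩⟩
      obtain ⟨x, hx, hxW⟩ := hcase
      obtain ⟨z, -, hz1, hz2⟩ := hShpre W (closure W)ᶜ isOpen_interior isClosed_closure.isOpen_compl
        (fun x hx => (em (x ∈ W)).imp id (hcl x hx)) h ⟨x, hx, hcl x hx hxW⟩
      exact hz2 (subset_closure hz1)
    obtain ⟨C, hC⟩ : ∃ C, ∀ y : Eu n, C < ‖y‖ → E.chart.symm y ∉ K' := by
      have h1 := E.proper.eventually hK'.compl_mem_cocompact
      rw [← comap_norm_atTop, eventually_comap] at h1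
      obtain ⟨C, hC⟩ := eventually_atTop.mp h1
      exact ⟨C, fun y hy => hC ‖y‖ hy.le y rfl⟩
    have hcl : frontier B = ∅ := by
      by_contra hne
      obtain ⟨p, hp⟩ := Set.nonempty_iff_ne_empty.mpr hne
      have hpB : p ∉ B := (hBo.frontier_eq ▸ hp).2
      have hpW : p ∈ W := hKK' ⟨closure_mono hsub (frontier_subset_closure hp), hpB⟩
      have h1 : p ∈ closure (W ∩ B) :=
        isOpen_interior.inter_closure ⟨hpW, frontier_subset_closure hp⟩
      have h2 : W ∩ B ⊆ E.chart.symm '' {y | E.R + δ ≤ ‖y‖ ∧ ‖y‖ ≤ C} := by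
        rintro _ ⟨hW, y, hy, rfl⟩
        refine ⟨y, ⟨not_lt.mp fun h => hdisj ⟨_, ⟨y, ⟨hy, h⟩, rfl⟩, hW⟩,
          not_lt.mp fun h => hC y h (interior_subset hW)⟩, rfl⟩
      obtain ⟨y, hy, hyp⟩ := closure_minimal h2
        (E.isCompact_shell (by linarith : E.R < E.R + δ)).isClosed h1
      exact hpB ⟨y, (by linarith : E.R < E.R + δ).trans_le hy.1, hyp⟩
    have huniv := (isClopen_iff_frontier_eq_empty.mpr hcl).eq_univ (E.beyond_nonempty hn le_rfl)
    have h3 : S.outside = univ := eq_univ_of_univ_subset (huniv ▸ hsub)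
    simpa [h3] using S.nonempty
  · refine ⟨E.R + δ / 2, _, by linarith, by linarith, hK.union hK', fun x hx hxb => ?_⟩
    by_cases hxB : x ∈ B
    · obtain ⟨y, hy, rfl⟩ := hxB
      right
      have hy2 : ‖y‖ ≤ E.R + δ / 2 := not_lt.mp fun h => hxb ⟨y, h, rfl⟩
      have : E.chart.symm y ∈ Sh := ⟨y, ⟨hy, by linarith⟩, rfl⟩
      by_contra hnK
      exact hcase ⟨_, this, fun hW => hnK (interior_subset hW)⟩
    · exact Or.inl ⟨hx, hxB⟩

theorem isOpen_target_inter {e : OpenPartialHomeomorph M (Eu n)} {Ω : Set M} (hΩ : IsOpen Ω) :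
    IsOpen (e.target ∩ e.symm ⁻¹' Ω) :=
  e.isOpen_inter_preimage_symm hΩ

theorem continuousAt_inv_coeff {e : OpenPartialHomeomorph M (Eu n)}
    (he : e ∈ IsManifold.maximalAtlas (𝓡 n) ∞ M) (g : C1Metric n M) {y : Eu n}
    (hy : y ∈ e.target) (i j : Fin n) :
    ContinuousAt (fun z => (coeff g.inner e z)⁻¹ i j) y :=
  (contDiffAt_inv (contDiffAt_coeff he g hy) (posDef_coeff he g hy).det_pos.ne' i j).continuousAt

/-- The strong maximum principle: a viscosity subsolution is locally constant near its interior
maximum points. -/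
theorem IsViscSubOn.eventually_eq (g : C1Metric n M) {Ω : Set M} (hΩ : IsOpen Ω) {φ : M → ℝ}
    {m : ℝ} (hφ : ContinuousOn φ Ω) (hsub : IsViscSubOn g.inner φ Ω) (hle : ∀ x ∈ Ω, φ x ≤ m)
    {x₀ : M} (hx₀ : x₀ ∈ Ω) (hm : φ x₀ = m) : ∀ᶠ x in 𝓝 x₀, φ x = m := by
  set e := chartAt (Eu n) x₀
  have he : e ∈ IsManifold.maximalAtlas (𝓡 n) ∞ M := IsManifold.chart_mem_maximalAtlas x₀
  have hs : x₀ ∈ e.source := mem_chart_source (Eu n) x₀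
  have h := eventually_eq_of_isViscSubAt (O := e.target ∩ e.symm ⁻¹' Ω)
    (φ := fun z => φ (e.symm z)) (m := m) (isOpen_target_inter hΩ) (continuousOn_comp_symm hφ)
    (fun i j y hy => (continuousAt_inv_coeff he g hy.1 i j).continuousWithinAt)
    (fun i y hy => (continuousAt_driftCoeff (contDiffAt_coeff he g hy.1)
      (posDef_coeff he g hy.1).det_pos i).continuousWithinAt)
    (fun y hy => (posDef_coeff he g hy.1).inv) (fun y hy => hsub e he y hy.1 hy.2)
    (fun y hy => hle _ hy.2) (x₀ := e x₀)
    ⟨e.map_source hs, by simpa [e.left_inv hs] using hx₀⟩ (by simpa [e.left_inv hs] using hm)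
  filter_upwards [(e.continuousAt hs).eventually h, e.open_source.mem_nhds hs] with x hx hxs
  rwa [e.left_inv hxs] at hx

/-- The maximum principle: a viscosity subsolution outside `S` is bounded by its values on `S` and at
infinity. -/
theorem Hypersurface.le_of_isViscSubOn (hn : 3 ≤ n) (S : Hypersurface E) (g : C1Metric n M)
    {φ : M → ℝ} (hφ : ContinuousOn φ (closure S.outside)) (hsub : IsViscSubOn g.inner φ S.outside)
    {c l : ℝ} (hb : ∀ x ∈ S.surface, φ x ≤ c) (hl : E.HasLimit φ l) (hlc : l ≤ c) :
    ∀ x ∈ closure S.outside, φ x ≤ c := by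
  by_contra! hcon
  obtain ⟨x1, hx1, hc1⟩ := hcon
  obtain ⟨r, hr, hrsub, hcomp⟩ := S.exists_isCompact_diff hn
  obtain ⟨ρ, hρ⟩ : ∃ ρ, ∀ y : Eu n, ρ < ‖y‖ → φ (E.chart.symm y) < φ x1 := by
    have h1 := hl.eventually (gt_mem_nhds (hlc.trans_lt hc1))
    rw [← comap_norm_atTop, eventually_comap] at h1
    obtain ⟨C, hC⟩ := eventually_atTop.mp h1
    exact ⟨C, fun y hy => hC ‖y‖ hy.le y rfl⟩
  have hK := hcomp (max r ρ) (le_max_left _ _)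
  have hlt : ∀ x ∈ E.beyond (max r ρ), φ x < φ x1 := by
    rintro _ ⟨y, hy, rfl⟩
    exact hρ y ((le_max_right _ _).trans_lt hy)
  have hx1K : x1 ∈ closure S.outside \ E.beyond (max r ρ) := ⟨hx1, fun h => lt_irrefl _ (hlt _ h)⟩
  obtain ⟨x2, hx2, hmax⟩ := hK.exists_isMaxOn ⟨x1, hx1K⟩ (hφ.mono sdiff_subset)
  have hle : ∀ x ∈ closure S.outside, φ x ≤ φ x2 := fun x hx => by
    by_cases hxb : x ∈ E.beyond (max r ρ)
    · exact (hlt x hxb).le.trans (hmax hx1K)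
    · exact hmax ⟨hx, hxb⟩
  have hc2 : c < φ x2 := hc1.trans_le (hmax hx1K)
  have hA : closure S.outside ∩ φ ⁻¹' {φ x2} ⊆ S.outside := fun x hx => by
    by_contra hxo
    have : x ∈ S.surface := by rw [Hypersurface.surface, S.isOpen.frontier_eq]; exact ⟨hx.1, hxo⟩
    exact absurd (hb x this) (not_le.mpr (hx.2 ▸ hc2))
  have hclosed := hφ.preimage_isClosed_of_isClosed isClosed_closure (isClosed_singleton (x := φ x2))
  have hopen : IsOpen (closure S.outside ∩ φ ⁻¹' {φ x2}) := by
    rw [isOpen_iff_mem_nhds]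
    intro x hx
    filter_upwards [hsub.eventually_eq g S.isOpen (hφ.mono subset_closure)
      (fun x hx => hle x (subset_closure hx)) (hA hx) hx.2, S.isOpen.mem_nhds (hA hx)] with z h1 h2
    exact ⟨subset_closure h2, h1⟩
  have huniv := IsClopen.eq_univ ⟨hclosed, hopen⟩ ⟨x2, hx2.1, rfl⟩
  have h3 : S.outside = univ := eq_univ_of_univ_subset (huniv ▸ hA)
  simpa [h3] using S.nonempty

end MaxPrinciple

/-! ### Classical harmonic functions -/

section Harmonic

variable {n : ℕ} {M : Type*} [TopologicalSpace M] [ChartedSpace (Eu n) M]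

/-- `f` is of class `C²` and harmonic on `Ω`, in every smooth chart. -/
def IsC2HarmonicOn (h : FormField n M) (f : M → ℝ) (Ω : Set M) : Prop :=
  ∀ e ∈ IsManifold.maximalAtlas (𝓡 n) ∞ M, ∀ y ∈ e.target, e.symm y ∈ Ω →
    ContDiffAt ℝ 2 (fun z => f (e.symm z)) y ∧
      lapOp (coeff h e) (fun z => f (e.symm z)) y = 0

namespace IsC2HarmonicOn

variable {h : FormField n M} {f f' : M → ℝ} {Ω Ω' : Set M}

theorem mono (hf : IsC2HarmonicOn h f Ω) (hΩ : Ω' ⊆ Ω) : IsC2HarmonicOn h f Ω' :=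
  fun e he y hy hyΩ => hf e he y hy (hΩ hyΩ)

theorem add (hf : IsC2HarmonicOn h f Ω) (hf' : IsC2HarmonicOn h f' Ω) :
    IsC2HarmonicOn h (fun x => f x + f' x) Ω := fun e he y hy hyΩ => by
  obtain ⟨h1, h2⟩ := hf e he y hy hyΩ
  obtain ⟨h3, h4⟩ := hf' e he y hy hyΩ
  exact ⟨h1.add h3, by rw [lapOp, ellOp_add h1 h3]; simp only [lapOp] at h2 h4; rw [h2, h4, add_zero]⟩

theorem const_mul (c : ℝ) (hf : IsC2HarmonicOn h f Ω) :
    IsC2HarmonicOn h (fun x => c * f x) Ω := fun e he y hy hyΩ => by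
  obtain ⟨h1, h2⟩ := hf e he y hy hyΩ
  exact ⟨contDiffAt_const.mul h1, by
    rw [lapOp, ellOp_const_mul c h1]; simp only [lapOp] at h2; rw [h2, mul_zero]⟩

theorem neg (hf : IsC2HarmonicOn h f Ω) : IsC2HarmonicOn h (fun x => -f x) Ω := by
  simpa using hf.const_mul (-1)

theorem sub (hf : IsC2HarmonicOn h f Ω) (hf' : IsC2HarmonicOn h f' Ω) :
    IsC2HarmonicOn h (fun x => f x - f' x) Ω := by
  simpa [sub_eq_add_neg] using hf.add hf'.neg

theorem const (c : ℝ) : IsC2HarmonicOn h (fun _ => c) Ω := fun _ _ _ _ _ =>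
  ⟨contDiffAt_const, ellOp_const c _⟩

theorem sum {ι : Type*} (s : Finset ι) {f : ι → M → ℝ} (hf : ∀ i ∈ s, IsC2HarmonicOn h (f i) Ω) :
    IsC2HarmonicOn h (fun x => ∑ i ∈ s, f i x) Ω := by
  classical
  induction s using Finset.induction_on with
  | empty => simpa using const 0
  | insert i s hi ih =>
    simp only [Finset.sum_insert hi]
    exact (hf i (Finset.mem_insert_self i s)).add
      (ih fun j hj => hf j (Finset.mem_insert_of_mem hj))

end IsC2HarmonicOn

theorem IsViscSubOn.add {h : FormField n M} {φ f : M → ℝ} {Ω : Set M} (hφ : IsViscSubOn h φ Ω)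
    (hf : IsC2HarmonicOn h f Ω) : IsViscSubOn h (fun x => φ x + f x) Ω := fun e he y hy hyΩ =>
  (hφ e he y hy hyΩ).add (hf e he y hy hyΩ).1 (hf e he y hy hyΩ).2.ge

theorem IsViscSubOn.mono {h : FormField n M} {φ : M → ℝ} {Ω Ω' : Set M} (hφ : IsViscSubOn h φ Ω)
    (hΩ : Ω' ⊆ Ω) : IsViscSubOn h φ Ω' := fun e he y hy hyΩ => hφ e he y hy (hΩ hyΩ)

variable [IsManifold (𝓡 n) ∞ M]

theorem IsC2HarmonicOn.isViscSubOn {g : C1Metric n M} {f : M → ℝ} {Ω : Set M}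
    (hf : IsC2HarmonicOn g.inner f Ω) : IsViscSubOn g.inner f Ω := fun e he y hy hyΩ =>
  isViscSubAt_of_contDiffAt (posDef_coeff he g hy).inv.posSemidef (hf e he y hy hyΩ).1
    (hf e he y hy hyΩ).2.ge

theorem isC2HarmonicOn_of_isHarmonicOn {g : C1Metric n M} {f : M → ℝ} {Ω : Set M} (hΩ : IsOpen Ω)
    (hf : ContMDiffOn (𝓡 n) 𝓘(ℝ, ℝ) 2 f Ω) (hh : IsHarmonicOn g.inner f Ω) :
    IsC2HarmonicOn g.inner f Ω := fun e he y hy hyΩ => by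
  have h1 := contDiffAt_comp_symm he hΩ ENat.LEInfty.out hf hy hyΩ
  refine ⟨h1, ?_⟩
  rw [← coordLaplacian_eq_lapOp (contDiffAt_coeff he g hy) (posDef_coeff he g hy).det_pos h1]
  have := hh e he (e.symm y) ⟨e.map_target hy, hyΩ⟩
  rwa [e.right_inv hy] at this

end Harmonic

/-! ### The conformal factor of a flow -/

section Flow

/-- A left endpoint Riemann sum of a monotone function approximates any function whose increments
lie between the corresponding bounds. -/
theorem abs_sub_riemannSum_le {p q : ℝ → ℝ} {T : ℝ} (hT : 0 ≤ T)
    (h : ∀ s t, 0 ≤ s → s ≤ t → t ≤ T → (t - s) * p s ≤ q t - q s ∧ q t - q s ≤ (t - s) * p t)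
    {N : ℕ} (hN : 0 < N) :
    |q T - (q 0 + ∑ i ∈ Finset.range N, T / N * p (i * (T / N)))| ≤ T / N * (p T - p 0) := by
  have hN' : (0 : ℝ) < N := by exact_mod_cast hN
  have hd : 0 ≤ T / N := by positivity
  have key : ∀ k : ℕ, k ≤ N →
      0 ≤ q (k * (T / N)) - q 0 - ∑ i ∈ Finset.range k, T / N * p (i * (T / N)) ∧
      q (k * (T / N)) - q 0 - ∑ i ∈ Finset.range k, T / N * p (i * (T / N)) ≤
        T / N * (p (k * (T / N)) - p 0) := by
    intro k
    induction k with
    | zero => intro _; simp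
    | succ k ih =>
      intro hk
      obtain ⟨h1, h2⟩ := ih (by omega)
      have hT' : ((k + 1 : ℕ) : ℝ) * (T / N) ≤ T := by
        have : ((k + 1 : ℕ) : ℝ) ≤ N := by exact_mod_cast hk
        calc ((k + 1 : ℕ) : ℝ) * (T / N) ≤ N * (T / N) := by gcongr
          _ = T := by field_simp
      have h3 := h (k * (T / N)) ((k + 1 : ℕ) * (T / N)) (by positivity)
        (by push_cast; nlinarith) hT'
      have h4 : ((k + 1 : ℕ) : ℝ) * (T / N) - k * (T / N) = T / N := by push_cast; ring
      rw [h4] at h3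
      rw [Finset.sum_range_succ]
      constructor <;> linarith [h3.1, h3.2]
  have := key N le_rfl
  rw [show (N : ℝ) * (T / N) = T by field_simp] at this
  rw [abs_le]
  have h0 : 0 ≤ T / N * (p T - p 0) := this.1.trans this.2
  constructor <;> linarith [this.1, this.2]

/-- A Lipschitz function whose derivative is almost everywhere bounded has increments bounded
accordingly. -/
theorem sub_mem_of_ae_hasDerivAt {f f' : ℝ → ℝ} {s t c C : ℝ} {K : NNReal} (hst : s ≤ t)
    (hf : LipschitzOnWith K f (Icc s t)) (hd : ∀ᵐ r : ℝ, r ∈ Ioo s t → HasDerivAt f (f' r) r)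
    (hc : ∀ r ∈ Ioo s t, c ≤ f' r) (hC : ∀ r ∈ Ioo s t, f' r ≤ C) :
    (t - s) * c ≤ f t - f s ∧ f t - f s ≤ (t - s) * C := by
  have hac : AbsolutelyContinuousOnInterval f s t :=
    LipschitzOnWith.absolutelyContinuousOnInterval (by rwa [uIcc_of_le hst])
  rw [← hac.integral_deriv_eq_sub]
  have hint := hac.intervalIntegrable_deriv
  have hae : ∀ᵐ r ∂(volume.restrict (Ioc s t)), c ≤ deriv f r ∧ deriv f r ≤ C := by
    rw [ae_restrict_iff' measurableSet_Ioc]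
    filter_upwards [hd, Measure.ae_ne volume t] with r hr hrt hrm
    have hr' : r ∈ Ioo s t := ⟨hrm.1, lt_of_le_of_ne hrm.2 hrt⟩
    rw [(hr hr').deriv]
    exact ⟨hc r hr', hC r hr'⟩
  constructor
  · have := intervalIntegral.integral_mono_ae_restrict (μ := volume) hst
      (intervalIntegrable_const (c := c)) hint (by
        rw [← restrict_Ioc_eq_restrict_Icc]
        filter_upwards [hae] with r hr using hr.1)
    simpa using this
  · have := intervalIntegral.integral_mono_ae_restrict (μ := volume) hst hint
      (intervalIntegrable_const (c := C)) (by
        rw [← restrict_Ioc_eq_restrict_Icc]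
        filter_upwards [hae] with r hr using hr.2)
    simpa using this

variable {n : ℕ} {M : Type*} [TopologicalSpace M] [ChartedSpace (Eu n) M] [T2Space M]
  [IsManifold (𝓡 n) ∞ M] [ConnectedSpace M] {E : DistinguishedEnd n M}

theorem exponent_pos (hn : 3 ≤ n) : 0 < 4 / ((n : ℝ) - 2) := by
  have : (3 : ℝ) ≤ n := by exact_mod_cast hn
  exact div_pos (by norm_num) (by linarith)

namespace IsDirichletSolution

variable {g : C1Metric n M} {S S' : Hypersurface E} {a a' : ℝ} {v v' : M → ℝ}

theorem isC2HarmonicOn (h : IsDirichletSolution g.inner S a v) :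
    IsC2HarmonicOn g.inner v S.outside :=
  isC2HarmonicOn_of_isHarmonicOn S.isOpen (h.smooth.of_le ENat.LEInfty.out) h.harmonic

theorem eq_zero_of_mem_surface (h : IsDirichletSolution g.inner S a v) {x : M}
    (hx : x ∈ S.surface) : v x = 0 :=
  h.eq_zero x (by rw [Hypersurface.surface, S.isOpen.frontier_eq] at hx; exact hx.2)

theorem nonpos (hn : 3 ≤ n) (h : IsDirichletSolution g.inner S a v) (ha : a ≤ 0) (x : M) :
    v x ≤ 0 := by
  by_cases hx : x ∈ S.outside
  · exact S.le_of_isViscSubOn hn g h.continuous.continuousOn h.isC2HarmonicOn.isViscSubOn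
      (fun z hz => (h.eq_zero_of_mem_surface hz).le) h.limit ha x (subset_closure hx)
  · exact (h.eq_zero x hx).le

theorem neg_le (hn : 3 ≤ n) (h : IsDirichletSolution g.inner S a v) (ha : a ≤ 0) (x : M) :
    a ≤ v x := by
  by_cases hx : x ∈ S.outside
  · have := S.le_of_isViscSubOn hn g (φ := fun x => -v x) h.continuous.neg.continuousOn
      h.isC2HarmonicOn.neg.isViscSubOn (c := -a) (l := -a)
      (fun z hz => by simp [h.eq_zero_of_mem_surface hz, ha]) h.limit.neg le_rfl x
      (subset_closure hx)
    linarith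
  · rw [h.eq_zero x hx]; exact ha

/-- The solutions of the Dirichlet problem, normalized at infinity, decrease as the domain grows. -/
theorem mono (hn : 3 ≤ n) (h : IsDirichletSolution g.inner S a v)
    (h' : IsDirichletSolution g.inner S' a' v') (hS : S'.Encloses S) (ha : a ≤ 0) (ha' : a' < 0)
    (haa : a ≤ a') (x : M) : v x ≤ v' x := by
  by_cases hx : x ∈ S'.outside
  · have hk : (a / a') * a' = a := div_mul_cancel₀ a ha'.ne
    have hk1 : 1 ≤ a / a' := by rw [one_le_div_of_neg ha']; exact haa
    have := S'.le_of_isViscSubOn hn g (φ := fun x => v x + -(a / a') * v' x)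
      (h.continuous.add (h'.continuous.const_mul _)).continuousOn
      ((h.isC2HarmonicOn.mono hS).add (h'.isC2HarmonicOn.const_mul _)).isViscSubOn (c := 0)
      (l := a + -(a / a') * a')
      (fun z hz => by simp [h'.eq_zero_of_mem_surface hz, h.nonpos hn ha z])
      (h.limit.add (h'.limit.const_mul _)) (by linarith) x (subset_closure hx)
    have h3 := h'.nonpos hn ha'.le x
    nlinarith
  · rw [h'.eq_zero x hx]; exact h.nonpos hn ha x

end IsDirichletSolution

namespace ConformalFlow

variable (F : ConformalFlow E)

theorem v_nonpos (hn : 3 ≤ n) {t : ℝ} (ht : 0 ≤ t) (x : M) : F.v t x ≤ 0 :=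
  (F.dirichlet t ht).nonpos hn (neg_nonpos.mpr (Real.exp_pos _).le) x

theorem neg_one_le_v (hn : 3 ≤ n) {t : ℝ} (ht : 0 ≤ t) (x : M) : -1 ≤ F.v t x := by
  have h1 := (F.dirichlet t ht).neg_le hn (neg_nonpos.mpr (Real.exp_pos _).le) x
  have : Real.exp (-t) ≤ 1 := Real.exp_le_one_iff.mpr (by linarith)
  linarith

theorem v_mono (hn : 3 ≤ n) {s t : ℝ} (hs : 0 ≤ s) (hst : s ≤ t) (x : M) : F.v s x ≤ F.v t x :=
  (F.dirichlet s hs).mono hn (F.dirichlet t (hs.trans hst)) (F.encloses s t hs hst)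
    (neg_nonpos.mpr (Real.exp_pos _).le) (neg_neg_of_pos (Real.exp_pos _))
    (neg_le_neg (Real.exp_le_exp.mpr (neg_le_neg hst))) x

theorem inner_eq {t : ℝ} (ht : 0 ≤ t) (x : M) (w : TangentSpace (𝓡 n) x) :
    (F.g t).inner x w w = F.u t x ^ (4 / ((n : ℝ) - 2)) * (F.g 0).inner x w w := by
  rw [F.conformal_eq t ht]; rfl

/-- Nonzero tangent vectors exist, which allows to recover `u_t` from `g_t` and `g_0`. -/
theorem exists_inner_pos (hn : 3 ≤ n) (x : M) : ∃ w : TangentSpace (𝓡 n) x,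
    0 < (F.g 0).inner x w w := by
  have : Nontrivial (TangentSpace (𝓡 n) x) := by
    have : Nonempty (Fin n) := ⟨⟨0, by omega⟩⟩
    exact (inferInstance : Nontrivial (Eu n))
  obtain ⟨w, hw⟩ := exists_ne (0 : TangentSpace (𝓡 n) x)
  exact ⟨w, (F.g 0).pos x w hw⟩

theorem u_zero (hn : 3 ≤ n) (x : M) : F.u 0 x = 1 := by
  obtain ⟨w, hw⟩ := F.exists_inner_pos hn x
  have h := F.inner_eq le_rfl x w
  have h1 : F.u 0 x ^ (4 / ((n : ℝ) - 2)) = 1 := by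
    have : (F.u 0 x ^ (4 / ((n : ℝ) - 2)) - 1) * (F.g 0).inner x w w = 0 := by linarith
    rcases mul_eq_zero.mp this with h0 | h0
    · linarith
    · exact absurd h0 hw.ne'
  rw [← Real.rpow_rpow_inv (F.u_pos 0 le_rfl x).le (exponent_pos hn).ne', h1, Real.one_rpow]

theorem u_eq_rpow (hn : 3 ≤ n) {t : ℝ} (ht : 0 ≤ t) (x : M) :
    F.u t x = (F.u t x ^ (4 / ((n : ℝ) - 2))) ^ (4 / ((n : ℝ) - 2))⁻¹ :=
  (Real.rpow_rpow_inv (F.u_pos t ht x).le (exponent_pos hn).ne').symm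

theorem lipschitz_u (hn : 3 ≤ n) (x : M) {T : ℝ} (hT : 0 ≤ T) :
    ∃ K, LipschitzOnWith K (fun t => F.u t x) (Icc 0 T) := by
  obtain ⟨w, hw⟩ := F.exists_inner_pos hn x
  obtain ⟨K, hK⟩ := F.lipschitz x w T
  set A : ℝ → ℝ := fun t => (F.g t).inner x w w
  have hApos : ∀ t ∈ Icc 0 T, 0 < A t := fun t ht => by
    simp only [A, F.inner_eq ht.1]
    exact mul_pos (Real.rpow_pos_of_pos (F.u_pos t ht.1 x) _) hw
  obtain ⟨t0, ht0, hmin⟩ := isCompact_Icc.exists_isMinOn ⟨0, le_rfl, hT⟩ hK.continuousOn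
  obtain ⟨t1, ht1, hmax⟩ := isCompact_Icc.exists_isMaxOn ⟨0, le_rfl, hT⟩ hK.continuousOn
  have hr : ContDiffOn ℝ 1 (fun z : ℝ => (z / (F.g 0).inner x w w) ^ (4 / ((n : ℝ) - 2))⁻¹)
      (Icc (A t0) (A t1)) := fun z hz =>
    ((contDiffAt_id.div_const _).rpow_const_of_ne
      (div_pos ((hApos t0 ht0).trans_le hz.1) hw).ne').contDiffWithinAt
  obtain ⟨K', hK'⟩ := hr.exists_lipschitzOnWith one_ne_zero (convex_Icc _ _) isCompact_Icc
  have heq : ∀ t ∈ Icc 0 T, F.u t x =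
      ((fun z : ℝ => (z / (F.g 0).inner x w w) ^ (4 / ((n : ℝ) - 2))⁻¹) ∘ A) t := fun t ht => by
    simp only [Function.comp, A, F.inner_eq ht.1]
    rw [mul_div_cancel_right₀ _ hw.ne', ← F.u_eq_rpow hn ht.1]
  refine ⟨K' * K, fun a ha b hb => ?_⟩
  change edist (F.u a x) (F.u b x) ≤ _
  rw [heq a ha, heq b hb]
  exact (hK'.comp hK fun t ht => ⟨hmin ht, hmax ht⟩) ha hb

/-- The evolution equation in integrated form, with bounds for the velocity. -/
theorem u_sub_mem (hn : 3 ≤ n) {s t : ℝ} (hs : 0 ≤ s) (hst : s ≤ t) {x : M} {c C : ℝ}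
    (hc : ∀ r ∈ Ioo s t, c ≤ F.v r x) (hC : ∀ r ∈ Ioo s t, F.v r x ≤ C) :
    (t - s) * c ≤ F.u t x - F.u s x ∧ F.u t x - F.u s x ≤ (t - s) * C := by
  obtain ⟨K, hK⟩ := F.lipschitz_u hn x (hs.trans hst)
  refine sub_mem_of_ae_hasDerivAt hst (hK.mono (Icc_subset_Icc_left hs)) ?_ hc hC
  filter_upwards [F.evolution] with r hr hrs using hr (hs.trans_lt hrs.1) x

theorem u_sub_bounds (hn : 3 ≤ n) {s t : ℝ} (hs : 0 ≤ s) (hst : s ≤ t) (x : M) :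
    (t - s) * F.v s x ≤ F.u t x - F.u s x ∧ F.u t x - F.u s x ≤ (t - s) * F.v t x :=
  F.u_sub_mem hn hs hst (fun _ hr => F.v_mono hn hs hr.1.le x)
    fun _ hr => F.v_mono hn (hs.trans hr.1.le) hr.2.le x

/-- Riemann sums for `u t = 1 + ∫₀ᵗ v s ds`. They are combinations of the `v s` with `s < t`. -/
def riemannSum (t : ℝ) (N : ℕ) (x : M) : ℝ :=
  1 + ∑ i ∈ Finset.range (N + 1), t / (N + 1 : ℕ) * F.v (i * (t / (N + 1 : ℕ))) x

theorem abs_u_sub_riemannSum_le (hn : 3 ≤ n) {t : ℝ} (ht : 0 ≤ t) (N : ℕ) (x : M) :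
    |F.u t x - F.riemannSum t N x| ≤ t / (N + 1 : ℕ) := by
  have h := abs_sub_riemannSum_le (p := fun s => F.v s x) (q := fun s => F.u s x) ht
    (fun s r hs hsr _ => F.u_sub_bounds hn hs hsr x) (Nat.succ_pos N)
  simp only [F.u_zero hn] at h
  refine h.trans (mul_le_of_le_one_right (by positivity) ?_)
  linarith [F.v_nonpos hn ht x, F.neg_one_le_v hn le_rfl x]

theorem tendsto_div_succ (t : ℝ) : Tendsto (fun N : ℕ => t / (N + 1 : ℕ)) atTop (𝓝 0) :=
  (tendsto_const_div_atTop_nhds_zero_nat t).comp (tendsto_add_atTop_nat 1)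

theorem tendstoUniformly_riemannSum (hn : 3 ≤ n) {t : ℝ} (ht : 0 ≤ t) :
    TendstoUniformly (F.riemannSum t) (F.u t) atTop := by
  rw [Metric.tendstoUniformly_iff]
  intro ε hε
  filter_upwards [(tendsto_div_succ t).eventually (gt_mem_nhds hε)] with N hN x
  exact (F.abs_u_sub_riemannSum_le hn ht N x).trans_lt hN

theorem riemannSum_node_lt {t : ℝ} (ht : 0 ≤ t) {N i : ℕ} (hi : i ∈ Finset.range (N + 1)) :
    0 ≤ (i : ℝ) * (t / (N + 1 : ℕ)) ∧ (0 < t → (i : ℝ) * (t / (N + 1 : ℕ)) < t) := by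
  refine ⟨by positivity, fun h => ?_⟩
  have h1 : (i : ℝ) < (N + 1 : ℕ) := by exact_mod_cast Finset.mem_range.mp hi
  have h2 : (0 : ℝ) < (N + 1 : ℕ) := by positivity
  rw [mul_div_assoc', div_lt_iff₀ h2, mul_comm t]
  exact mul_lt_mul_of_pos_right h1 h

theorem isC2HarmonicOn_riemannSum {t : ℝ} (ht : 0 ≤ t) {Ω : Set M}
    (hΩ : ∀ s, 0 ≤ s → s < t → Ω ⊆ (F.Sig s).outside) (N : ℕ) :
    IsC2HarmonicOn (F.g 0).inner (F.riemannSum t N) Ω := by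
  rcases ht.eq_or_lt with rfl | hpos
  · have : F.riemannSum 0 N = fun _ => 1 := by ext x; simp [riemannSum]
    rw [this]
    exact IsC2HarmonicOn.const 1
  · refine (IsC2HarmonicOn.const 1).add (IsC2HarmonicOn.sum _ fun i hi => ?_)
    obtain ⟨h1, h2⟩ := riemannSum_node_lt ht hi
    exact ((F.dirichlet _ h1).isC2HarmonicOn.mono (hΩ _ h1 (h2 hpos))).const_mul _

theorem hasLimit_riemannSum {t : ℝ} (ht : 0 ≤ t) (N : ℕ) :
    E.HasLimit (F.riemannSum t N)
      (1 + ∑ i ∈ Finset.range (N + 1), t / (N + 1 : ℕ) * -Real.exp (-(i * (t / (N + 1 : ℕ))))) :=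
  tendsto_const_nhds.add (tendsto_finsetSum _ fun _ hi =>
    (F.dirichlet _ (riemannSum_node_lt ht hi).1).limit.const_mul _)

/-- The conformal factor tends to `1 - ∫₀ᵗ e^(-s) ds`. -/
theorem hasLimit_u (hn : 3 ≤ n) {t : ℝ} (ht : 0 ≤ t) : E.HasLimit (F.u t) (Real.exp (-t)) := by
  have hexp : ∀ s r : ℝ, 0 ≤ s → s ≤ r → r ≤ t →
      (r - s) * -Real.exp (-s) ≤ Real.exp (-r) - Real.exp (-s) ∧
        Real.exp (-r) - Real.exp (-s) ≤ (r - s) * -Real.exp (-r) := fun s r _ _ _ => by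
    have h1 := Real.add_one_le_exp (s - r)
    have h2 := Real.add_one_le_exp (r - s)
    have e1 : Real.exp (-r) = Real.exp (-s) * Real.exp (s - r) := by rw [← Real.exp_add]; ring_nf
    have e2 : Real.exp (-s) = Real.exp (-r) * Real.exp (r - s) := by rw [← Real.exp_add]; ring_nf
    constructor
    · rw [e1]; nlinarith [Real.exp_pos (-s)]
    · rw [e2]; nlinarith [Real.exp_pos (-r)]
  have hcN : ∀ N : ℕ, |Real.exp (-t) - (1 + ∑ i ∈ Finset.range (N + 1),
      t / (N + 1 : ℕ) * -Real.exp (-(i * (t / (N + 1 : ℕ)))))| ≤ t / (N + 1 : ℕ) := fun N => by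
    have h := abs_sub_riemannSum_le (p := fun s => -Real.exp (-s)) (q := fun s => Real.exp (-s)) ht
      hexp (Nat.succ_pos N)
    simp only [neg_zero, Real.exp_zero] at h
    refine h.trans (mul_le_of_le_one_right (by positivity) ?_)
    linarith [Real.exp_pos (-t)]
  rw [DistinguishedEnd.HasLimit, Metric.tendsto_nhds]
  intro ε hε
  obtain ⟨N, hN⟩ := ((tendsto_div_succ t).eventually (gt_mem_nhds (by positivity : 0 < ε / 3))).exists
  filter_upwards [Metric.tendsto_nhds.mp (F.hasLimit_riemannSum ht N) (ε / 3) (by positivity)]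
    with y hy
  have h1 := F.abs_u_sub_riemannSum_le hn ht N (E.chart.symm y)
  have h2 := hcN N
  rw [Real.dist_eq] at hy ⊢
  rw [abs_lt] at hy ⊢
  rw [abs_le] at h1 h2
  constructor <;> linarith [hy.1, hy.2, h1.1, h1.2, h2.1, h2.2]

/-- The conformal factor is as regular as the quotient of `g_t` and `g_0`. -/
theorem contDiffAt_u (hn : 3 ≤ n) {t : ℝ} (ht : 0 ≤ t) {e : OpenPartialHomeomorph M (Eu n)}
    (he : e ∈ IsManifold.maximalAtlas (𝓡 n) ∞ M) {y : Eu n} (hy : y ∈ e.target) :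
    ContDiffAt ℝ 1 (fun z => F.u t (e.symm z)) y := by
  set i : Fin n := ⟨0, by omega⟩
  have hpos : ∀ z ∈ e.target, 0 < coeff (F.g 0).inner e z i i := fun z hz =>
    (posDef_coeff he (F.g 0) hz).diag_pos
  have hrel : ∀ z, coeff (F.g t).inner e z i i =
      F.u t (e.symm z) ^ (4 / ((n : ℝ) - 2)) * coeff (F.g 0).inner e z i i := fun z => by
    rw [F.conformal_eq t ht, coeff_conformal]; rfl
  have hq : ∀ z ∈ e.target, coeff (F.g t).inner e z i i / coeff (F.g 0).inner e z i i =
      F.u t (e.symm z) ^ (4 / ((n : ℝ) - 2)) := fun z hz => by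
    rw [hrel, mul_div_cancel_right₀ _ (hpos z hz).ne']
  have h1 : ContDiffAt ℝ 1 (fun z => (coeff (F.g t).inner e z i i /
      coeff (F.g 0).inner e z i i) ^ (4 / ((n : ℝ) - 2))⁻¹) y := by
    refine ((contDiffAt_coeff he (F.g t) hy i i).div (contDiffAt_coeff he (F.g 0) hy i i)
      (hpos y hy).ne').rpow_const_of_ne ?_
    change coeff (F.g t).inner e y i i / coeff (F.g 0).inner e y i i ≠ 0
    rw [hq y hy]
    exact (Real.rpow_pos_of_pos (F.u_pos t ht _) _).ne'
  refine h1.congr_of_eventuallyEq ?_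
  filter_upwards [e.open_target.mem_nhds hy] with z hz
  rw [hq z hz, ← F.u_eq_rpow hn ht]

theorem continuous_u (hn : 3 ≤ n) {t : ℝ} (ht : 0 ≤ t) : Continuous (F.u t) := by
  rw [continuous_iff_continuousAt]
  intro x
  set e := chartAt (Eu n) x
  have hs : x ∈ e.source := mem_chart_source (Eu n) x
  have h1 := (F.contDiffAt_u hn ht (IsManifold.chart_mem_maximalAtlas x)
    (e.map_source hs)).continuousAt
  have h2 : ContinuousAt (fun z => F.u t (e.symm (e z))) x :=
    ContinuousAt.comp (g := fun z => F.u t (e.symm z)) h1 (e.continuousAt hs)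
  refine h2.congr ?_
  filter_upwards [e.open_source.mem_nhds hs] with z hz
  rw [e.left_inv hz]

end ConformalFlow
end Flow

/-! ### The boundary of a smooth domain -/

section BoundaryLocal

variable {n : ℕ} {a : Eu n → Matrix (Fin n) (Fin n) ℝ} {b : Eu n → Fin n → ℝ}

theorem hasDerivAt_line (y w : Eu n) (τ : ℝ) : HasDerivAt (fun τ : ℝ => y + τ • w) w τ := by
  simpa using ((hasDerivAt_id τ).smul_const w).const_add y

theorem eventually_pos_of_fderiv_pos {f : Eu n → ℝ} {y w : Eu n} (hf : DifferentiableAt ℝ f y)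
    (h0 : f y = 0) (hw : 0 < fderiv ℝ f y w) : ∀ᶠ τ : ℝ in 𝓝[>] 0, 0 < f (y + τ • w) := by
  have h1 : HasFDerivAt f (fderiv ℝ f y) (y + (0 : ℝ) • w) := by simpa using hf.hasFDerivAt
  have h2 : HasDerivAt (fun τ : ℝ => f (y + τ • w)) (fderiv ℝ f y w) 0 :=
    h1.comp_hasDerivAt (0 : ℝ) (hasDerivAt_line y w 0)
  have h3 := (hasDerivAt_iff_tendsto_slope.mp h2).mono_left
    (nhdsWithin_mono (0 : ℝ) (fun τ (hτ : 0 < τ) => hτ.ne' : Ioi (0 : ℝ) ⊆ {0}ᶜ))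
  filter_upwards [h3.eventually (lt_mem_nhds hw), self_mem_nhdsWithin] with τ hτ hτ0
  have hτ0' : (0 : ℝ) < τ := hτ0
  rw [slope_def_field, sub_zero, zero_smul, add_zero, h0, sub_zero] at hτ
  exact (div_pos_iff_of_pos_right hτ0').mp hτ

/-- Near a boundary point of `{f > 0}`, the points on an inner transversal belong to every component
of `{f > 0}` whose closure contains the boundary point. -/
theorem eventually_mem_component {O D D' : Set (Eu n)} (hO : IsOpen O) {y : Eu n} (hy : y ∈ O)
    {f : Eu n → ℝ} (hf : ∀ z ∈ O, ContDiffAt ℝ 2 f z) (hD : ∀ z ∈ O, z ∈ D ↔ 0 < f z)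
    (h0 : f y = 0) (hcl : y ∈ closure D') (hsub : D' ⊆ D)
    (hcomp : ∀ P ⊆ D ∩ O, IsPreconnected P → (P ∩ D').Nonempty → P ⊆ D')
    {w : Eu n} (hw : 0 < fderiv ℝ f y w) : ∀ᶠ τ : ℝ in 𝓝[>] 0, y + τ • w ∈ D' := by
  have hev : ∀ᶠ z in 𝓝 y, z ∈ O ∧ 0 < fderiv ℝ f z w := by
    have hc : ContinuousAt (fun z => fderiv ℝ f z w) y :=
      (((hf y hy).fderiv_right (m := 0) (by norm_num)).continuousAt).clm_apply continuousAt_const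
    filter_upwards [hO.mem_nhds hy, hc.eventually (lt_mem_nhds hw)] with z h1 h2 using ⟨h1, h2⟩
  obtain ⟨η, hη, hball⟩ := Metric.mem_nhds_iff.mp hev
  have hsmall : ∀ᶠ τ : ℝ in 𝓝[>] 0, ‖τ • w‖ < η / 2 := by
    have h1 : ContinuousAt (fun τ : ℝ => ‖τ • w‖) 0 := by fun_prop
    have h2 : Tendsto (fun τ : ℝ => ‖τ • w‖) (𝓝[>] 0) (𝓝 0) := by
      simpa [ContinuousAt] using h1.tendsto.mono_left nhdsWithin_le_nhds
    exact h2.eventually (gt_mem_nhds (by positivity))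
  filter_upwards [hsmall, eventually_pos_of_fderiv_pos ((hf y hy).differentiableAt two_ne_zero) h0 hw,
    self_mem_nhdsWithin] with τ h1 h2 h3
  have hτ : (0 : ℝ) < τ := h3
  have hyτ : y + τ • w ∈ Metric.ball y η := by
    simp only [Metric.mem_ball, dist_self_add_left]; linarith
  obtain ⟨r, hr, hrsub⟩ : ∃ r > 0, Metric.ball (y + τ • w) r ⊆ D ∩ O := by
    refine Metric.mem_nhds_iff.mp ?_
    have hyO := (hball hyτ).1
    filter_upwards [hO.mem_nhds hyO, (hf _ hyO).continuousAt.eventually (lt_mem_nhds h2)] with z hz1 hz2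
    exact ⟨(hD z hz1).mpr hz2, hz1⟩
  obtain ⟨q, hq, hqd⟩ := Metric.mem_closure_iff.mp hcl (min r (η / 2)) (by positivity)
  have hseg : ∀ σ ∈ Icc (0 : ℝ) τ, q + σ • w ∈ Metric.ball y η := fun σ hσ => by
    have e1 : ‖σ • w‖ ≤ ‖τ • w‖ := by
      rw [norm_smul, norm_smul, Real.norm_of_nonneg hσ.1, Real.norm_of_nonneg hτ.le]
      exact mul_le_mul_of_nonneg_right hσ.2 (norm_nonneg _)
    have e2 : ‖q - y‖ < η / 2 := by
      rw [← dist_eq_norm, dist_comm]; exact hqd.trans_le (min_le_right _ _)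
    rw [Metric.mem_ball, dist_eq_norm, add_sub_right_comm]
    exact (norm_add_le _ _).trans_lt (by linarith)
  have hqO : q ∈ O := by simpa using (hball (hseg 0 ⟨le_rfl, hτ.le⟩)).1
  have hmono : MonotoneOn (fun σ : ℝ => f (q + σ • w)) (Icc 0 τ) := by
    have hd : ∀ σ ∈ Icc 0 τ, HasDerivAt (fun σ : ℝ => f (q + σ • w)) (fderiv ℝ f (q + σ • w) w) σ :=
      fun σ hσ => ((hf _ (hball (hseg σ hσ)).1).differentiableAt two_ne_zero).hasFDerivAt.comp_hasDerivAt
        σ (hasDerivAt_line q w σ)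
    refine monotoneOn_of_deriv_nonneg (convex_Icc _ _)
      (fun σ hσ => (hd σ hσ).continuousAt.continuousWithinAt) (fun σ hσ =>
        (hd σ (interior_subset hσ)).differentiableAt.differentiableWithinAt) fun σ hσ => ?_
    rw [(hd σ (interior_subset hσ)).deriv]
    exact (hball (hseg σ (interior_subset hσ))).2.le
  have hP1 : (fun σ : ℝ => q + σ • w) '' Icc 0 τ ⊆ D' := by
    refine hcomp _ ?_ (isPreconnected_Icc.image _ (by fun_prop))
      ⟨q, ⟨0, ⟨le_rfl, hτ.le⟩, by simp⟩, hq⟩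
    rintro _ ⟨σ, hσ, rfl⟩
    have hσO := (hball (hseg σ hσ)).1
    refine ⟨(hD _ hσO).mpr ?_, hσO⟩
    have h5 := hmono ⟨le_rfl, hτ.le⟩ hσ hσ.1
    simp only [zero_smul, add_zero] at h5
    exact ((hD q hqO).mp (hsub hq)).trans_le h5
  refine hcomp _ hrsub (convex_ball _ _).isPreconnected
    ⟨q + τ • w, ?_, hP1 ⟨τ, ⟨hτ.le, le_rfl⟩, rfl⟩⟩ (Metric.mem_ball_self hr)
  rw [Metric.mem_ball, dist_add_right, dist_comm]
  exact hqd.trans_le (min_le_left _ _)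

/-- Hopf's boundary lemma: below its maximum `m`, attained at the boundary point `p` of `{f > 0}`, a
viscosity subsolution stays away from `m` at a linear rate. -/
theorem eventually_le_sub_barrier {O D Q : Set (Eu n)} (hO : IsOpen O) {p : Eu n} (hp : p ∈ O)
    (ha : ∀ i j, ContinuousOn (fun y => a y i j) O) (hb : ∀ i, ContinuousOn (fun y => b y i) O)
    (hpos : ∀ y ∈ O, (a y).PosDef) {f : Eu n → ℝ} (hf : ∀ y ∈ O, ContDiffAt ℝ 2 f y)
    (hfp : fderiv ℝ f p ≠ 0) (hDo : IsOpen D)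
    (hQ : ∀ K ⊆ O, IsClosed K → IsClosed (K ∩ Q)) (hQD : ∀ y ∈ Q ∩ O, y ∉ D → f y ≤ 0)
    {φ : Eu n → ℝ} {m : ℝ} (hφ : ContinuousOn φ (Q ∩ O))
    (hsub : ∀ y ∈ D ∩ O, IsViscSubAt a b φ y) (hle : ∀ y ∈ Q ∩ O, φ y ≤ m)
    (hlt : ∀ y ∈ D ∩ O, φ y < m) (hDQ : D ⊆ Q) :
    ∃ ε > 0, ∃ k > 0, ∀ᶠ y in 𝓝 p, y ∈ Q →
      φ y ≤ m - ε * (Real.exp (k * (f y + -‖y - p‖ ^ 2)) - 1) := by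
  set F : Eu n → ℝ := fun y => f y + -‖y - p‖ ^ 2
  have hF : ∀ y ∈ O, ContDiffAt ℝ 2 F y := fun y hy =>
    (hf y hy).add (contDiff_neg_normSq p).contDiffAt
  have hdF : fderiv ℝ F p ≠ 0 := by
    have : fderiv ℝ F p = fderiv ℝ f p := by
      rw [fderiv_fun_add ((hf p hp).differentiableAt two_ne_zero)
        ((contDiff_neg_normSq p).differentiable two_ne_zero p)]
      refine ContinuousLinearMap.ext fun w => ?_
      rw [add_apply, fderiv_neg_normSq]
      simp
    rwa [this]
  have hev : ∀ᶠ y in 𝓝 p, y ∈ O ∧ fderiv ℝ F y ≠ 0 := by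
    have hc : ContinuousAt (fderiv ℝ F) p :=
      ((hF p hp).fderiv_right (m := 0) (by norm_num)).continuousAt
    filter_upwards [hO.mem_nhds hp, hc.eventually_ne hdF] with y h1 h2 using ⟨h1, h2⟩
  obtain ⟨ρ, hρ, hball⟩ := Metric.nhds_basis_closedBall.mem_iff.mp hev
  set K := Metric.closedBall p ρ
  have hKc : IsCompact K := isCompact_closedBall p ρ
  have hKO : K ⊆ O := fun y hy => (hball hy).1
  obtain ⟨k, hk, hkL⟩ := exists_barrier hKc (fun i j => (ha i j).mono hKO)
    (fun i => (hb i).mono hKO) (fun y hy => hpos y (hKO hy)) (fun y hy => hF y (hKO hy))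
    fun y hy => (hball hy).2
  have hfc : ContinuousOn f K := fun y hy => (hf y (hKO hy)).continuousAt.continuousWithinAt
  have hFc : ContinuousOn F K := fun y hy => (hF y (hKO hy)).continuousAt.continuousWithinAt
  have hKQ : IsCompact (K ∩ Q) := hKc.of_isClosed_subset (hQ K hKO hKc.isClosed) inter_subset_left
  have hexpc : ContinuousOn (fun y => Real.exp (k * F y)) K := (hFc.const_mul k).rexp
  -- the part of the sphere on which the barrier is positive
  obtain ⟨δ, hδ, hδS⟩ : ∃ δ > 0, ∀ y ∈ K ∩ Q, dist y p = ρ → ρ ^ 2 ≤ f y → φ y ≤ m - δ := by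
    set T := (K ∩ Q) ∩ ((K ∩ f ⁻¹' Ici (ρ ^ 2)) ∩ {y | dist y p = ρ})
    have hT : IsCompact T := hKQ.inter_right
      ((hfc.preimage_isClosed_of_isClosed hKc.isClosed isClosed_Ici).inter
        (isClosed_eq (by fun_prop) continuous_const))
    rcases T.eq_empty_or_nonempty with he | he
    · exact ⟨1, one_pos, fun y h1 h2 h3 => absurd (he ▸ (⟨h1, ⟨h1.1, h3⟩, h2⟩ : y ∈ T))
        (notMem_empty y)⟩
    obtain ⟨y0, hy0, hmax⟩ := hT.exists_isMaxOn he (hφ.mono fun y hy => ⟨hy.1.2, hKO hy.1.1⟩)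
    refine ⟨m - φ y0, sub_pos.mpr (hlt y0 ⟨?_, hKO hy0.1.1⟩), fun y h1 h2 h3 => ?_⟩
    · by_contra hnD
      have h4 := hQD y0 ⟨hy0.1.2, hKO hy0.1.1⟩ hnD
      have h5 : ρ ^ 2 ≤ f y0 := hy0.2.1.2
      nlinarith
    · have h6 : φ y ≤ φ y0 := hmax (show y ∈ T from ⟨h1, ⟨h1.1, h3⟩, h2⟩)
      linarith
  obtain ⟨C, hC⟩ := hKc.exists_bound_of_continuousOn hexpc
  have hC0 : 0 < C := (Real.exp_pos _).trans_le
    ((le_abs_self _).trans (hC p (Metric.mem_closedBall_self hρ.le)))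
  refine ⟨δ / C, by positivity, k, hk, ?_⟩
  filter_upwards [Metric.closedBall_mem_nhds p hρ] with y hyK hyQ
  by_contra! hcon
  obtain ⟨z, hz, hzmax⟩ := hKQ.exists_isMaxOn ⟨y, hyK, hyQ⟩
    ((hφ.mono fun y hy => ⟨hy.2, hKO hy.1⟩).add ((hexpc.mono inter_subset_left).const_mul (δ / C)) :
      ContinuousOn (fun y => φ y + δ / C * Real.exp (k * F y)) (K ∩ Q))
  have hzgt : m + δ / C < φ z + δ / C * Real.exp (k * F z) := by
    have h1 : φ y + δ / C * Real.exp (k * F y) ≤ φ z + δ / C * Real.exp (k * F z) :=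
      hzmax ⟨hyK, hyQ⟩
    have h2 : m - δ / C * (Real.exp (k * F y) - 1) < φ y := hcon
    linarith
  have hFle : F z ≤ 0 → False := fun h => by
    have h1 : Real.exp (k * F z) ≤ 1 := Real.exp_le_one_iff.mpr (mul_nonpos_of_nonneg_of_nonpos hk.le h)
    have h2 := hle z ⟨hz.2, hKO hz.1⟩
    have h3 : 0 < δ / C := by positivity
    nlinarith
  have hzD : z ∈ D := by
    by_contra hnD
    refine hFle ?_
    have := hQD z ⟨hz.2, hKO hz.1⟩ hnD
    have h2 := sq_nonneg ‖z - p‖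
    simp only [F]; linarith
  have hzball : z ∈ Metric.ball p ρ := by
    refine lt_of_le_of_ne (Metric.mem_closedBall.mp hz.1) fun hs => ?_
    by_cases hfz : ρ ^ 2 ≤ f z
    · have h1 := hδS z hz hs hfz
      have h2 : Real.exp (k * F z) ≤ C := (le_abs_self _).trans (hC z hz.1)
      have h3 : δ / C * Real.exp (k * F z) ≤ δ := by
        calc δ / C * Real.exp (k * F z) ≤ δ / C * C := by gcongr
          _ = δ := by field_simp
      have h4 : 0 < δ / C := by positivity
      linarith
    · refine hFle ?_
      rw [dist_eq_norm] at hs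
      simp only [F, hs]; linarith
  have hloc : IsLocalMax (fun y => φ y + δ / C * Real.exp (k * F y)) z := by
    refine hzmax.isLocalMax (Filter.mem_of_superset
      ((Metric.isOpen_ball.inter hDo).mem_nhds ⟨hzball, hzD⟩) fun q hq => ?_)
    exact ⟨Metric.ball_subset_closedBall hq.1, hDQ hq.2⟩
  have hFz := hF z (hKO hz.1)
  have h1 := hsub z ⟨hzD, hKO hz.1⟩ _ (contDiffAt_const.mul (contDiffAt_exp k hFz)) hloc
  rw [ellOp_const_mul _ (contDiffAt_exp k hFz)] at h1
  exact absurd h1 (not_le.mpr (mul_pos (by positivity) (hkL z hz.1)))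

end BoundaryLocal

section Boundary

variable {n : ℕ} {M : Type*} [TopologicalSpace M] [ChartedSpace (Eu n) M] [IsManifold (𝓡 n) ∞ M]

/-- A local defining function, read in a chart. -/
theorem IsDefiningFunction.exists_chart {Ω : Set M} (hΩ : IsOpen Ω) {p : M} (hp : p ∈ frontier Ω)
    {f : M → ℝ} (hf : IsDefiningFunction (n := n) Ω p f) {e : OpenPartialHomeomorph M (Eu n)}
    (he : e ∈ IsManifold.maximalAtlas (𝓡 n) ∞ M) (hpe : p ∈ e.source) :
    ∃ O, IsOpen O ∧ e p ∈ O ∧ O ⊆ e.target ∧ (∀ y ∈ O, ContDiffAt ℝ 2 (fun z => f (e.symm z)) y) ∧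
      (∀ y ∈ O, e.symm y ∈ Ω ↔ 0 < f (e.symm y)) ∧ f p = 0 ∧
      (∀ w : TangentSpace (𝓡 n) p, fderiv ℝ (fun z => f (e.symm z)) (e p) (mfderiv (𝓡 n) (𝓡 n) e p w)
        = mfderiv (𝓡 n) 𝓘(ℝ, ℝ) f p w) ∧
      fderiv ℝ (fun z => f (e.symm z)) (e p) ≠ 0 := by
  obtain ⟨hdf, U, hU, hfU, hfΩ⟩ := hf
  obtain ⟨V, hVU, hVo, hpV⟩ := mem_nhds_iff.mp hU
  have hO := e.isOpen_inter_preimage_symm hVo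
  have hpO : e p ∈ e.target ∩ e.symm ⁻¹' V := ⟨e.map_source hpe, by simpa [e.left_inv hpe] using hpV⟩
  have hcd : ∀ y ∈ e.target ∩ e.symm ⁻¹' V, ContDiffAt ℝ 2 (fun z => f (e.symm z)) y := fun y hy =>
    contDiffAt_comp_symm he hVo ENat.LEInfty.out ((hfU.mono hVU).of_le ENat.LEInfty.out) hy.1 hy.2
  have hfp : f p = 0 := by
    refine le_antisymm (not_lt.mp fun h => ?_) ?_
    · rw [hΩ.frontier_eq] at hp
      exact hp.2 ((hfΩ p (hVU hpV)).mpr h)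
    · have h1 : p ∈ closure (V ∩ Ω) := hVo.inter_closure ⟨hpV, frontier_subset_closure hp⟩
      have h2 : ContinuousWithinAt f (V ∩ Ω) p :=
        ((hfU.mono hVU).continuousOn.continuousAt (hVo.mem_nhds hpV)).continuousWithinAt
      have := mem_closure_iff_nhdsWithin_neBot.mp h1
      exact ge_of_tendsto h2.tendsto (eventually_nhdsWithin_of_forall fun x hx =>
        ((hfΩ x (hVU hx.1)).mp hx.2).le)
  have hchain : ∀ w : TangentSpace (𝓡 n) p, fderiv ℝ (fun z => f (e.symm z)) (e p)
      (mfderiv (𝓡 n) (𝓡 n) e p w) = mfderiv (𝓡 n) 𝓘(ℝ, ℝ) f p w := fun w => by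
    have hme := mdifferentiable_of_mem_maximalAtlas he
    have h1 : MDifferentiableAt (𝓡 n) 𝓘(ℝ, ℝ) (fun z => f (e.symm z)) (e p) :=
      ((hcd _ hpO).differentiableAt two_ne_zero).mdifferentiableAt
    have h2 := mfderiv_comp p h1 (hme.mdifferentiableAt hpe)
    have h3 : mfderiv (𝓡 n) 𝓘(ℝ, ℝ) ((fun z => f (e.symm z)) ∘ e) p = mfderiv (𝓡 n) 𝓘(ℝ, ℝ) f p := by
      refine Filter.EventuallyEq.mfderiv_eq ?_
      filter_upwards [e.open_source.mem_nhds hpe] with z hz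
      simp [e.left_inv hz]
    rw [h3, mfderiv_eq_fderiv] at h2
    exact (DFunLike.congr_fun h2 w).symm
  refine ⟨_, hO, hpO, inter_subset_left, hcd, fun y hy => hfΩ _ (hVU hy.2), hfp, hchain, fun h0 => ?_⟩
  apply hdf
  ext w
  rw [← hchain w, h0]
  rfl

/-- Points inside the hypersurface exist near each of its points. -/
theorem IsDefiningFunction.notMem_interior_closure {Ω : Set M} (hΩ : IsOpen Ω) {p : M}
    (hp : p ∈ frontier Ω) {f : M → ℝ} (hf : IsDefiningFunction (n := n) Ω p f) :
    p ∉ interior (closure Ω) := by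
  intro hint
  have he := IsManifold.chart_mem_maximalAtlas (I := 𝓡 n) (n := ∞) p
  set e := chartAt (Eu n) p
  have hpe : p ∈ e.source := mem_chart_source (Eu n) p
  obtain ⟨O, hO, hpO, hOt, hcd, hOΩ, hfp, -, hne⟩ := hf.exists_chart hΩ hp he hpe
  obtain ⟨w, hw⟩ : ∃ w : Eu n, 0 < fderiv ℝ (fun z => -f (e.symm z)) (e p) w := by
    by_contra! h
    refine hne (ContinuousLinearMap.ext fun w => ?_)
    have h1 := h w
    have h2 := h (-w)
    have h3 : fderiv ℝ (fun z => -f (e.symm z)) (e p) = -fderiv ℝ (fun z => f (e.symm z)) (e p) :=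
      fderiv_neg
    rw [h3] at h1 h2
    simp only [neg_apply, map_neg, neg_neg] at h1 h2
    exact le_antisymm h2 (neg_nonpos.mp h1)
  have hd : DifferentiableAt ℝ (fun z => -f (e.symm z)) (e p) :=
    ((hcd _ hpO).differentiableAt two_ne_zero).neg
  have h0 : -f (e.symm (e p)) = 0 := by rw [e.left_inv hpe, hfp, neg_zero]
  have hline : Tendsto (fun τ : ℝ => e p + τ • w) (𝓝[>] 0) (𝓝 (e p)) := by
    have : ContinuousAt (fun τ : ℝ => e p + τ • w) 0 := by fun_prop
    simpa [ContinuousAt] using this.tendsto.mono_left nhdsWithin_le_nhds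
  have hint' : ∀ᶠ y in 𝓝 (e p), e.symm y ∈ interior (closure Ω) :=
    (e.continuousAt_symm (e.map_source hpe)).eventually (by
      rw [e.left_inv hpe]; exact isOpen_interior.mem_nhds hint)
  obtain ⟨τ, h1, h2, h3⟩ := ((eventually_pos_of_fderiv_pos hd h0 hw).and
    ((hline.eventually hint').and (hline.eventually (hO.mem_nhds hpO)))).exists
  have h4 : ∀ᶠ z in 𝓝 (e p + τ • w), z ∈ O ∧ 0 < -f (e.symm z) := by
    filter_upwards [hO.mem_nhds h3, (hcd _ h3).neg.continuousAt.eventually (lt_mem_nhds h1)]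
      with z h5 h6 using ⟨h5, h6⟩
  have h5 : ∀ᶠ x in 𝓝 (e.symm (e p + τ • w)), x ∉ Ω := by
    have h6 : Tendsto e (𝓝 (e.symm (e p + τ • w))) (𝓝 (e p + τ • w)) := by
      have := (e.continuousAt (e.map_target (hOt h3))).tendsto
      rwa [e.right_inv (hOt h3)] at this
    filter_upwards [h6.eventually h4, e.open_source.mem_nhds (e.map_target (hOt h3))] with x hx hxs hxΩ
    have h7 := (hOΩ (e x) hx.1).mp (by rwa [e.left_inv hxs])
    linarith [hx.2]
  obtain ⟨V, hV, hVo, hxV⟩ := mem_nhds_iff.mp h5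
  obtain ⟨z, hz1, hz2⟩ := mem_closure_iff.mp (interior_subset h2) V hVo hxV
  exact hV hz1 hz2

/-- Two defining functions at the same point have the same tangent space. -/
theorem IsDefiningFunction.mfderiv_eq_zero {Ω : Set M} (hΩ : IsOpen Ω) {p : M}
    (hp : p ∈ frontier Ω) {f f' : M → ℝ} (hf : IsDefiningFunction (n := n) Ω p f)
    (hf' : IsDefiningFunction (n := n) Ω p f') {w : TangentSpace (𝓡 n) p}
    (hw : mfderiv (𝓡 n) 𝓘(ℝ, ℝ) f' p w = 0) : mfderiv (𝓡 n) 𝓘(ℝ, ℝ) f p w = 0 := by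
  have he := IsManifold.chart_mem_maximalAtlas (I := 𝓡 n) (n := ∞) p
  set e := chartAt (Eu n) p
  have hpe : p ∈ e.source := mem_chart_source (Eu n) p
  obtain ⟨O, hO, hpO, hOt, hcd, hOΩ, hfp, hch, hne⟩ := hf.exists_chart hΩ hp he hpe
  obtain ⟨O', hO', hpO', hOt', hcd', hOΩ', hfp', hch', hne'⟩ := hf'.exists_chart hΩ hp he hpe
  rw [← hch]
  rw [← hch'] at hw
  set A := fderiv ℝ (fun z => f (e.symm z)) (e p)
  set A' := fderiv ℝ (fun z => f' (e.symm z)) (e p) with hA'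
  -- if `A v > 0` and `A' v < 0`, the two functions contradict each other along `v`
  have key : ∀ v : Eu n, 0 < A v → A' v < 0 → False := fun v h1 h2 => by
    have hd : DifferentiableAt ℝ (fun z => f (e.symm z)) (e p) :=
      (hcd _ hpO).differentiableAt two_ne_zero
    have hd' : DifferentiableAt ℝ (fun z => -f' (e.symm z)) (e p) :=
      ((hcd' _ hpO').differentiableAt two_ne_zero).neg
    have h2' : 0 < fderiv ℝ (fun z => -f' (e.symm z)) (e p) v := by
      have h3 : fderiv ℝ (fun z => -f' (e.symm z)) (e p) = -A' := fderiv_neg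
      rw [h3, neg_apply]; linarith
    have hline : Tendsto (fun τ : ℝ => e p + τ • v) (𝓝[>] 0) (𝓝 (e p)) := by
      have : ContinuousAt (fun τ : ℝ => e p + τ • v) 0 := by fun_prop
      simpa [ContinuousAt] using this.tendsto.mono_left nhdsWithin_le_nhds
    obtain ⟨τ, h3, h4, h5, h6⟩ := ((eventually_pos_of_fderiv_pos hd (by rw [e.left_inv hpe, hfp]) h1).and
      ((eventually_pos_of_fderiv_pos hd' (by rw [e.left_inv hpe, hfp', neg_zero]) h2').and
      ((hline.eventually (hO.mem_nhds hpO)).and (hline.eventually (hO'.mem_nhds hpO'))))).exists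
    have h7 := (hOΩ' _ h6).mp ((hOΩ _ h5).mpr h3)
    linarith
  obtain ⟨v1, hv1⟩ : ∃ v1 : Eu n, 0 < A' v1 := by
    by_contra! h
    refine hne' (ContinuousLinearMap.ext fun v => ?_)
    have h2 := h (-v)
    rw [map_neg] at h2
    exact le_antisymm (h v) (neg_nonpos.mp h2)
  set w' : Eu n := mfderiv (𝓡 n) (𝓡 n) e p w
  have key2 : ∀ v : Eu n, A' v = 0 → ¬ 0 < A v := fun v h0 hv => by
    obtain ⟨η, hη, hη2⟩ : ∃ η > 0, η * A v1 < A v := by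
      refine ⟨A v / (2 * (|A v1| + 1)), by positivity, ?_⟩
      rw [div_mul_eq_mul_div, div_lt_iff₀ (by positivity)]
      nlinarith [le_abs_self (A v1), abs_nonneg (A v1)]
    refine key (v - η • v1) ?_ ?_
    · rw [map_sub, map_smul, smul_eq_mul]; linarith
    · rw [map_sub, map_smul, smul_eq_mul, h0]; nlinarith
  have h1 := key2 w' hw
  have h2 := key2 (-w') (by rw [map_neg]; exact neg_eq_zero.mpr hw)
  rw [map_neg] at h2
  change A w' = 0
  linarith

/-- The gradient of a defining function is a normal vector that points to the outside. -/
theorem Hypersurface.exists_isNormal {E : DistinguishedEnd n M} (S : Hypersurface E)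
    (g : C1Metric n M) {p : M} (hp : p ∈ S.surface) {f : M → ℝ}
    (hf : IsDefiningFunction (n := n) S.outside p f) :
    ∃ (N : TangentSpace (𝓡 n) p) (c : ℝ), 0 < c ∧ mfderiv (𝓡 n) 𝓘(ℝ, ℝ) f p N = c ∧
      S.IsNormal g.inner p N := by
  let B : Eu n →L[ℝ] Eu n →L[ℝ] ℝ := g.inner p
  let df : Eu n →L[ℝ] ℝ := mfderiv (𝓡 n) 𝓘(ℝ, ℝ) f p
  let L : Eu n →ₗ[ℝ] Module.Dual ℝ (Eu n) :=
    { toFun := fun v => (B v).toLinearMap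
      map_add' := fun v w => by ext; simp
      map_smul' := fun c v => by ext; simp }
  have hinj : Function.Injective L := by
    rw [injective_iff_map_eq_zero]
    intro v hv
    by_contra hne
    have h1 : 0 < B v v := g.pos p v hne
    have h2 : L v v = 0 := by rw [hv]; rfl
    exact h1.ne' h2
  have hsurj : Function.Surjective L :=
    (LinearMap.injective_iff_surjective_of_finrank_eq_finrank
      Subspace.dual_finrank_eq.symm).mp hinj
  obtain ⟨N, hN⟩ := hsurj df.toLinearMap
  have hN' : ∀ w : Eu n, B N w = df w := fun w => LinearMap.congr_fun hN w
  refine ⟨N, df N, ?_, rfl, fun f' hf' w hw => ?_⟩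
  swap
  · exact (hN' w).trans (hf.mfderiv_eq_zero S.isOpen hp hf' hw)
  · have hne : N ≠ 0 := fun h0 => hf.1 (by
      ext w
      have h1 := hN' w
      rw [show B N = 0 by rw [h0]; exact map_zero B] at h1
      exact h1.symm)
    rw [← hN' N]
    exact g.pos p N hne

end Boundary

/-! ### The Neumann problem -/

theorem mem_connectedComponentIn_of_mem_closure {X : Type*} [TopologicalSpace X]
    [LocallyConnectedSpace X] {Ω : Set X} (hΩ : IsOpen Ω) {x z : X} (hz : z ∈ Ω)
    (hcl : z ∈ closure (connectedComponentIn Ω x)) : z ∈ connectedComponentIn Ω x := by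
  obtain ⟨q, hq1, hq2⟩ := mem_closure_iff.mp hcl _ (hΩ.connectedComponentIn (x := z))
    (mem_connectedComponentIn hz)
  rw [connectedComponentIn_eq hq2, ← connectedComponentIn_eq hq1]
  exact mem_connectedComponentIn hz

section Neumann

variable {n : ℕ} {M : Type*} [TopologicalSpace M] [T2Space M] [ConnectedSpace M]
  [ChartedSpace (Eu n) M] [IsManifold (𝓡 n) ∞ M] {E : DistinguishedEnd n M}

/-- The derivative along a curve that enters the closed outside region with velocity `N`. -/
theorem hasDerivWithinAt_line {e : OpenPartialHomeomorph M (Eu n)}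
    (he : e ∈ IsManifold.maximalAtlas (𝓡 n) ∞ M) {p : M} (hpe : p ∈ e.source) {w : M → ℝ}
    {A : Set M} {D : TangentSpace (𝓡 n) p →L[ℝ] ℝ}
    (hD : HasMFDerivWithinAt (𝓡 n) 𝓘(ℝ, ℝ) w A p D) (N : TangentSpace (𝓡 n) p) {v : Eu n}
    (hv : mfderiv (𝓡 n) (𝓡 n) e p N = v) (hA : ∀ᶠ τ : ℝ in 𝓝[>] 0, e.symm (e p + τ • v) ∈ A) :
    HasDerivWithinAt (fun τ : ℝ => w (e.symm (e p + τ • v))) (D N) (Ioi 0) 0 := by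
  have hme := mdifferentiable_of_mem_maximalAtlas he
  have h1 : HasMFDerivWithinAt 𝓘(ℝ, Eu n) (𝓡 n) e.symm (e.symm ⁻¹' A) (e p)
      (mfderiv (𝓡 n) (𝓡 n) e.symm (e p)) :=
    (hme.mdifferentiableAt_symm (e.map_source hpe)).hasMFDerivAt.hasMFDerivWithinAt
  have hD' : HasMFDerivWithinAt (𝓡 n) 𝓘(ℝ, ℝ) w A (e.symm (e p)) (D : Eu n →L[ℝ] ℝ) := by
    rw [e.left_inv hpe]; exact hD
  have h2 := HasMFDerivWithinAt.comp (e p) hD' h1 (fun _ h => h)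
  have h3 : HasFDerivWithinAt (w ∘ e.symm)
      ((D : Eu n →L[ℝ] ℝ).comp (mfderiv (𝓡 n) (𝓡 n) e.symm (e p) : Eu n →L[ℝ] Eu n))
      (e.symm ⁻¹' A) (e p) := h2.hasFDerivWithinAt
  have h4 : (mfderiv (𝓡 n) (𝓡 n) e.symm (e p) : Eu n →L[ℝ] Eu n) v = N :=
    (congrArg (mfderiv (𝓡 n) (𝓡 n) e.symm (e p) : Eu n →L[ℝ] Eu n) hv.symm).trans
      (DFunLike.congr_fun (hme.symm_comp_deriv hpe) N)
  have h5 : HasFDerivWithinAt (w ∘ e.symm)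
      ((D : Eu n →L[ℝ] ℝ).comp (mfderiv (𝓡 n) (𝓡 n) e.symm (e p) : Eu n →L[ℝ] Eu n))
      (e.symm ⁻¹' A) (e p + (0 : ℝ) • v) := by simpa using h3
  have h6 : HasDerivWithinAt (fun τ : ℝ => e p + τ • v) v
      ((fun τ : ℝ => e p + τ • v) ⁻¹' (e.symm ⁻¹' A)) 0 := (hasDerivAt_line (e p) v 0).hasDerivWithinAt
  have h7 := h5.comp_hasDerivWithinAt (0 : ℝ) h6 (fun _ h => h)
  have h8 : ((D : Eu n →L[ℝ] ℝ).comp (mfderiv (𝓡 n) (𝓡 n) e.symm (e p) : Eu n →L[ℝ] Eu n)) v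
      = D N := congrArg D h4
  exact (h7.congr_deriv h8).mono_of_mem_nhdsWithin hA

/-- Hopf's lemma at the hypersurface: a subsolution on a component of the outside region does not
attain its strict maximum at a point where its normal derivative vanishes. -/
theorem Hypersurface.false_of_isMax (S : Hypersurface E) (g : C1Metric n M)
    {w : M → ℝ} (hw : ContinuousOn w (closure S.outside)) (hsub : IsViscSubOn g.inner w S.outside)
    {x₀ p : M} (hp : p ∈ S.surface) {D : TangentSpace (𝓡 n) p →L[ℝ] ℝ}
    (hD : HasMFDerivWithinAt (𝓡 n) 𝓘(ℝ, ℝ) w (closure S.outside) p D)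
    (hDN : ∀ N, S.IsNormal g.inner p N → D N = 0)
    (hpc : p ∈ closure (connectedComponentIn S.outside x₀))
    (hlt : ∀ x ∈ connectedComponentIn S.outside x₀, w x < w p) : False := by
  have : LocallyConnectedSpace M := ChartedSpace.locallyConnectedSpace (Eu n) M
  set Ω' := connectedComponentIn S.outside x₀
  have hΩ'o : IsOpen Ω' := S.isOpen.connectedComponentIn
  have hΩ'sub : Ω' ⊆ S.outside := connectedComponentIn_subset _ _
  have hcl : closure Ω' ⊆ closure S.outside := closure_mono hΩ'sub
  have hle : ∀ x ∈ closure Ω', w x ≤ w p := fun x hx => by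
    have : (𝓝[Ω'] x).NeBot := mem_closure_iff_nhdsWithin_neBot.mp hx
    exact le_of_tendsto ((hw x (hcl hx)).mono (hΩ'sub.trans subset_closure))
      (eventually_nhdsWithin_of_forall fun z hz => (hlt z hz).le)
  have he := IsManifold.chart_mem_maximalAtlas (I := 𝓡 n) (n := ∞) p
  set e := chartAt (Eu n) p
  have hpe : p ∈ e.source := mem_chart_source (Eu n) p
  obtain ⟨f, hf⟩ := S.regular p hp
  obtain ⟨O, hO, hpO, hOt, hcd, hOΩ, hfp, hch, hne⟩ := hf.exists_chart S.isOpen hp he hpe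
  obtain ⟨N, c, hc, hNc, hNn⟩ := S.exists_isNormal g hp hf
  set v : Eu n := mfderiv (𝓡 n) (𝓡 n) e p N with hv
  have hfv : fderiv ℝ (fun z => f (e.symm z)) (e p) v = c := (hch N).trans hNc
  have hsymm : ContinuousOn e.symm O := e.continuousOn_symm.mono hOt
  obtain ⟨ε, hε, k, hk, hbar⟩ := eventually_le_sub_barrier (D := e.target ∩ e.symm ⁻¹' Ω')
    (Q := e.symm ⁻¹' closure Ω') (φ := fun z => w (e.symm z)) (m := w p) hO hpO
    (fun i j y hy => (continuousAt_inv_coeff he g (hOt hy) i j).continuousWithinAt)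
    (fun i y hy => (continuousAt_driftCoeff (contDiffAt_coeff he g (hOt hy))
      (posDef_coeff he g (hOt hy)).det_pos i).continuousWithinAt)
    (fun y hy => (posDef_coeff he g (hOt hy)).inv) hcd hne (isOpen_target_inter hΩ'o)
    (fun K hKO hK => (hsymm.mono hKO).preimage_isClosed_of_isClosed hK isClosed_closure)
    (fun y hy hyD => not_lt.mp fun hpos => hyD ⟨hOt hy.2,
      mem_connectedComponentIn_of_mem_closure S.isOpen ((hOΩ y hy.2).mpr hpos) hy.1⟩)
    (hw.comp (hsymm.mono inter_subset_right) fun y hy => hcl hy.1)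
    (fun y hy => hsub e he y hy.1.1 (hΩ'sub hy.1.2)) (fun y hy => hle _ hy.1)
    (fun y hy => hlt _ hy.1.2) (fun y hy => subset_closure hy.2)
  have hline : Tendsto (fun τ : ℝ => e p + τ • v) (𝓝[>] 0) (𝓝 (e p)) := by
    have : ContinuousAt (fun τ : ℝ => e p + τ • v) 0 := by fun_prop
    simpa [ContinuousAt] using this.tendsto.mono_left nhdsWithin_le_nhds
  have hmem : ∀ᶠ τ : ℝ in 𝓝[>] 0, e p + τ • v ∈ e.target ∩ e.symm ⁻¹' Ω' := by
    refine eventually_mem_component (D := e.symm ⁻¹' S.outside) hO hpO hcd hOΩ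
      (by rw [e.left_inv hpe, hfp]) ?_ (fun y hy => hΩ'sub hy.2) ?_ (by rw [hfv]; exact hc)
    · rw [mem_closure_iff]
      intro V hV hpV
      obtain ⟨q, hq1, hq2⟩ := mem_closure_iff.mp hpc _ (e.isOpen_inter_preimage hV) ⟨hpe, hpV⟩
      exact ⟨e q, hq1.2, e.map_source hq1.1, by simpa [e.left_inv hq1.1] using hq2⟩
    · rintro P hPD hP ⟨q, hqP, hq⟩ z hz
      refine ⟨hOt (hPD hz).2, ?_⟩
      have h1 : e.symm '' P ⊆ connectedComponentIn S.outside (e.symm q) :=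
        (hP.image _ (hsymm.mono fun y hy => (hPD hy).2)).subset_connectedComponentIn
          ⟨q, hqP, rfl⟩ (by rintro _ ⟨y, hy, rfl⟩; exact (hPD hy).1)
      have h2 := h1 ⟨z, hz, rfl⟩
      rwa [← connectedComponentIn_eq (show e.symm q ∈ connectedComponentIn S.outside x₀ from hq.2)] at h2
  have hder := hasDerivWithinAt_line he hpe hD N hv.symm (hmem.mono fun τ h => subset_closure (hΩ'sub h.2))
  rw [hDN N hNn] at hder
  -- the barrier has derivative `-ε k c < 0` along the same line
  have hF : HasDerivWithinAt (fun τ : ℝ => w p - ε * (Real.exp (k * (f (e.symm (e p + τ • v)) +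
      -‖e p + τ • v - e p‖ ^ 2)) - 1)) (-(ε * (k * c))) (Ioi 0) 0 := by
    have h1 : HasFDerivAt (fun z => f (e.symm z)) (fderiv ℝ (fun z => f (e.symm z)) (e p))
        (e p + (0 : ℝ) • v) := by
      simpa using ((hcd _ hpO).differentiableAt two_ne_zero).hasFDerivAt
    have h2 : HasDerivAt (fun τ : ℝ => f (e.symm (e p + τ • v))) c 0 := by
      have := h1.comp_hasDerivAt (0 : ℝ) (hasDerivAt_line (e p) v 0)
      rwa [hfv] at this
    have h3 : HasDerivAt (fun τ : ℝ => -‖e p + τ • v - e p‖ ^ 2) 0 0 := by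
      have h4 : (fun τ : ℝ => -‖e p + τ • v - e p‖ ^ 2) = fun τ => -(τ ^ 2 * ‖v‖ ^ 2) := by
        ext τ; rw [add_sub_cancel_left, norm_smul, mul_pow, Real.norm_eq_abs, sq_abs]
      rw [h4]
      exact ((hasDerivAt_pow 2 (0 : ℝ)).mul_const (‖v‖ ^ 2)).neg.congr_deriv (by simp)
    have h5 := (((((h2.add h3).const_mul k).exp).sub_const 1).const_mul ε).const_sub (w p)
    refine (h5.congr_deriv ?_).hasDerivWithinAt
    simp [e.left_inv hpe, hfp]
  have hG := hF.sub hder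
  rw [hasDerivWithinAt_iff_tendsto_slope' (by simp)] at hG
  have hnn : (0 : ℝ) ≤ -(ε * (k * c)) - 0 := by
    refine ge_of_tendsto hG ?_
    filter_upwards [hmem, hline.eventually hbar, self_mem_nhdsWithin] with τ h1 h2 h3
    have h4 := h2 (subset_closure h1.2)
    have h5 : (0 : ℝ) < τ := h3
    rw [slope_def_field, sub_zero]
    refine div_nonneg ?_ h5.le
    simp only [Pi.sub_apply, zero_smul, add_zero, e.left_inv hpe, hfp, sub_self, norm_zero]
    simp only [ne_eq, OfNat.ofNat_ne_zero, not_false_eq_true, zero_pow, neg_zero, add_zero,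
      mul_zero, Real.exp_zero, sub_self, sub_zero, v] at h4 ⊢
    linarith
  have : 0 < ε * (k * c) := by positivity
  linarith

/-- A subsolution with vanishing normal derivative is, on the component of the outside region that
contains the distinguished end, bounded by its limit at infinity. -/
theorem Hypersurface.le_of_neumann (hn : 3 ≤ n) (S : Hypersurface E) (g : C1Metric n M)
    {w : M → ℝ} (hw : ContinuousOn w (closure S.outside)) (hsub : IsViscSubOn g.inner w S.outside)
    (hN : ∀ p ∈ S.surface, ∃ D : TangentSpace (𝓡 n) p →L[ℝ] ℝ,
      HasMFDerivWithinAt (𝓡 n) 𝓘(ℝ, ℝ) w (closure S.outside) p D ∧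
        ∀ N, S.IsNormal g.inner p N → D N = 0)
    {l : ℝ} (hl : E.HasLimit w l) {r : ℝ} (hr : E.R ≤ r) (hrS : E.beyond r ⊆ S.outside) :
    ∀ x ∈ E.beyond r, w x ≤ l := by
  by_contra! hcon
  obtain ⟨x1, hx1, hc1⟩ := hcon
  have : LocallyConnectedSpace M := ChartedSpace.locallyConnectedSpace (Eu n) M
  set Ω' := connectedComponentIn S.outside x1 with hΩ'
  have hΩ'o : IsOpen Ω' := S.isOpen.connectedComponentIn
  have hΩ'sub : Ω' ⊆ S.outside := connectedComponentIn_subset _ _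
  have hcl : closure Ω' ⊆ closure S.outside := closure_mono hΩ'sub
  have hx1Ω : x1 ∈ Ω' := mem_connectedComponentIn (hrS hx1)
  have hbΩ : E.beyond r ⊆ Ω' := by
    refine IsPreconnected.subset_connectedComponentIn ?_ hx1 hrS
    exact (isPreconnected_norm_mem hn isPreconnected_Ioi fun s hs =>
      E.R_pos.trans_le (hr.trans (le_of_lt hs))).image _
      (E.chart.continuousOn_symm.mono fun y hy => E.mem_target (hr.trans_lt hy))
  obtain ⟨r', hr', -, hcomp⟩ := S.exists_isCompact_diff hn
  obtain ⟨ρ, hρ⟩ : ∃ ρ, ∀ y : Eu n, ρ < ‖y‖ → w (E.chart.symm y) < w x1 := by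
    have h1 := hl.eventually (gt_mem_nhds hc1)
    rw [← comap_norm_atTop, eventually_comap] at h1
    obtain ⟨C, hC⟩ := eventually_atTop.mp h1
    exact ⟨C, fun y hy => hC ‖y‖ hy.le y rfl⟩
  have hlt : ∀ x ∈ E.beyond (max r' ρ), w x < w x1 := by
    rintro _ ⟨y, hy, rfl⟩
    exact hρ y ((le_max_right _ _).trans_lt hy)
  have hK : IsCompact (closure Ω' \ E.beyond (max r' ρ)) :=
    (hcomp (max r' ρ) (le_max_left _ _)).of_isClosed_subset
      (isClosed_closure.sdiff (E.isOpen_beyond (hr'.le.trans (le_max_left _ _))))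
      (sdiff_subset_sdiff_left hcl)
  have hx1K : x1 ∈ closure Ω' \ E.beyond (max r' ρ) :=
    ⟨subset_closure hx1Ω, fun h => lt_irrefl _ (hlt _ h)⟩
  obtain ⟨p, hp, hmax⟩ := hK.exists_isMaxOn ⟨x1, hx1K⟩ (hw.mono (sdiff_subset.trans hcl))
  have hle : ∀ x ∈ closure Ω', w x ≤ w p := fun x hx => by
    by_cases hxb : x ∈ E.beyond (max r' ρ)
    · exact (hlt x hxb).le.trans (hmax hx1K)
    · exact hmax ⟨hx, hxb⟩
  have hwc : ContinuousOn w Ω' := hw.mono (subset_closure.trans hcl)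
  -- otherwise the strong maximum principle would make `w` constant on the component
  have hltΩ : ∀ x ∈ Ω', w x < w p := by
    by_contra! h
    obtain ⟨x2, hx2, hx2p⟩ := h
    have hall : Ω' ⊆ {x | x ∈ Ω' ∧ w x = w p} := by
      by_contra hns
      obtain ⟨x3, hx3, hx3n⟩ := not_subset.mp hns
      have hu : IsOpen {x | x ∈ Ω' ∧ w x = w p} := by
        rw [isOpen_iff_mem_nhds]
        rintro x ⟨hx, hxp⟩
        filter_upwards [(hsub.mono hΩ'sub).eventually_eq g hΩ'o hwc
          (fun x hx => hle x (subset_closure hx)) hx hxp, hΩ'o.mem_nhds hx] with z h1 h2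
        exact ⟨h2, h1⟩
      have hv : IsOpen (Ω' ∩ w ⁻¹' Iio (w p)) := hwc.isOpen_inter_preimage hΩ'o isOpen_Iio
      obtain ⟨z, -, hz1, hz2⟩ := isPreconnected_connectedComponentIn (x := x1) (F := S.outside) _ _ hu hv
        (fun x hx => (hle x (subset_closure hx)).eq_or_lt.imp (fun h => ⟨hx, h⟩) fun h => ⟨hx, h⟩)
        ⟨x2, hx2, hx2, le_antisymm (hle x2 (subset_closure hx2)) hx2p⟩
        ⟨x3, hx3, hx3, lt_of_le_of_ne (hle x3 (subset_closure hx3)) fun h => hx3n ⟨hx3, h⟩⟩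
      exact (hz2.2 : w z < w p).ne hz1.2
    obtain ⟨_, y, hy, rfl⟩ := E.beyond_nonempty hn (r := max r (max r' ρ)) (hr.trans (le_max_left _ _))
    have h1 := (hall (hbΩ (E.symm_mem_beyond ((le_max_left _ _).trans_lt hy)))).2
    have h2 := hlt _ (E.symm_mem_beyond ((le_max_right _ _).trans_lt hy))
    have h3 : w x1 ≤ w p := hmax hx1K
    linarith
  have hpS : p ∈ S.surface := by
    rw [Hypersurface.surface, S.isOpen.frontier_eq]
    refine ⟨hcl hp.1, fun hpo => ?_⟩
    exact lt_irrefl _ (hltΩ p (mem_connectedComponentIn_of_mem_closure S.isOpen hpo hp.1))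
  obtain ⟨D, hD, hDN⟩ := hN p hpS
  exact S.false_of_isMax g hw hsub hpS hD hDN hp.1 hltΩ

end Neumann
/-! ### Closing functions of the double -/

namespace Hypersurface

variable {n : ℕ} {M : Type*} [TopologicalSpace M] [ChartedSpace (Eu n) M] {E : DistinguishedEnd n M}

theorem sheet_of_notMem (S : Hypersurface E) (χ : S.Double → ℝ) (b : Bool) {x : M}
    (hx : x ∉ closure S.outside) : S.sheet χ b x = 0 := dif_neg hx

theorem sheet_eq_of_mem_surface (S : Hypersurface E) (χ : S.Double → ℝ) {x : M}
    (hx : x ∈ S.surface) : S.sheet χ false x = S.sheet χ true x := by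
  have hcl : x ∈ closure S.outside := frontier_subset_closure hx
  rw [sheet, sheet, dif_pos hcl, dif_pos hcl]
  exact congrArg χ (Quotient.sound ⟨rfl, Or.inr hx⟩)

/-- The difference of a function on the double and its reflection, on the sheet `true`. -/
def sheetDiff (S : Hypersurface E) (χ : S.Double → ℝ) (x : M) : ℝ :=
  S.sheet χ true x - S.sheet χ false x

theorem sheetDiff_eq_zero (S : Hypersurface E) (χ : S.Double → ℝ) {x : M} (hx : x ∉ S.outside) :
    S.sheetDiff χ x = 0 := by
  by_cases hcl : x ∈ closure S.outside
  · have : x ∈ S.surface := by rw [surface, S.isOpen.frontier_eq]; exact ⟨hcl, hx⟩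
    rw [sheetDiff, S.sheet_eq_of_mem_surface χ this, sub_self]
  · rw [sheetDiff, S.sheet_of_notMem χ _ hcl, S.sheet_of_notMem χ _ hcl, sub_self]

namespace IsClosingFunction

variable [T2Space M] [IsManifold (𝓡 n) ∞ M] [ConnectedSpace M] {S : Hypersurface E}
  {g : C1Metric n M} {χ : S.Double → ℝ}

theorem continuousOn_sheet (hχ : S.IsClosingFunction g.inner χ) (b : Bool) :
    ContinuousOn (S.sheet χ b) (closure S.outside) := (hχ.contMDiffOn_one b).continuousOn

theorem isC2HarmonicOn_sheet (hχ : S.IsClosingFunction g.inner χ) (b : Bool) :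
    IsC2HarmonicOn g.inner (S.sheet χ b) S.outside :=
  isC2HarmonicOn_of_isHarmonicOn S.isOpen (hχ.contMDiffOn_two b) (hχ.harmonic b)

/-- The sum of the two sheets has vanishing normal derivative. -/
theorem exists_hasMFDerivWithinAt_add (hχ : S.IsClosingFunction g.inner χ) {p : M}
    (hp : p ∈ S.surface) : ∃ D : TangentSpace (𝓡 n) p →L[ℝ] ℝ,
      HasMFDerivWithinAt (𝓡 n) 𝓘(ℝ, ℝ) (fun x => S.sheet χ true x + S.sheet χ false x)
        (closure S.outside) p D ∧ ∀ N, S.IsNormal g.inner p N → D N = 0 := by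
  have h := fun b => ((hχ.contMDiffOn_one b).mdifferentiableOn one_ne_zero p
    (frontier_subset_closure hp)).hasMFDerivWithinAt
  exact ⟨_, (h true).add (h false), fun N hN => hχ.matching p hp N hN⟩

/-- By reflection, a closing function and its mirror image add up to `1` on the component of the
distinguished end. -/
theorem sheet_add_sheet (hn : 3 ≤ n) (hχ : S.IsClosingFunction g.inner χ) {r : ℝ} (hr : E.R ≤ r)
    (hrS : E.beyond r ⊆ S.outside) {x : M} (hx : x ∈ E.beyond r) :
    S.sheet χ true x + S.sheet χ false x = 1 := by
  have hlim : E.HasLimit (fun x => S.sheet χ true x + S.sheet χ false x) 1 := by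
    simpa [DistinguishedEnd.HasLimit] using hχ.limit_one.add hχ.limit_zero
  have hharm := (hχ.isC2HarmonicOn_sheet true).add (hχ.isC2HarmonicOn_sheet false)
  have hcont := (hχ.continuousOn_sheet true).add (hχ.continuousOn_sheet false)
  refine le_antisymm (S.le_of_neumann hn g hcont hharm.isViscSubOn
    (fun p hp => hχ.exists_hasMFDerivWithinAt_add hp) hlim hr hrS x hx) ?_
  refine neg_le_neg_iff.mp (S.le_of_neumann hn g hcont.neg hharm.neg.isViscSubOn
    (fun p hp => ?_) hlim.neg hr hrS x hx)
  obtain ⟨D, hD, hDN⟩ := hχ.exists_hasMFDerivWithinAt_add hp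
  exact ⟨-D, hD.neg, fun N hN => by rw [neg_apply, hDN N hN, neg_zero]⟩

theorem isC2HarmonicOn_sheetDiff (hχ : S.IsClosingFunction g.inner χ) :
    IsC2HarmonicOn g.inner (S.sheetDiff χ) S.outside :=
  (hχ.isC2HarmonicOn_sheet true).sub (hχ.isC2HarmonicOn_sheet false)

theorem continuous_sheetDiff (hχ : S.IsClosingFunction g.inner χ) : Continuous (S.sheetDiff χ) := by
  have h1 : ContinuousOn (S.sheetDiff χ) (closure S.outside) :=
    (hχ.continuousOn_sheet true).sub (hχ.continuousOn_sheet false)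
  have h2 : ContinuousOn (S.sheetDiff χ) S.outsideᶜ :=
    continuousOn_const.congr fun x hx => S.sheetDiff_eq_zero χ hx
  rw [← continuousOn_univ]
  refine (h1.union_of_isClosed h2 isClosed_closure S.isOpen.isClosed_compl).mono fun x _ => ?_
  exact (em (x ∈ S.outside)).imp (fun h => subset_closure h) id

theorem hasLimit_sheetDiff (hχ : S.IsClosingFunction g.inner χ) :
    E.HasLimit (S.sheetDiff χ) 1 := by
  simpa [DistinguishedEnd.HasLimit, sheetDiff] using hχ.limit_one.sub hχ.limit_zero

theorem sheetDiff_nonneg (hn : 3 ≤ n) (hχ : S.IsClosingFunction g.inner χ) (x : M) :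
    0 ≤ S.sheetDiff χ x := by
  by_cases hx : x ∈ S.outside
  · have := S.le_of_isViscSubOn hn g (φ := fun x => -S.sheetDiff χ x)
      hχ.continuous_sheetDiff.neg.continuousOn hχ.isC2HarmonicOn_sheetDiff.neg.isViscSubOn (c := 0)
      (fun z hz => by
        rw [S.sheetDiff_eq_zero χ (by rw [surface, S.isOpen.frontier_eq] at hz; exact hz.2), neg_zero])
      hχ.hasLimit_sheetDiff.neg (by norm_num) x (subset_closure hx)
    linarith
  · rw [S.sheetDiff_eq_zero χ hx]

/-- By the strong maximum principle the difference vanishes near each of its zeros outside `S`. Zeros occur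
on the components of the outside region that do not meet the end. -/
theorem eventually_sheetDiff_eq_zero (hn : 3 ≤ n) (hχ : S.IsClosingFunction g.inner χ) {x : M}
    (hx : x ∈ S.outside) (h0 : S.sheetDiff χ x = 0) : ∀ᶠ z in 𝓝 x, S.sheetDiff χ z = 0 := by
  have := hχ.isC2HarmonicOn_sheetDiff.neg.isViscSubOn.eventually_eq g S.isOpen (m := 0)
    hχ.continuous_sheetDiff.neg.continuousOn
    (fun z _ => neg_nonpos.mpr (hχ.sheetDiff_nonneg hn z)) hx (neg_eq_zero.mpr h0)
  filter_upwards [this] with z hz using neg_eq_zero.mp hz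

end IsClosingFunction

end Hypersurface

namespace ConformalFlow

variable {n : ℕ} {M : Type*} [TopologicalSpace M] [T2Space M] [ConnectedSpace M]
  [ChartedSpace (Eu n) M] [IsManifold (𝓡 n) ∞ M] {E : DistinguishedEnd n M} (F : ConformalFlow E)
  {S : Hypersurface E} {χ : S.Double → ℝ} {t : ℝ}

/-- The function `(χ ∘ reflection - χ) u_t`: it is `g_0`-harmonic outside `S`, vanishes on and inside
`S`, and tends to `-e^(-t)` at infinity, like `v_t` for `S = Σ(t)`. -/
def potential (t : ℝ) (χ : S.Double → ℝ) (x : M) : ℝ := -S.sheetDiff χ x * F.u t x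

theorem potential_eq_zero {x : M} (hx : x ∉ S.outside) : F.potential t χ x = 0 := by
  rw [potential, S.sheetDiff_eq_zero χ hx, neg_zero, zero_mul]

theorem continuous_potential (hn : 3 ≤ n) (ht : 0 ≤ t)
    (hχ : S.IsClosingFunction (F.g t).inner χ) : Continuous (F.potential t χ) :=
  hχ.continuous_sheetDiff.neg.mul (F.continuous_u hn ht)

theorem hasLimit_potential (hn : 3 ≤ n) (ht : 0 ≤ t)
    (hχ : S.IsClosingFunction (F.g t).inner χ) : E.HasLimit (F.potential t χ) (-Real.exp (-t)) := by
  have := hχ.hasLimit_sheetDiff.neg.mul (F.hasLimit_u hn ht)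
  simpa [DistinguishedEnd.HasLimit, potential] using this

/-- The conformal Laplacian is covariant, in the viscosity sense: `u_t` is only of class `C¹`. -/
theorem isViscSubOn_mul_potential (hn : 3 ≤ n) (ht : 0 ≤ t)
    (hχ : S.IsClosingFunction (F.g t).inner χ)
    (hS : ∀ s, 0 ≤ s → s < t → S.outside ⊆ (F.Sig s).outside) {c : ℝ} (hc : c ≠ 0) :
    IsViscSubOn (F.g 0).inner (fun x => c * F.potential t χ x) S.outside := by
  intro e he y hy hyS
  by_cases h0 : S.sheetDiff χ (e.symm y) = 0
  · have h1 := (e.continuousAt_symm hy).eventually (hχ.eventually_sheetDiff_eq_zero hn hyS h0)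
    refine (isViscSubAt_of_contDiffAt (v := fun _ => 0) (posDef_coeff he (F.g 0) hy).inv.posSemidef
      contDiffAt_const (ellOp_const 0 y).ge).congr ?_
    filter_upwards [h1] with z hz
    simp [potential, hz]
  have hO := (isOpen_target_inter (e := e) S.isOpen).mem_nhds ⟨hy, hyS⟩
  obtain ⟨hκ, hLκ⟩ := hχ.isC2HarmonicOn_sheetDiff.const_mul (-c) e he y hy hyS
  have hu := F.contDiffAt_u hn ht he hy
  have hG := contDiffAt_coeff he (F.g 0) hy
  have hpd := posDef_coeff he (F.g 0) hy
  have hL : coordLaplacian (coeff (F.g t).inner e) (fun z => -c * S.sheetDiff χ (e.symm z)) y = 0 := by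
    rw [coordLaplacian_eq_lapOp (contDiffAt_coeff he (F.g t) hy) (posDef_coeff he (F.g t) hy).det_pos hκ]
    exact hLκ
  have heq := lapOp_of_coordLaplacian_conformal hn hG hpd.det_pos hu (F.u_pos t ht _)
    (Eventually.of_forall fun z => by rw [F.conformal_eq t ht, coeff_conformal]) hκ hL
  have hψ := fun N => F.isC2HarmonicOn_riemannSum ht hS N
  have h := isViscSubAt_mul (ψ := fun N z => F.riemannSum t N (e.symm z)) hO
    (fun i j => continuousAt_inv_coeff he (F.g 0) hy i j)
    (fun i => continuousAt_driftCoeff hG hpd.det_pos i)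
    (fun z hz => (posDef_coeff he (F.g 0) hz.1).inv) hκ (mul_ne_zero (neg_ne_zero.mpr hc) h0)
    (hu.differentiableAt one_ne_zero) heq (fun N z hz => (hψ N e he z hz.1 hz.2).1)
    (fun N z hz => (hψ N e he z hz.1 hz.2).2)
    ((F.tendstoUniformly_riemannSum hn ht).comp e.symm).tendstoUniformlyOn
    (continuousOn_comp_symm (F.continuous_u hn ht).continuousOn)
  refine h.congr (Eventually.of_forall fun z => ?_)
  simp only [potential]; ring

end ConformalFlow

/-! ### Convergence of the velocities -/

namespace ConformalFlow

variable {n : ℕ} {M : Type*} [TopologicalSpace M] [T2Space M] [ConnectedSpace M]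
  [ChartedSpace (Eu n) M] [IsManifold (𝓡 n) ∞ M] {E : DistinguishedEnd n M} (F : ConformalFlow E)
  {S : Hypersurface E} {χ : S.Double → ℝ} {t : ℝ}

theorem _root_.ConfFlow.Hypersurface.ConvergesTo.eventually_mem_iff {Sig : ℝ → Hypersurface E}
    {l : Filter ℝ} (h : Hypersurface.ConvergesTo Sig l S) {x : M} (hx : x ∉ S.surface) :
    ∀ᶠ s in l, x ∈ (Sig s).outside ↔ x ∈ S.outside := by
  filter_upwards [h {x}ᶜ isOpen_compl_singleton fun z hz hzx => hx (hzx ▸ hz)] with s hs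
  by_contra hne
  refine hs (a := x) ?_ rfl
  rw [mem_symmDiff]; tauto

theorem _root_.ConfFlow.Hypersurface.notMem_surface {x : M} (hx : x ∈ S.outside) :
    x ∉ S.surface := fun h => by
  rw [Hypersurface.surface, S.isOpen.frontier_eq] at h; exact h.2 hx

theorem _root_.ConfFlow.Hypersurface.notMem_outside {x : M} (hx : x ∈ S.surface) :
    x ∉ S.outside := fun h => Hypersurface.notMem_surface h hx

/-- As the outsides of the `Σ(s)` decrease, that of the limit is contained in each of the earlier ones. -/
theorem outside_subset_of_tendsto_left
    (h : Hypersurface.ConvergesTo F.Sig (𝓝[<] t) S) {s : ℝ} (hs : 0 ≤ s) (hst : s < t) :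
    S.outside ⊆ (F.Sig s).outside := fun x hx => by
  obtain ⟨r, hr, hr1⟩ := ((h.eventually_mem_iff (Hypersurface.notMem_surface hx)).and
    (Ioo_mem_nhdsLT hst)).exists
  exact F.encloses s r hs hr1.1.le (hr.mpr hx)

theorem outside_subset_of_tendsto_right
    (h : Hypersurface.ConvergesTo F.Sig (𝓝[>] t) S) {s : ℝ} (hs : 0 ≤ s) (hst : s < t) :
    S.outside ⊆ (F.Sig s).outside := fun x hx => by
  obtain ⟨r, hr, hr1⟩ := ((h.eventually_mem_iff (Hypersurface.notMem_surface hx)).and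
    self_mem_nhdsWithin).exists
  exact F.encloses s r hs (hst.trans hr1).le (hr.mpr hx)

/-- A later outside region is contained in that of the limit: by convergence only points of the limit
hypersurface could be exceptions, and every one of them has points strictly inside nearby. -/
theorem subset_outside_of_tendsto_right (ht : 0 ≤ t)
    (h : Hypersurface.ConvergesTo F.Sig (𝓝[>] t) S) {s : ℝ} (hst : t < s) :
    (F.Sig s).outside ⊆ S.outside := fun x hx => by
  have key : ∀ z ∈ (F.Sig s).outside, z ∉ S.outside → z ∈ S.surface := fun z hz hzS => by
    by_contra hns
    obtain ⟨r, hr, hr1⟩ := ((h.eventually_mem_iff hns).and (Ioo_mem_nhdsGT hst)).exists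
    exact hzS (hr.mp (F.encloses r s (ht.trans hr1.1.le) hr1.2.le hz))
  by_contra hxS
  obtain ⟨f, hf⟩ := S.regular x (key x hx hxS)
  refine hf.notMem_interior_closure S.isOpen (key x hx hxS)
    (mem_interior.mpr ⟨_, fun z hz => ?_, (F.Sig s).isOpen, hx⟩)
  by_cases hzS : z ∈ S.outside
  · exact subset_closure hzS
  · exact frontier_subset_closure (key z hz hzS)

theorem tendsto_exp_sub (l : Filter ℝ) (hl : l ≤ 𝓝 t) {ε : ℝ} (hε : 0 < ε) :
    ∀ᶠ s in l, |Real.exp (-s) - Real.exp (-t)| < ε := by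
  have h : ContinuousAt (fun s : ℝ => |Real.exp (-s) - Real.exp (-t)|) t := by fun_prop
  have h2 : Tendsto (fun s : ℝ => |Real.exp (-s) - Real.exp (-t)|) l (𝓝 0) := by
    simpa [ContinuousAt] using h.tendsto.mono_left hl
  exact h2.eventually (gt_mem_nhds hε)

/-- The difference of `v_s` and a potential is bounded by its values on a hypersurface outside of
which both are harmonic. -/
theorem abs_v_sub_potential_le (hn : 3 ≤ n) (ht : 0 ≤ t)
    (hχ : S.IsClosingFunction (F.g t).inner χ)
    (hS : ∀ s, 0 ≤ s → s < t → S.outside ⊆ (F.Sig s).outside) {s : ℝ} (hs : 0 ≤ s)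
    {T : Hypersurface E} (hT : T.outside ⊆ S.outside) (hT' : T.outside ⊆ (F.Sig s).outside) {ε : ℝ}
    (hε : |Real.exp (-s) - Real.exp (-t)| < ε)
    (hb : ∀ x ∈ T.surface, |F.v s x - F.potential t χ x| ≤ ε) :
    ∀ x ∈ T.outside, |F.v s x - F.potential t χ x| ≤ ε := by
  have hv := (F.dirichlet s hs).isC2HarmonicOn.mono hT'
  have hvc := (F.dirichlet s hs).continuous
  have hwc := F.continuous_potential hn ht hχ
  have hlim : E.HasLimit (fun x => F.v s x - F.potential t χ x)
    (-Real.exp (-s) - -Real.exp (-t)) := (F.dirichlet s hs).limit.sub (F.hasLimit_potential hn ht hχ)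
  have hε' := abs_lt.mp hε
  intro x hx
  refine abs_le.mpr ⟨neg_le.mp ?_, ?_⟩
  · refine T.le_of_isViscSubOn hn (F.g 0) (φ := fun x => -(F.v s x - F.potential t χ x))
      (hvc.sub hwc).neg.continuousOn ?_ (fun z hz => neg_le.mp (abs_le.mp (hb z hz)).1) hlim.neg
      (by linarith) x (subset_closure hx)
    have h := ((F.isViscSubOn_mul_potential hn ht hχ hS (c := 1) one_ne_zero).mono hT).add hv.neg
    convert h using 2; ring
  · refine T.le_of_isViscSubOn hn (F.g 0) (hvc.sub hwc).continuousOn ?_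
      (fun z hz => (abs_le.mp (hb z hz)).2) hlim (by linarith) x (subset_closure hx)
    have h := ((F.isViscSubOn_mul_potential hn ht hχ hS (c := -1) (by norm_num)).mono hT).add hv
    convert h using 2
    rw [Pi.sub_apply]; ring

/-- For `s ↓ t` the functions are compared outside `Σ(s)`, where both are harmonic: the points of
`Σ(s)` are close to `S`, and so the potential is small there. -/
theorem eventually_abs_v_sub_potential_le_right (hn : 3 ≤ n) (ht : 0 ≤ t)
    (h : Hypersurface.ConvergesTo F.Sig (𝓝[>] t) S)
    (hχ : S.IsClosingFunction (F.g t).inner χ) {ε : ℝ} (hε : 0 < ε) :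
    ∀ᶠ s in 𝓝[>] t, ∀ x, |F.v s x - F.potential t χ x| ≤ ε := by
  have hN : IsOpen {x | |F.potential t χ x| < ε} :=
    isOpen_lt (F.continuous_potential hn ht hχ).abs continuous_const
  filter_upwards [h _ hN fun x hx => by
    simpa [F.potential_eq_zero (Hypersurface.notMem_outside hx)] using hε,
    tendsto_exp_sub _ nhdsWithin_le_nhds hε, self_mem_nhdsWithin] with s hs1 hs2 hs3
  have hs : 0 ≤ s := ht.trans (le_of_lt hs3)
  have hout : ∀ x ∉ (F.Sig s).outside, |F.v s x - F.potential t χ x| ≤ ε := fun x hx => by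
    rw [(F.dirichlet s hs).eq_zero x hx, zero_sub, abs_neg]
    by_cases hxS : x ∈ S.outside
    · exact le_of_lt (hs1 (mem_symmDiff.mpr (Or.inr ⟨hxS, hx⟩)))
    · rw [F.potential_eq_zero hxS, abs_zero]; exact hε.le
  intro x
  by_cases hx : x ∈ (F.Sig s).outside
  · exact F.abs_v_sub_potential_le hn ht hχ
      (fun r hr hrt => F.outside_subset_of_tendsto_right h hr hrt) hs
      (F.subset_outside_of_tendsto_right ht h hs3) le_rfl hs2
      (fun z hz => hout z (Hypersurface.notMem_outside hz)) x hx
  · exact hout x hx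

/-- Near the limit hypersurface, the functions `v_s` are uniformly small: a barrier that vanishes at a
small distance inside the limit bounds them. -/
theorem exists_eventually_neg_v_le (hn : 3 ≤ n) (ht : 0 < t)
    (h : Hypersurface.ConvergesTo F.Sig (𝓝[<] t) S) {p : M} (hp : p ∈ S.surface) {ε : ℝ}
    (hε : 0 < ε) : ∃ U ∈ 𝓝 p, ∀ᶠ s in 𝓝[<] t, ∀ x ∈ U, -F.v s x ≤ ε := by
  have he := IsManifold.chart_mem_maximalAtlas (I := 𝓡 n) (n := ∞) p
  set e := chartAt (Eu n) p
  have hpe : p ∈ e.source := mem_chart_source (Eu n) p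
  obtain ⟨f, hf⟩ := S.regular p hp
  obtain ⟨O, hO, hpO, hOt, hcd, hOΩ, hfp, hch, hne⟩ := hf.exists_chart S.isOpen hp he hpe
  set a : Eu n → Matrix (Fin n) (Fin n) ℝ := fun z => (coeff (F.g 0).inner e z)⁻¹
  set b := driftCoeff (coeff (F.g 0).inner e)
  -- `G ≤ 0` on the closure of the outside of `S`, with equality at `p` only, so that `exp (k G)` is a barrier
  set G : Eu n → ℝ := fun y => -f (e.symm y) + -‖y - e p‖ ^ 2
  have hG : ∀ y ∈ O, ContDiffAt ℝ 2 G y := fun y hy =>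
    (hcd y hy).neg.add (contDiff_neg_normSq (e p)).contDiffAt
  have hdG : fderiv ℝ G (e p) ≠ 0 := by
    have : fderiv ℝ G (e p) = -fderiv ℝ (fun z => f (e.symm z)) (e p) := by
      rw [fderiv_fun_add ((hcd _ hpO).neg.differentiableAt two_ne_zero)
        ((contDiff_neg_normSq (e p)).differentiable two_ne_zero (e p)), fderiv_fun_neg]
      refine ContinuousLinearMap.ext fun w => ?_
      rw [add_apply, fderiv_neg_normSq]
      simp
    rw [this]; exact neg_ne_zero.mpr hne
  have hev : ∀ᶠ y in 𝓝 (e p), y ∈ O ∧ fderiv ℝ G y ≠ 0 := by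
    have hc : ContinuousAt (fderiv ℝ G) (e p) :=
      ((hG _ hpO).fderiv_right (m := 0) (by norm_num)).continuousAt
    filter_upwards [hO.mem_nhds hpO, hc.eventually_ne hdG] with y h1 h2 using ⟨h1, h2⟩
  obtain ⟨ρ, hρ, hball⟩ := Metric.nhds_basis_closedBall.mem_iff.mp hev
  set K := Metric.closedBall (e p) ρ
  have hKc : IsCompact K := isCompact_closedBall (e p) ρ
  have hKO : K ⊆ O := fun y hy => (hball hy).1
  obtain ⟨k, hk, hkL⟩ := exists_barrier (a := a) (b := b) hKc
    (fun i j y hy => (continuousAt_inv_coeff he (F.g 0) (hOt (hKO hy)) i j).continuousWithinAt)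
    (fun i y hy => (continuousAt_driftCoeff (contDiffAt_coeff he (F.g 0) (hOt (hKO hy)))
      (posDef_coeff he (F.g 0) (hOt (hKO hy))).det_pos i).continuousWithinAt)
    (fun y hy => (posDef_coeff he (F.g 0) (hOt (hKO hy))).inv) (fun y hy => hG y (hKO hy))
    fun y hy => (hball hy).2
  have hGp : G (e p) = 0 := by simp [G, e.left_inv hpe, hfp]
  have hq : Real.exp (-(k * ρ ^ 2)) < 1 := Real.exp_lt_one_iff.mpr (by nlinarith [pow_pos hρ 2, mul_pos hk (pow_pos hρ 2)])
  -- with this factor the barrier exceeds `1`, a bound for `-v_s`, on the sphere around `p`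
  set A := (1 - Real.exp (-(k * ρ ^ 2)))⁻¹ with hA
  have hA0 : 0 < A := inv_pos.mpr (by linarith)
  obtain ⟨δ, hδ, hδε⟩ : ∃ δ > 0, A * (Real.exp (k * δ) - 1) < ε / 2 := by
    have h1 : ContinuousAt (fun δ : ℝ => A * (Real.exp (k * δ) - 1)) 0 := by fun_prop
    have h2 : Tendsto (fun δ : ℝ => A * (Real.exp (k * δ) - 1)) (𝓝[>] 0) (𝓝 0) := by
      simpa [ContinuousAt] using h1.tendsto.mono_left nhdsWithin_le_nhds
    obtain ⟨δ, h3, h4⟩ := ((h2.eventually (gt_mem_nhds (half_pos hε))).and self_mem_nhdsWithin).exists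
    exact ⟨δ, h4, h3⟩
  have hnear : ∀ᶠ y in 𝓝 (e p), A * (1 - Real.exp (k * G y)) < ε / 2 := by
    have h1 : ContinuousAt (fun y => A * (1 - Real.exp (k * G y))) (e p) :=
      ((((hG _ hpO).continuousAt).const_mul k).rexp.const_sub 1).const_mul A
    refine h1.tendsto.eventually (gt_mem_nhds ?_)
    rw [hGp]; simpa using hε
  have hfc : ContinuousOn (fun y => f (e.symm y)) K := fun y hy =>
    (hcd y (hKO hy)).continuousAt.continuousWithinAt
  -- inside `S`, off the `δ`-neighbourhood, `v_s` eventually vanishes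
  have hzero : ∀ᶠ s in 𝓝[<] t, ∀ y ∈ K, f (e.symm y) ≤ -δ → e.symm y ∉ (F.Sig s).outside := by
    set C := e.symm '' (K ∩ (fun y => f (e.symm y)) ⁻¹' Iic (-δ))
    have hC : IsCompact C := (hKc.of_isClosed_subset
      (hfc.preimage_isClosed_of_isClosed hKc.isClosed isClosed_Iic) inter_subset_left).image_of_continuousOn
        (e.continuousOn_symm.mono fun y hy => hOt (hKO hy.1))
    have hCS : ∀ y ∈ K, f (e.symm y) ≤ -δ → e.symm y ∉ closure S.outside := fun y hy hyf hcl => by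
      have h1 : ∀ᶠ z in 𝓝 y, z ∈ O ∧ f (e.symm z) < 0 := by
        filter_upwards [hO.mem_nhds (hKO hy), (hcd y (hKO hy)).continuousAt.eventually
          (gt_mem_nhds (show f (e.symm y) < 0 by linarith))] with z h1 h2 using ⟨h1, h2⟩
      have h2 : ∀ᶠ x in 𝓝 (e.symm y), x ∉ S.outside := by
        have h6 : Tendsto e (𝓝 (e.symm y)) (𝓝 y) := by
          have := (e.continuousAt (e.map_target (hOt (hKO hy)))).tendsto
          rwa [e.right_inv (hOt (hKO hy))] at this
        filter_upwards [h6.eventually h1, e.open_source.mem_nhds (e.map_target (hOt (hKO hy)))]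
          with x hx hxs hxΩ
        have h7 := (hOΩ (e x) hx.1).mp (by rwa [e.left_inv hxs])
        linarith [hx.2]
      obtain ⟨V, hV, hVo, hxV⟩ := mem_nhds_iff.mp h2
      obtain ⟨z, hz1, hz2⟩ := mem_closure_iff.mp hcl V hVo hxV
      exact hV hz1 hz2
    filter_upwards [h Cᶜ hC.isClosed.isOpen_compl (by
      rintro x hx ⟨y, hy, rfl⟩
      exact hCS y hy.1 hy.2 (frontier_subset_closure hx))] with s hs y hy hyf hys
    exact hs (mem_symmDiff.mpr (Or.inl ⟨hys, fun hyS => hCS y hy hyf (subset_closure hyS)⟩))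
      ⟨y, ⟨hy, hyf⟩, rfl⟩
  have hUy : {y | y ∈ Metric.ball (e p) ρ ∧ A * (1 - Real.exp (k * G y)) < ε / 2} ∈ 𝓝 (e p) := by
    filter_upwards [Metric.ball_mem_nhds (e p) hρ, hnear] with y h1 h2 using ⟨h1, h2⟩
  refine ⟨_, inter_mem (e.open_source.mem_nhds hpe) ((e.continuousAt hpe).preimage_mem_nhds hUy), ?_⟩
  filter_upwards [hzero, Ioo_mem_nhdsLT ht] with s hs hst
  have hs0 : 0 ≤ s := hst.1.le
  have hv := (F.dirichlet s hs0)
  -- comparison with the barrier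
  have hcomp : ∀ y ∈ K, -δ ≤ f (e.symm y) →
      -F.v s (e.symm y) ≤ A * (Real.exp (k * δ) - Real.exp (k * G y)) := by
    by_contra! hcon
    obtain ⟨y1, hy1, hy1f, hy1v⟩ := hcon
    set T := K ∩ (fun y => f (e.symm y)) ⁻¹' Ici (-δ)
    have hT : IsCompact T := hKc.of_isClosed_subset
      (hfc.preimage_isClosed_of_isClosed hKc.isClosed isClosed_Ici) inter_subset_left
    have hvc : ContinuousOn (fun y => F.v s (e.symm y)) K :=
      hv.continuous.comp_continuousOn (e.continuousOn_symm.mono fun y hy => hOt (hKO hy))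
    have hGc : ContinuousOn (fun y => Real.exp (k * G y)) K := fun y hy =>
      (((hG y (hKO hy)).continuousAt).const_mul k).rexp.continuousWithinAt
    obtain ⟨z, hz, hmax⟩ := hT.exists_isMaxOn ⟨y1, hy1, hy1f⟩
      ((hvc.neg.add (hGc.const_mul A)).mono inter_subset_left :
        ContinuousOn (fun y => -F.v s (e.symm y) + A * Real.exp (k * G y)) T)
    have hzgt : A * Real.exp (k * δ) < -F.v s (e.symm z) + A * Real.exp (k * G z) := by
      have h1 : -F.v s (e.symm y1) + A * Real.exp (k * G y1) ≤
        -F.v s (e.symm z) + A * Real.exp (k * G z) := hmax ⟨hy1, hy1f⟩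
      have h2 : A * (Real.exp (k * δ) - Real.exp (k * G y1)) =
        A * Real.exp (k * δ) - A * Real.exp (k * G y1) := mul_sub _ _ _
      linarith
    have hzf : -δ ≤ f (e.symm z) := hz.2
    have hGle : G z ≤ δ - dist z (e p) ^ 2 := by simp only [G, dist_eq_norm]; linarith
    have hzs : e.symm z ∈ (F.Sig s).outside := by
      by_contra hzs
      have h1 : Real.exp (k * G z) ≤ Real.exp (k * δ) := by
        gcongr; linarith [sq_nonneg (dist z (e p))]
      have h2 := mul_le_mul_of_nonneg_left h1 hA0.le
      rw [hv.eq_zero _ hzs] at hzgt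
      linarith
    have hzball : z ∈ Metric.ball (e p) ρ := by
      refine lt_of_le_of_ne (Metric.mem_closedBall.mp hz.1) fun hsph => ?_
      rw [hsph] at hGle
      have h1 : Real.exp (k * G z) ≤ Real.exp (k * δ) * Real.exp (-(k * ρ ^ 2)) := by
        rw [← Real.exp_add]; gcongr; nlinarith
      have h2 : 1 ≤ Real.exp (k * δ) := Real.one_le_exp (by positivity)
      have h3 := F.neg_one_le_v hn hs0 (e.symm z)
      have h4 := mul_le_mul_of_nonneg_left h1 hA0.le
      have h5 : A * (1 - Real.exp (-(k * ρ ^ 2))) = 1 := inv_mul_cancel₀ (by linarith)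
      have h6 : A * Real.exp (k * δ) - A * (Real.exp (k * δ) * Real.exp (-(k * ρ ^ 2))) =
        Real.exp (k * δ) * (A * (1 - Real.exp (-(k * ρ ^ 2)))) := by ring
      rw [h5, mul_one] at h6
      linarith
    have hzf' : -δ < f (e.symm z) := lt_of_le_of_ne hzf fun heq => hs z hz.1 heq.ge hzs
    have hloc : IsLocalMax (fun y => -F.v s (e.symm y) + A * Real.exp (k * G y)) z := by
      refine hmax.isLocalMax ?_
      filter_upwards [Metric.isOpen_ball.mem_nhds hzball,
        (hcd z (hKO hz.1)).continuousAt.eventually (lt_mem_nhds hzf')] with q h1 h2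
      exact ⟨Metric.ball_subset_closedBall h1, le_of_lt h2⟩
    obtain ⟨h1, h2⟩ := hv.isC2HarmonicOn.neg e he z (hOt (hKO hz.1)) hzs
    have hGz := contDiffAt_exp k (hG z (hKO hz.1))
    have h3 := ellOp_nonpos_of_isLocalMax (a := a) (b := b)
      (posDef_coeff he (F.g 0) (hOt (hKO hz.1))).inv.posSemidef (h1.add (contDiffAt_const.mul hGz)) hloc
    rw [ellOp_add h1 (contDiffAt_const.mul hGz), ellOp_const_mul _ hGz] at h3
    have h4 : ellOp a b (fun y => -F.v s (e.symm y)) z = 0 := h2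
    have h5 := mul_pos hA0 (hkL z hz.1)
    linarith
  rintro x ⟨hxs, hxb, hxA⟩
  have hxK : e x ∈ K := Metric.ball_subset_closedBall hxb
  have hxe := e.left_inv hxs
  rcases le_total (-δ) (f (e.symm (e x))) with h1 | h1
  · have h2 := hcomp (e x) hxK h1
    rw [hxe] at h2
    have h3 : A * (Real.exp (k * δ) - Real.exp (k * G (e x))) =
      A * (Real.exp (k * δ) - 1) + A * (1 - Real.exp (k * G (e x))) := by ring
    linarith
  · have h2 := hs (e x) hxK h1
    rw [hxe] at h2
    rw [hv.eq_zero x h2]; linarith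

/-- For `s ↑ t` the functions are compared outside `S`, where both are harmonic; on `S` the potential
vanishes and `v_s` is small. -/
theorem eventually_abs_v_sub_potential_le_left (hn : 3 ≤ n) (ht : 0 < t)
    (h : Hypersurface.ConvergesTo F.Sig (𝓝[<] t) S)
    (hχ : S.IsClosingFunction (F.g t).inner χ) {ε : ℝ} (hε : 0 < ε) :
    ∀ᶠ s in 𝓝[<] t, ∀ x ∈ S.outside, |F.v s x - F.potential t χ x| ≤ ε := by
  have hcpt : IsCompact S.surface := by
    obtain ⟨r, hr, hrS, hK⟩ := S.exists_isCompact_diff hn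
    exact (hK r le_rfl).of_isClosed_subset isClosed_frontier fun x hx =>
      ⟨frontier_subset_closure hx, fun hb => Hypersurface.notMem_surface (hrS hb) hx⟩
  have hS : ∀ᶠ s in 𝓝[<] t, ∀ x ∈ S.surface, -F.v s x ≤ ε := by
    refine hcpt.induction_on (p := fun A => ∀ᶠ s in 𝓝[<] t, ∀ x ∈ A, -F.v s x ≤ ε) (by simp)
      (fun A B hAB hB => hB.mono fun s hs x hx => hs x (hAB hx))
      (fun A B hA hB => (hA.and hB).mono fun s hs x hx => hx.elim (hs.1 x) (hs.2 x)) fun p hp => ?_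
    obtain ⟨U, hU, hs⟩ := F.exists_eventually_neg_v_le hn ht h hp hε
    exact ⟨U, mem_nhdsWithin_of_mem_nhds hU, hs⟩
  have hout := fun s hs hst => F.outside_subset_of_tendsto_left h (s := s) hs hst
  filter_upwards [hS, tendsto_exp_sub _ nhdsWithin_le_nhds hε, Ioo_mem_nhdsLT ht] with s h1 h2 h3
  refine F.abs_v_sub_potential_le hn ht.le hχ hout h3.1.le le_rfl (hout s h3.1.le h3.2) h2
    fun x hx => ?_
  rw [F.potential_eq_zero (Hypersurface.notMem_outside hx), sub_zero,
    abs_of_nonpos (F.v_nonpos hn h3.1.le x)]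
  exact h1 x hx

end ConformalFlow

/-! ### Spherical means of harmonic functions -/

section SphericalMean

variable {n : ℕ}

/-- The integral of `f` over the sphere of radius `σ`, with respect to the area of the unit sphere. -/
def sphereIntegral (f : Eu n → ℝ) (σ : ℝ) : ℝ :=
  ∫ θ : Metric.sphere (0 : Eu n) 1, f (σ • (θ : Eu n)) ∂((volume : Measure (Eu n)).toSphere)

/-- The area of the unit sphere. -/
def sphereArea (n : ℕ) : ℝ := (volume : Measure (Eu n)).toSphere.real univ

/-- The derivative of `f` in the radial direction. -/
def radialDeriv (f : Eu n → ℝ) (y : Eu n) : ℝ := fderiv ℝ f y (‖y‖⁻¹ • y)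

theorem norm_smul_sphere {σ : ℝ} (hσ : 0 ≤ σ) (θ : Metric.sphere (0 : Eu n) 1) :
    ‖σ • (θ : Eu n)‖ = σ := by
  rw [norm_smul, norm_eq_of_mem_sphere, mul_one, Real.norm_of_nonneg hσ]

theorem radialDeriv_smul (f : Eu n → ℝ) {σ : ℝ} (hσ : 0 < σ) (θ : Metric.sphere (0 : Eu n) 1) :
    radialDeriv f (σ • (θ : Eu n)) = fderiv ℝ f (σ • (θ : Eu n)) θ := by
  rw [radialDeriv, norm_smul_sphere hσ.le, smul_smul, inv_mul_cancel₀ hσ.ne', one_smul]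

theorem sphereArea_pos (hn : 3 ≤ n) : 0 < sphereArea n := by
  have : Nonempty (Fin n) := ⟨⟨0, by omega⟩⟩
  rw [sphereArea, Measure.real, ENNReal.toReal_pos_iff]
  exact ⟨Measure.measure_univ_pos.mpr ((volume : Measure (Eu n)).toSphere_ne_zero), measure_lt_top _ _⟩

theorem integrable_sphere {f : Metric.sphere (0 : Eu n) 1 → ℝ} (hf : Continuous f) :
    Integrable f ((volume : Measure (Eu n)).toSphere) :=
  hf.integrable_of_hasCompactSupport (HasCompactSupport.of_compactSpace f)

theorem continuous_smul_sphere {f : Eu n → ℝ} {r σ : ℝ} (hr : 0 ≤ r)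
    (hf : ContinuousOn f {y | r < ‖y‖}) (hσ : r < σ) :
    Continuous fun θ : Metric.sphere (0 : Eu n) 1 => f (σ • (θ : Eu n)) :=
  hf.comp_continuous (by fun_prop) fun θ => by
    simpa [norm_smul_sphere (hr.trans hσ.le)] using hσ

theorem abs_sphereIntegral_le {f : Eu n → ℝ} {σ C : ℝ} (hσ : 0 ≤ σ)
    (hf : ∀ y, ‖y‖ = σ → |f y| ≤ C) : |sphereIntegral f σ| ≤ C * sphereArea n :=
  norm_integral_le_of_norm_le_const
    (f := fun θ : Metric.sphere (0 : Eu n) 1 => f (σ • (θ : Eu n)))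
    (Eventually.of_forall fun θ => hf _ (norm_smul_sphere hσ θ))

theorem sphereIntegral_sub {f g : Eu n → ℝ} {r σ : ℝ} (hr : 0 ≤ r)
    (hf : ContinuousOn f {y | r < ‖y‖}) (hg : ContinuousOn g {y | r < ‖y‖}) (hσ : r < σ) :
    sphereIntegral (fun y => f y - g y) σ = sphereIntegral f σ - sphereIntegral g σ :=
  integral_sub (integrable_sphere (continuous_smul_sphere hr hf hσ))
    (integrable_sphere (continuous_smul_sphere hr hg hσ))

theorem sphereIntegral_const_mul (c : ℝ) (f : Eu n → ℝ) (σ : ℝ) :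
    sphereIntegral (fun y => c * f y) σ = c * sphereIntegral f σ := integral_const_mul _ _

theorem sphereIntegral_const (c σ : ℝ) :
    sphereIntegral (fun _ : Eu n => c) σ = c * sphereArea n := by
  simp [sphereIntegral, sphereArea, mul_comm]

theorem sphereIntegral_congr {f g : Eu n → ℝ} {σ : ℝ} (hσ : 0 ≤ σ) (h : ∀ y, ‖y‖ = σ → f y = g y) :
    sphereIntegral f σ = sphereIntegral g σ :=
  integral_congr_ae (Eventually.of_forall fun θ => h _ (norm_smul_sphere hσ θ))

theorem continuousOn_sphereIntegral {f : Eu n → ℝ} {r : ℝ} (hr : 0 ≤ r)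
    (hf : ContinuousOn f {y | r < ‖y‖}) : ContinuousOn (sphereIntegral f) (Ioi r) := by
  rw [continuousOn_iff_continuous_domRestrict]
  have : LocallyCompactSpace (Ioi r) := isOpen_Ioi.locallyCompactSpace
  have h : Continuous (fun σ : Ioi r => ∫ θ in univ, f ((σ : ℝ) • (θ : Eu n))
      ∂((volume : Measure (Eu n)).toSphere)) := by
    refine continuous_parametric_integral_of_continuous
      (f := fun (σ : Ioi r) (θ : Metric.sphere (0 : Eu n) 1) => f ((σ : ℝ) • (θ : Eu n))) ?_
      isCompact_univ
    refine hf.comp_continuous (by fun_prop) fun p => ?_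
    have h1 : r < p.1 := p.1.2
    rw [mem_ofPred_eq, norm_smul_sphere (hr.trans h1.le)]
    exact h1
  simpa [Set.domRestrict_def, sphereIntegral] using h

/-- Differentiation with respect to the radius under the integral sign. -/
theorem hasDerivAt_sphereIntegral {f : Eu n → ℝ} {r : ℝ} (hr : 0 ≤ r)
    (hf : ∀ y, r < ‖y‖ → ContDiffAt ℝ 1 f y) {σ : ℝ} (hσ : r < σ) :
    HasDerivAt (sphereIntegral f) (sphereIntegral (radialDeriv f) σ) σ := by
  have hσ0 : 0 < σ := hr.trans_lt hσ
  have hfc : ContinuousOn f {y | r < ‖y‖} := fun y hy => (hf y hy).continuousAt.continuousWithinAt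
  have hdc : ContinuousOn (fun y => fderiv ℝ f y) {y | r < ‖y‖} := fun y hy =>
    ((hf y hy).fderiv_right (m := 0) (by norm_num)).continuousAt.continuousWithinAt
  obtain ⟨ρ, hρ1, hρ2⟩ := exists_between hσ
  set K : Set (Eu n) := {y | ρ ≤ ‖y‖ ∧ ‖y‖ ≤ σ + 1}
  have hK : IsCompact K := (isCompact_closedBall (0 : Eu n) (σ + 1)).of_isClosed_subset
    ((isClosed_le continuous_const continuous_norm).inter
      (isClosed_le continuous_norm continuous_const)) fun y hy => by simpa using hy.2
  obtain ⟨C, hC⟩ := hK.exists_bound_of_continuousOn (hdc.mono fun y hy => hρ1.trans_le hy.1)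
  have hs : Ioo ρ (σ + 1) ∈ 𝓝 σ := Ioo_mem_nhds hρ2 (by linarith)
  have h := hasDerivAt_integral_of_dominated_loc_of_deriv_le
    (μ := (volume : Measure (Eu n)).toSphere) (x₀ := σ) (bound := fun _ => C) (s := Ioo ρ (σ + 1))
    (F := fun (τ : ℝ) (θ : Metric.sphere (0 : Eu n) 1) => f (τ • (θ : Eu n)))
    (F' := fun (τ : ℝ) (θ : Metric.sphere (0 : Eu n) 1) => fderiv ℝ f (τ • (θ : Eu n)) θ) hs
    (by filter_upwards [hs] with τ hτ using
      (continuous_smul_sphere hr hfc (hρ1.trans hτ.1)).aestronglyMeasurable)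
    (integrable_sphere (continuous_smul_sphere hr hfc hσ))
    ((Continuous.clm_apply (hdc.comp_continuous (by fun_prop) fun θ => by
      simpa [norm_smul_sphere hσ0.le] using hσ) continuous_subtype_val).aestronglyMeasurable)
    (Eventually.of_forall fun θ τ hτ => by
      have hτ0 : 0 ≤ τ := (hr.trans hρ1.le).trans hτ.1.le
      refine (ContinuousLinearMap.le_opNorm _ _).trans ?_
      rw [norm_eq_of_mem_sphere, mul_one]
      refine hC _ ⟨?_, ?_⟩
      · rw [norm_smul_sphere hτ0]; exact hτ.1.le
      · rw [norm_smul_sphere hτ0]; exact hτ.2.le)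
    (integrable_const C)
    (Eventually.of_forall fun θ τ hτ => by
      have hτ0 : 0 ≤ τ := (hr.trans hρ1.le).trans hτ.1.le
      have hd : HasDerivAt (fun τ : ℝ => τ • (θ : Eu n)) (θ : Eu n) τ := by
        simpa using (hasDerivAt_id τ).smul_const (θ : Eu n)
      exact ((hf _ (by rw [norm_smul_sphere hτ0]; exact hρ1.trans hτ.1)).differentiableAt
        one_ne_zero).hasFDerivAt.comp_hasDerivAt τ hd)
  refine h.2.congr_deriv ?_
  exact integral_congr_ae (Eventually.of_forall fun θ => (radialDeriv_smul f hσ0 θ).symm)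

/-- Integration in polar coordinates. -/
theorem integral_eq_integral_sphereIntegral (hn : 3 ≤ n) {F : Eu n → ℝ} (hF : Integrable F) :
    ∫ y, F y = ∫ σ in Ioi (0 : ℝ), σ ^ (n - 1) * sphereIntegral F σ := by
  have : Nonempty (Fin n) := ⟨⟨0, by omega⟩⟩
  set μ : Measure (Eu n) := volume
  set g : Metric.sphere (0 : Eu n) 1 × Ioi (0 : ℝ) → ℝ := fun p => F ((p.2 : ℝ) • (p.1 : Eu n))
  have hdim : Module.finrank ℝ (Eu n) - 1 = n - 1 := by simp
  have hmp := μ.measurePreserving_homeomorphUnitSphereProd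
  rw [hdim] at hmp
  have hg : ∀ x : ({(0)}ᶜ : Set (Eu n)), g (homeomorphUnitSphereProd (Eu n) x) = F x := fun x => by
    have hx : ‖(x : Eu n)‖ ≠ 0 := norm_ne_zero_iff.mpr x.2
    simp only [g, homeomorphUnitSphereProd_apply_fst_coe, homeomorphUnitSphereProd_apply_snd_coe]
    rw [smul_smul, mul_inv_cancel₀ hx, one_smul]
  have hint : Integrable g (μ.toSphere.prod (.volumeIoiPow (n - 1))) := by
    rw [← hmp.integrable_comp_emb (Homeomorph.measurableEmbedding _)]
    simp only [Function.comp_def, hg]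
    have h1 : IntegrableOn F ({0}ᶜ : Set (Eu n)) μ := hF.integrableOn
    exact (integrableOn_iff_comap_subtypeVal (measurableSet_singleton _).compl).mp h1
  calc ∫ y, F y = ∫ x : ({(0)}ᶜ : Set (Eu n)), F x ∂(μ.comap (↑)) := by
        rw [integral_subtype_comap (measurableSet_singleton _).compl F, restrict_compl_singleton]
    _ = ∫ p, g p ∂μ.toSphere.prod (.volumeIoiPow (n - 1)) := by
        rw [← hmp.integral_comp (Homeomorph.measurableEmbedding _)]
        simp only [hg]
    _ = ∫ σ : Ioi (0 : ℝ), sphereIntegral F σ ∂.volumeIoiPow (n - 1) := integral_prod_symm _ hint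
    _ = _ := by
        simp only [Measure.volumeIoiPow, ENNReal.ofReal]
        rw [integral_withDensity_eq_integral_smul,
          integral_subtype_comap measurableSet_Ioi fun a => Real.toNNReal (a ^ (n - 1)) •
            sphereIntegral F a, setIntegral_congr_fun measurableSet_Ioi fun x hx => ?_]
        · rw [NNReal.smul_def, Real.coe_toNNReal _ (pow_nonneg hx.out.le _), smul_eq_mul]
        · exact (measurable_subtype_coe.pow_const _).real_toNNReal

/-- A continuous function `h` on an interval which is orthogonal to the derivatives of all `C¹`
functions with compact support is constant: test with `(h - c) w`, where `w > 0` is a weight and `c`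
the weighted mean of `h`. -/
theorem eq_of_integral_mul_eq_zero {h : ℝ → ℝ} {α β : ℝ} (hαβ : α < β)
    (hh : ContinuousOn h (Icc α β))
    (horth : ∀ φ φ' : ℝ → ℝ, (∀ σ, HasDerivAt φ (φ' σ) σ) → Continuous φ' →
      (∀ σ ∉ Icc α β, φ σ = 0) → (∀ σ ∉ Icc α β, φ' σ = 0) → ∫ σ in α..β, φ' σ * h σ = 0) :
    ∃ c, ∀ σ ∈ Ioo α β, h σ = c := by
  set k : ℝ → ℝ := IccExtend hαβ.le ((Icc α β).domRestrict h) with hk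
  have hkc : Continuous k := (continuousOn_iff_continuous_domRestrict.mp hh).Icc_extend'
  have hkh : ∀ σ ∈ Icc α β, k σ = h σ := fun σ hσ => by rw [hk, IccExtend_of_mem _ _ hσ]; rfl
  set w : ℝ → ℝ := fun σ => max 0 ((σ - α) * (β - σ)) with hw
  have hwc : Continuous w := by fun_prop
  have hw0 : ∀ σ ∉ Icc α β, w σ = 0 := fun σ hσ => by
    refine max_eq_left ?_
    rw [mem_Icc, not_and_or, not_le, not_le] at hσ
    rcases hσ with h1 | h1 <;> nlinarith
  have hwpos : ∀ σ ∈ Ioo α β, 0 < w σ := fun σ hσ =>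
    lt_max_of_lt_right (mul_pos (sub_pos.mpr hσ.1) (sub_pos.mpr hσ.2))
  have hwn : ∀ σ, 0 ≤ w σ := fun σ => le_max_left _ _
  have hwint : 0 < ∫ σ in α..β, w σ :=
    intervalIntegral.intervalIntegral_pos_of_pos_on (hwc.intervalIntegrable _ _) hwpos hαβ
  set c := (∫ σ in α..β, k σ * w σ) / ∫ σ in α..β, w σ with hc
  set χ : ℝ → ℝ := fun σ => (k σ - c) * w σ
  have hχc : Continuous χ := by fun_prop
  have hχ0 : ∀ σ ∉ Icc α β, χ σ = 0 := fun σ hσ => by simp only [χ, hw0 σ hσ, mul_zero]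
  have hχint : ∫ σ in α..β, χ σ = 0 := by
    have : ∫ σ in α..β, χ σ = (∫ σ in α..β, k σ * w σ) - ∫ σ in α..β, c * w σ := by
      have h1 : Continuous fun σ => k σ * w σ := hkc.mul hwc
      have h2 : Continuous fun σ => c * w σ := continuous_const.mul hwc
      rw [← intervalIntegral.integral_sub (h1.intervalIntegrable _ _) (h2.intervalIntegrable _ _)]
      simp only [χ, sub_mul]
    rw [this, intervalIntegral.integral_const_mul, hc, div_mul_cancel₀ _ hwint.ne', sub_self]
  have hzero := horth (fun σ => ∫ s in α..σ, χ s) χ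
    (fun σ => intervalIntegral.integral_hasDerivAt_right (hχc.intervalIntegrable _ _)
      (hχc.stronglyMeasurableAtFilter _ _) hχc.continuousAt) hχc (fun σ hσ => by
      rw [mem_Icc, not_and_or, not_le, not_le] at hσ
      rcases hσ with h1 | h1
      · rw [intervalIntegral.integral_symm, neg_eq_zero]
        rw [intervalIntegral.integral_of_le h1.le]
        refine (setIntegral_congr_ae (g := fun _ => (0 : ℝ)) measurableSet_Ioc ?_).trans (by simp)
        filter_upwards [compl_mem_ae_iff.mpr (measure_singleton α)] with s hs hs2
        exact hχ0 s fun h2 => hs (le_antisymm hs2.2 h2.1)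
      · rw [← intervalIntegral.integral_add_adjacent_intervals (hχc.intervalIntegrable α β)
          (hχc.intervalIntegrable β σ), hχint, zero_add, intervalIntegral.integral_of_le h1.le]
        refine (setIntegral_congr_fun (g := fun _ => (0 : ℝ)) measurableSet_Ioc fun s hs => ?_).trans
          (by simp)
        exact hχ0 s fun h2 => not_lt.mpr h2.2 hs.1) hχ0
  have hsq : ∫ σ in α..β, (k σ - c) ^ 2 * w σ = 0 := by
    have h1 : ∫ σ in α..β, χ σ * k σ = 0 := by
      rw [← hzero]
      refine intervalIntegral.integral_congr fun σ hσ => ?_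
      rw [uIcc_of_le hαβ.le] at hσ
      simp only [hkh σ hσ]
    have h2 : ∫ σ in α..β, (k σ - c) ^ 2 * w σ =
        (∫ σ in α..β, χ σ * k σ) - ∫ σ in α..β, c * χ σ := by
      have h3 : Continuous fun σ => χ σ * k σ := hχc.mul hkc
      have h4 : Continuous fun σ => c * χ σ := continuous_const.mul hχc
      rw [← intervalIntegral.integral_sub (h3.intervalIntegrable _ _) (h4.intervalIntegrable _ _)]
      refine intervalIntegral.integral_congr fun σ _ => ?_
      simp only [χ]; ring
    rw [h2, h1, intervalIntegral.integral_const_mul, hχint, mul_zero, sub_zero]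
  refine ⟨c, fun σ hσ => ?_⟩
  by_contra hne
  have hpos : 0 < ∫ σ in α..β, (k σ - c) ^ 2 * w σ := by
    refine intervalIntegral.integral_pos hαβ (by fun_prop) (fun s _ =>
      mul_nonneg (sq_nonneg _) (hwn s)) ⟨σ, Ioo_subset_Icc_self hσ, mul_pos ?_ (hwpos σ hσ)⟩
    rw [hkh σ (Ioo_subset_Icc_self hσ)]
    exact sq_pos_of_ne_zero (sub_ne_zero.mpr hne)
  exact hpos.ne' hsq

theorem continuous_of_eq_zero_off {X : Type*} [TopologicalSpace X] {f : X → ℝ} {A U : Set X}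
    (hU : IsOpen U) (hA : IsClosed A) (hAU : A ⊆ U) (hf : ContinuousOn f U)
    (h0 : ∀ x ∉ A, f x = 0) : Continuous f := by
  rw [continuous_iff_continuousAt]
  intro x
  by_cases hx : x ∈ U
  · exact hf.continuousAt (hU.mem_nhds hx)
  · refine (continuousAt_const (y := (0 : ℝ))).congr ?_
    filter_upwards [hA.isOpen_compl.mem_nhds fun h => hx (hAU h)] with z hz using (h0 z hz).symm

theorem integrable_of_eq_zero_off {f : Eu n → ℝ} {A U : Set (Eu n)} (hU : IsOpen U)
    (hA : IsCompact A) (hAU : A ⊆ U) (hf : ContinuousOn f U) (h0 : ∀ x ∉ A, f x = 0) :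
    Integrable f :=
  (continuous_of_eq_zero_off hU hA.isClosed hAU hf h0).integrable_of_hasCompactSupport
    (HasCompactSupport.intro hA h0)

theorem isCompact_annulus (α β : ℝ) : IsCompact {y : Eu n | ‖y‖ ∈ Icc α β} :=
  (isCompact_closedBall (0 : Eu n) β).of_isClosed_subset (isClosed_Icc.preimage continuous_norm)
    fun y hy => by simpa using hy.2

theorem hasFDerivAt_comp_norm {φ : ℝ → ℝ} {φ' : ℝ} {y : Eu n} (hy : y ≠ 0)
    (hφ : HasDerivAt φ φ' ‖y‖) :
    HasFDerivAt (fun z : Eu n => φ ‖z‖) ((φ' * ‖y‖⁻¹) • innerSL ℝ y) y := by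
  have hy0 : ‖y‖ ≠ 0 := norm_ne_zero_iff.mpr hy
  have h1 : HasFDerivAt (fun z : Eu n => √(‖z‖ ^ 2)) ((‖y‖⁻¹) • innerSL ℝ y) y := by
    refine ((hasStrictFDerivAt_norm_sq y).hasFDerivAt.sqrt (by positivity)).congr_fderiv ?_
    rw [Real.sqrt_sq (norm_nonneg y)]
    ext w
    simp; field_simp
  simp only [Real.sqrt_sq (norm_nonneg _)] at h1
  refine (hφ.comp_hasFDerivAt y h1).congr_fderiv ?_
  rw [smul_smul]

/-- The flux of a harmonic function through spheres does not depend on the radius: its Laplacian is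
orthogonal to radial test functions. -/
theorem exists_sphereIntegral_radialDeriv_eq (hn : 3 ≤ n) {V : Eu n → ℝ} {r : ℝ} (hr : 0 ≤ r)
    (hV : ∀ y, r < ‖y‖ → ContDiffAt ℝ 2 V y) (hL : ∀ y, r < ‖y‖ → flatLap V y = 0) :
    ∃ c, ∀ σ, r < σ → σ ^ (n - 1) * sphereIntegral (radialDeriv V) σ = c := by
  set h : ℝ → ℝ := fun σ => σ ^ (n - 1) * sphereIntegral (radialDeriv V) σ with hh
  set U : Set (Eu n) := {y | r < ‖y‖}
  have hU : IsOpen U := isOpen_lt continuous_const continuous_norm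
  have hU0 : ∀ y ∈ U, ‖y‖ ≠ 0 := fun y hy => (hr.trans_lt hy).ne'
  have hinv : ContinuousOn (fun y : Eu n => ‖y‖⁻¹) U := continuous_norm.continuousOn.inv₀ hU0
  have hrad : ContinuousOn (radialDeriv V) U := fun y hy =>
    (((hV y hy).fderiv_right (m := 1) (by norm_num)).continuousAt.continuousWithinAt).clm_apply
      ((hinv y hy).smul continuousWithinAt_id)
  have hpd : ∀ i, ContinuousOn (pd i V) U := fun i y hy =>
    (continuousAt_pd i ((hV y hy).of_le one_le_two)).continuousWithinAt
  have hpdpd : ∀ i, ContinuousOn (pd i (pd i V)) U := fun i y hy =>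
    (continuousAt_pd_pd i i (hV y hy)).continuousWithinAt
  have hloc : ∀ α β, r < α → α < β → ∃ c, ∀ σ ∈ Ioo α β, h σ = c := fun α β hα hαβ => by
    have hα0 : 0 < α := hr.trans_lt hα
    have hhc : ContinuousOn h (Icc α β) := ((continuous_pow (n - 1)).continuousOn.mul
      (continuousOn_sphereIntegral hr hrad)).mono fun σ hσ => hα.trans_le hσ.1
    refine eq_of_integral_mul_eq_zero hαβ hhc fun φ φ' hφ hφ'c hφ0 hφ'0 => ?_
    set A : Set (Eu n) := {y | ‖y‖ ∈ Icc α β}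
    have hA : IsCompact A := isCompact_annulus α β
    have hAU : A ⊆ U := fun y hy => hα.trans_le hy.1
    set f : Eu n → ℝ := fun y => φ ‖y‖
    have hf : ∀ y, HasFDerivAt f ((φ' ‖y‖ * ‖y‖⁻¹) • innerSL ℝ y) y := fun y => by
      by_cases hy : y = 0
      · have h1 : f =ᶠ[𝓝 y] fun _ => 0 := by
          have : ∀ᶠ z : Eu n in 𝓝 y, ‖z‖ < α :=
            continuous_norm.continuousAt.eventually (gt_mem_nhds (by simpa [hy] using hα0))
          filter_upwards [this] with z hz using hφ0 _ fun h => not_le.mpr hz h.1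
        refine ((hasFDerivAt_const (0 : ℝ) y).congr_of_eventuallyEq h1).congr_fderiv ?_
        simp [hy]
      · exact hasFDerivAt_comp_norm hy (hφ _)
    have hfc : Continuous f :=
      (continuous_iff_continuousAt.mpr fun σ => (hφ σ).continuousAt).comp continuous_norm
    have hpf : ∀ i y, pd i f y = φ' ‖y‖ * ‖y‖⁻¹ * y i := fun i y => by
      have h1 : inner ℝ y (EuclideanSpace.single i (1 : ℝ)) = y i := by
        simpa using EuclideanSpace.inner_single_right i (1 : ℝ) y
      rw [pd, (hf y).fderiv, smul_apply, innerSL_apply_apply, h1, smul_eq_mul]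
    have hpf0 : ∀ i, ∀ y ∉ A, pd i f y = 0 := fun i y hy => by
      rw [hpf, hφ'0 _ hy, zero_mul, zero_mul]
    have hf0 : ∀ y ∉ A, f y = 0 := fun y hy => hφ0 _ hy
    have hpfc : ∀ i, ContinuousOn (pd i f) U := fun i => by
      refine ContinuousOn.congr ?_ fun y _ => hpf i y
      exact ((hφ'c.comp continuous_norm).continuousOn.mul hinv).mul (by fun_prop)
    have hts : tsupport f ⊆ A := closure_minimal (fun y hy => by
      by_contra hyA; exact hy (hf0 y hyA)) hA.isClosed
    have hparts : ∀ i, ∫ y, pd i f y * pd i V y = -∫ y, f y * pd i (pd i V) y := fun i => by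
      have := integral_mul_fderiv_eq_neg_fderiv_mul_of_integrable (μ := (volume : Measure (Eu n)))
        (f := f) (g := pd i V) (v := EuclideanSpace.single i 1)
        (integrable_of_eq_zero_off hU hA hAU ((hpfc i).mul (hpd i)) fun y hy => by
          change pd i f y * pd i V y = 0
          rw [hpf0 i y hy, zero_mul])
        (integrable_of_eq_zero_off hU hA hAU (hfc.continuousOn.mul (hpdpd i)) fun y hy => by
          change f y * pd i (pd i V) y = 0
          rw [hf0 y hy, zero_mul])
        (integrable_of_eq_zero_off hU hA hAU (hfc.continuousOn.mul (hpd i)) fun y hy => by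
          change f y * pd i V y = 0
          rw [hf0 y hy, zero_mul])
        (fun y _ => (hf y).differentiableAt)
        (fun y hy => (contDiffAt_pd_one i (hV y (hAU (hts hy)))).differentiableAt one_ne_zero)
      exact (neg_eq_iff_eq_neg.mpr this).symm
    set F : Eu n → ℝ := fun y => φ' ‖y‖ * radialDeriv V y
    have hF0 : ∀ y ∉ A, F y = 0 := fun y hy => by simp only [F, hφ'0 _ hy, zero_mul]
    have hFi : Integrable F := integrable_of_eq_zero_off hU hA hAU
      ((hφ'c.comp continuous_norm).continuousOn.mul hrad) hF0
    have hFsum : ∀ y, F y = ∑ i, pd i f y * pd i V y := fun y => by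
      simp only [F, radialDeriv, fderiv_eq_sum_pd, hpf, Finset.mul_sum]
      exact Finset.sum_congr rfl fun i _ => by simp; ring
    have hzero : ∫ y, F y = 0 := by
      simp only [hFsum]
      rw [integral_finsetSum _ (f := fun i y => pd i f y * pd i V y) fun i _ => integrable_of_eq_zero_off hU hA hAU
        ((hpfc i).mul (hpd i)) fun y hy => by
          rw [hpf0 i y hy, zero_mul]]
      simp only [hparts, Finset.sum_neg_distrib]
      rw [← integral_finsetSum _ (f := fun i y => f y * pd i (pd i V) y) fun i _ => integrable_of_eq_zero_off hU hA hAU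
        (hfc.continuousOn.mul (hpdpd i)) fun y hy => by
          rw [hf0 y hy, zero_mul]]
      rw [neg_eq_zero]
      refine (integral_congr_ae (Eventually.of_forall fun y => ?_)).trans (integral_zero _ _)
      change ∑ i, f y * pd i (pd i V) y = 0
      rw [← Finset.mul_sum]
      by_cases hy : y ∈ A
      · have := hL y (hAU hy)
        rw [flatLap] at this
        rw [this, mul_zero]
      · rw [hf0 y hy, zero_mul]
    have hsph : ∀ σ, 0 ≤ σ → σ ^ (n - 1) * sphereIntegral F σ = φ' σ * h σ := fun σ hσ => by
      have : sphereIntegral F σ = φ' σ * sphereIntegral (radialDeriv V) σ := by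
        rw [← sphereIntegral_const_mul]
        exact sphereIntegral_congr hσ fun y hy => by simp only [F, hy]
      rw [this, hh]; ring
    rw [integral_eq_integral_sphereIntegral hn hFi,
      setIntegral_congr_fun measurableSet_Ioi fun σ hσ => hsph σ (le_of_lt hσ)] at hzero
    rw [intervalIntegral.integral_of_le hαβ.le, ← hzero, ← integral_Icc_eq_integral_Ioc]
    refine (setIntegral_eq_of_subset_of_forall_sdiff_eq_zero measurableSet_Ioi
      (fun σ hσ => hα0.trans_le hσ.1) fun σ hσ => ?_).symm
    rw [hφ'0 σ hσ.2, zero_mul]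
  refine ⟨h (r + 1), fun σ hσ => ?_⟩
  obtain ⟨α, h1, h2⟩ := exists_between (lt_min hσ (lt_add_one r))
  obtain ⟨c, hc⟩ := hloc α (max σ (r + 1) + 1) h1
    ((h2.trans_le (min_le_left _ _)).trans_le ((le_max_left _ _).trans (le_add_of_nonneg_right zero_le_one)))
  exact (hc σ ⟨h2.trans_le (min_le_left _ _), (le_max_left _ _).trans_lt (lt_add_one _)⟩).trans
    (hc (r + 1) ⟨h2.trans_le (min_le_right _ _), (le_max_right _ _).trans_lt (lt_add_one _)⟩).symm

end SphericalMean

/-! ### Harmonic functions near infinity -/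

section Exterior

variable {n : ℕ}

theorem flatLap_eq_ellOp (f : Eu n → ℝ) (y : Eu n) :
    flatLap f y = ellOp (fun _ => (1 : Matrix (Fin n) (Fin n) ℝ)) (fun _ _ => 0) f y := by
  simp [flatLap, ellOp, Matrix.one_apply]

theorem flatLap_add {f g : Eu n → ℝ} {y : Eu n} (hf : ContDiffAt ℝ 2 f y) (hg : ContDiffAt ℝ 2 g y) :
    flatLap (fun z => f z + g z) y = flatLap f y + flatLap g y := by
  simp only [flatLap_eq_ellOp, ellOp_add hf hg]

theorem flatLap_const_mul (c : ℝ) {f : Eu n → ℝ} {y : Eu n} (hf : ContDiffAt ℝ 2 f y) :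
    flatLap (fun z => c * f z) y = c * flatLap f y := by
  simp only [flatLap_eq_ellOp, ellOp_const_mul c hf]

theorem flatLap_const (c : ℝ) (y : Eu n) : flatLap (fun _ => c) y = 0 := by
  rw [flatLap_eq_ellOp, ellOp_const]

theorem flatLap_nonpos_of_isLocalMax {f : Eu n → ℝ} {y : Eu n} (hf : ContDiffAt ℝ 2 f y)
    (hy : IsLocalMax f y) : flatLap f y ≤ 0 := by
  rw [flatLap_eq_ellOp]
  exact ellOp_nonpos_of_isLocalMax Matrix.PosSemidef.one hf hy

theorem pd_eq_of_hasFDerivAt {f : Eu n → ℝ} {L : Eu n →L[ℝ] ℝ} {y : Eu n} (h : HasFDerivAt f L y)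
    (i : Fin n) : pd i f y = L (EuclideanSpace.single i 1) := by rw [pd, h.fderiv]

theorem inner_single (y : Eu n) (i : Fin n) :
    inner ℝ y (EuclideanSpace.single i (1 : ℝ)) = y i := by
  simpa using EuclideanSpace.inner_single_right i (1 : ℝ) y

theorem pd_coord (i j : Fin n) (y : Eu n) : pd i (fun z : Eu n => z j) y = if i = j then 1 else 0 := by
  have h : HasFDerivAt (fun z : Eu n => z j) (EuclideanSpace.proj j : Eu n →L[ℝ] ℝ) y :=
    (EuclideanSpace.proj j : Eu n →L[ℝ] ℝ).hasFDerivAt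
  rw [pd_eq_of_hasFDerivAt h]
  simp [eq_comm]

theorem pd_normSq (i : Fin n) (y : Eu n) : pd i (fun z : Eu n => ‖z‖ ^ 2) y = 2 * y i := by
  rw [pd_eq_of_hasFDerivAt (hasStrictFDerivAt_norm_sq y).hasFDerivAt]
  simp [inner_single]

theorem contDiff_coord (j : Fin n) : ContDiff ℝ 2 (fun z : Eu n => z j) :=
  (EuclideanSpace.proj j : Eu n →L[ℝ] ℝ).contDiff

theorem differentiableAt_coord (j : Fin n) (y : Eu n) : DifferentiableAt ℝ (fun z : Eu n => z j) y :=
  (contDiff_coord j).differentiable two_ne_zero y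

theorem flatLap_normSq (y : Eu n) : flatLap (fun z : Eu n => ‖z‖ ^ 2) y = 2 * n := by
  have h : ∀ i : Fin n, pd i (fun z : Eu n => ‖z‖ ^ 2) = fun z => 2 * z i := fun i =>
    funext (pd_normSq i)
  simp only [flatLap, h, pd_const_mul _ _ (differentiableAt_coord _ y), pd_coord]
  simp [mul_comm]

/-- The weak maximum principle. -/
theorem le_of_flatLap_eq_zero (hn : 3 ≤ n) {K : Set (Eu n)} (hK : IsCompact K) {f : Eu n → ℝ}
    (hf : ContinuousOn f K) (hd : ∀ y ∈ interior K, ContDiffAt ℝ 2 f y)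
    (hL : ∀ y ∈ interior K, flatLap f y = 0) {c : ℝ} (hb : ∀ y ∈ K, y ∉ interior K → f y ≤ c) :
    ∀ y ∈ K, f y ≤ c := by
  by_contra! hcon
  obtain ⟨y, hy, hcy⟩ := hcon
  obtain ⟨R, hR⟩ := hK.isBounded.exists_norm_le
  have hR0 : 0 ≤ R := (norm_nonneg y).trans (hR y hy)
  obtain ⟨δ, hδ, hδR⟩ : ∃ δ > 0, δ * R ^ 2 < f y - c :=
    ⟨(f y - c) / (2 * (R ^ 2 + 1)), div_pos (sub_pos.mpr hcy) (by positivity), by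
      rw [div_mul_eq_mul_div, div_lt_iff₀ (by positivity)]
      nlinarith [sub_pos.mpr hcy, sq_nonneg R, mul_nonneg (sub_pos.mpr hcy).le (sq_nonneg R)]⟩
  obtain ⟨z, hz, hmax⟩ := hK.exists_isMaxOn ⟨y, hy⟩
    (hf.add (by fun_prop : ContinuousOn (fun y : Eu n => δ * ‖y‖ ^ 2) K) :
      ContinuousOn (fun y => f y + δ * ‖y‖ ^ 2) K)
  by_cases hzi : z ∈ interior K
  · have hsq : ContDiffAt ℝ 2 (fun y : Eu n => ‖y‖ ^ 2) z := (contDiff_norm_sq ℝ).contDiffAt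
    have h1 := flatLap_nonpos_of_isLocalMax ((hd z hzi).add (contDiffAt_const.mul hsq))
      (hmax.isLocalMax (mem_interior_iff_mem_nhds.mp hzi))
    rw [flatLap_add (hd z hzi) (contDiffAt_const.mul hsq), hL z hzi, flatLap_const_mul _ hsq,
      flatLap_normSq, zero_add] at h1
    have : (0 : ℝ) < n := by exact_mod_cast (by omega : 0 < n)
    exact absurd h1 (not_le.mpr (by positivity))
  · have h1 := hb z hz hzi
    have h2 : f y + δ * ‖y‖ ^ 2 ≤ f z + δ * ‖z‖ ^ 2 := hmax hy
    have h3 : δ * ‖z‖ ^ 2 ≤ δ * R ^ 2 := by gcongr; exact hR z hz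
    have h4 : 0 ≤ δ * ‖y‖ ^ 2 := by positivity
    linarith

theorem hasDerivAt_inv_pow (k : ℕ) {s : ℝ} (hs : s ≠ 0) :
    HasDerivAt (fun s : ℝ => (s ^ k)⁻¹) (-(k * (s ^ (k + 1))⁻¹)) s := by
  rcases k with _ | k
  · simpa using hasDerivAt_const s (1 : ℝ)
  refine ((hasDerivAt_pow (k + 1) s).inv (pow_ne_zero _ hs)).congr_deriv ?_
  field_simp
  simp
  ring

theorem contDiffAt_inv_norm_pow (k : ℕ) {y : Eu n} (hy : y ≠ 0) :
    ContDiffAt ℝ 2 (fun z : Eu n => (‖z‖ ^ k)⁻¹) y :=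
  ((contDiffAt_norm ℝ hy).pow k).inv (pow_ne_zero _ (norm_ne_zero_iff.mpr hy))

theorem pd_inv_norm_pow (k : ℕ) (i : Fin n) {y : Eu n} (hy : y ≠ 0) :
    pd i (fun z : Eu n => (‖z‖ ^ k)⁻¹) y = -k * (y i * (‖y‖ ^ (k + 2))⁻¹) := by
  have hy0 : ‖y‖ ≠ 0 := norm_ne_zero_iff.mpr hy
  rw [pd_eq_of_hasFDerivAt (hasFDerivAt_comp_norm hy (hasDerivAt_inv_pow k hy0)), smul_apply,
    innerSL_apply_apply, inner_single, smul_eq_mul]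
  field_simp
  ring

/-- The function `|y|^(2-n)` is harmonic. -/
theorem flatLap_inv_norm_pow (hn : 3 ≤ n) {y : Eu n} (hy : y ≠ 0) :
    flatLap (fun z : Eu n => (‖z‖ ^ (n - 2))⁻¹) y = 0 := by
  have hy0 : ‖y‖ ≠ 0 := norm_ne_zero_iff.mpr hy
  have h : ∀ i : Fin n, pd i (pd i (fun z : Eu n => (‖z‖ ^ (n - 2))⁻¹)) y =
      -(n - 2 : ℕ) * (y i * (-(n - 2 + 2 : ℕ) * (y i * (‖y‖ ^ (n - 2 + 2 + 2))⁻¹)) +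
        (‖y‖ ^ (n - 2 + 2))⁻¹) := fun i => by
    have h1 : pd i (fun z : Eu n => (‖z‖ ^ (n - 2))⁻¹) =ᶠ[𝓝 y]
        fun z => -(n - 2 : ℕ) * (z i * (‖z‖ ^ (n - 2 + 2))⁻¹) := by
      filter_upwards [isOpen_ne.mem_nhds hy] with z hz using pd_inv_norm_pow _ i hz
    have h2 := (contDiffAt_inv_norm_pow (n - 2 + 2) hy).differentiableAt two_ne_zero
    have h3 : DifferentiableAt ℝ (fun z : Eu n => z i * (‖z‖ ^ (n - 2 + 2))⁻¹) y :=
      (differentiableAt_coord i y).mul h2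
    rw [pd_congr i h1, pd_const_mul i _ h3,
      pd_mul i (differentiableAt_coord i y) h2, pd_inv_norm_pow _ i hy, pd_coord, if_pos rfl, one_mul]
  have hsum : ∑ i, y i * y i = ‖y‖ ^ 2 := by
    rw [EuclideanSpace.norm_sq_eq]
    exact Finset.sum_congr rfl fun i _ => by rw [Real.norm_eq_abs, sq_abs, sq]
  have h3 : n - 2 + 2 = n := by omega
  have h4 : ∀ i, -((n - 2 : ℕ) : ℝ) * (y i * (-(n - 2 + 2 : ℕ) * (y i * (‖y‖ ^ (n - 2 + 2 + 2))⁻¹)) +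
      (‖y‖ ^ (n - 2 + 2))⁻¹) = ((n - 2 : ℕ) : ℝ) * n * (‖y‖ ^ (n + 2))⁻¹ * (y i * y i) -
        ((n - 2 : ℕ) : ℝ) * (‖y‖ ^ n)⁻¹ := fun i => by rw [h3]; ring
  simp only [flatLap, h, h4, Finset.sum_sub_distrib, ← Finset.mul_sum, hsum, Finset.sum_const,
    Finset.card_univ, Fintype.card_fin, nsmul_eq_mul]
  rw [pow_add]
  field_simp
  ring

/-- A harmonic function on `{|y| > r}` that tends to `a` at infinity. -/
structure IsHarmonicEnd (r a : ℝ) (V : Eu n → ℝ) : Prop where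
  contDiffAt : ∀ y, r < ‖y‖ → ContDiffAt ℝ 2 V y
  flatLap_eq_zero : ∀ y, r < ‖y‖ → flatLap V y = 0
  limit : Tendsto V (Bornology.cobounded (Eu n)) (𝓝 a)

theorem exists_forall_norm_of_tendsto {V : Eu n → ℝ} {a : ℝ}
    (h : Tendsto V (Bornology.cobounded (Eu n)) (𝓝 a)) {ε : ℝ} (hε : 0 < ε) :
    ∃ C, ∀ y, C ≤ ‖y‖ → |V y - a| ≤ ε := by
  have h1 := h.eventually (Metric.closedBall_mem_nhds a hε)
  rw [← comap_norm_atTop, eventually_comap] at h1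
  obtain ⟨C, hC⟩ := eventually_atTop.mp h1
  exact ⟨C, fun y hy => hC ‖y‖ hy y rfl⟩

theorem sphereIntegral_tendsto {V : Eu n → ℝ} {a r : ℝ} (hr : 0 ≤ r)
    (hV : ContinuousOn V {y | r < ‖y‖}) (h : Tendsto V (Bornology.cobounded (Eu n)) (𝓝 a)) :
    Tendsto (sphereIntegral V) atTop (𝓝 (a * sphereArea n)) := by
  rw [Metric.tendsto_atTop]
  intro ε hε
  have hA : 0 ≤ sphereArea n := measureReal_nonneg
  obtain ⟨C, hC⟩ := exists_forall_norm_of_tendsto h (show 0 < ε / (sphereArea n + 1) by positivity)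
  refine ⟨max C (r + 1), fun σ hσ => ?_⟩
  have hσr : r < σ := (lt_add_one r).trans_le ((le_max_right _ _).trans hσ)
  rw [Real.dist_eq, ← sphereIntegral_const a σ,
    ← sphereIntegral_sub hr hV continuousOn_const hσr]
  refine (abs_sphereIntegral_le (hr.trans hσr.le) (C := ε / (sphereArea n + 1)) fun y hy =>
    hC y (by rw [hy]; exact (le_max_left _ _).trans hσ)).trans_lt ?_
  rw [div_mul_eq_mul_div, div_lt_iff₀ (by positivity)]
  nlinarith

namespace IsHarmonicEnd

variable {r a : ℝ} {V : Eu n → ℝ}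

theorem neg (h : IsHarmonicEnd r a V) : IsHarmonicEnd r (-a) (fun y => -V y) where
  contDiffAt y hy := (h.contDiffAt y hy).neg
  flatLap_eq_zero y hy := by
    have := flatLap_const_mul (-1) (h.contDiffAt y hy)
    simpa [h.flatLap_eq_zero y hy] using this
  limit := h.limit.neg

theorem continuousOn (h : IsHarmonicEnd r a V) : ContinuousOn V {y | r < ‖y‖} := fun y hy =>
  (h.contDiffAt y hy).continuousAt.continuousWithinAt

/-- The spherical means are those of the fundamental solution plus a constant, as the flux is constant
and the limit at infinity is known. -/
theorem exists_sphereIntegral_eq (hn : 3 ≤ n) (hr : 0 ≤ r) (h : IsHarmonicEnd r a V) :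
    ∃ B, ∀ σ, r < σ → sphereIntegral V σ = a * sphereArea n + B * (σ ^ (n - 2))⁻¹ := by
  obtain ⟨c, hc⟩ := exists_sphereIntegral_radialDeriv_eq hn hr h.contDiffAt h.flatLap_eq_zero
  have hk : (0 : ℝ) < (n - 2 : ℕ) := by exact_mod_cast (by omega : 0 < n - 2)
  set f : ℝ → ℝ := fun σ => sphereIntegral V σ + c / (n - 2 : ℕ) * (σ ^ (n - 2))⁻¹
  have hf : ∀ σ ∈ Ioi r, HasDerivAt f 0 σ := fun σ hσ => by
    have hσ0 : 0 < σ := hr.trans_lt hσ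
    refine ((hasDerivAt_sphereIntegral hr (fun y hy => (h.contDiffAt y hy).of_le one_le_two) hσ).add
      ((hasDerivAt_inv_pow (n - 2) hσ0.ne').const_mul _)).congr_deriv ?_
    rw [← hc σ hσ, show n - 2 + 1 = n - 1 by omega]
    field_simp
    ring
  have hconst : ∀ σ ∈ Ioi r, ∀ τ ∈ Ioi r, f σ = f τ := fun σ hσ τ hτ =>
    isOpen_Ioi.is_const_of_deriv_eq_zero isPreconnected_Ioi
      (fun s hs => (hf s hs).differentiableAt.differentiableWithinAt) (fun s hs => (hf s hs).deriv) hσ hτ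
  have hlim : Tendsto f atTop (𝓝 (a * sphereArea n + c / (n - 2 : ℕ) * 0)) :=
    (sphereIntegral_tendsto hr h.continuousOn h.limit).add
      ((tendsto_inv_atTop_zero.comp (tendsto_pow_atTop (by omega))).const_mul _)
  rw [mul_zero, add_zero] at hlim
  refine ⟨-(c / (n - 2 : ℕ)), fun σ hσ => ?_⟩
  have h1 : f σ = a * sphereArea n := by
    refine tendsto_nhds_unique ((tendsto_const_nhds (x := f σ)).congr' ?_) hlim
    filter_upwards [eventually_gt_atTop r] with τ hτ using hconst σ hσ τ hτ
  simp only [f] at h1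
  linarith

/-- Comparison with a multiple of `|y|^(2-n)` on annuli. -/
theorem sub_le (hn : 3 ≤ n) (h : IsHarmonicEnd r a V) {ρ M : ℝ} (hρ0 : 0 < ρ) (hρ : r < ρ)
    (hM0 : 0 ≤ M) (hM : ∀ y, ‖y‖ = ρ → V y - a ≤ M) {y : Eu n} (hy : ρ ≤ ‖y‖) :
    V y - a ≤ M * ρ ^ (n - 2) * (‖y‖ ^ (n - 2))⁻¹ := by
  refine le_of_forall_pos_le_add fun ε hε => ?_
  obtain ⟨C, hC⟩ := exists_forall_norm_of_tendsto h.limit hε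
  set R := max C (‖y‖ + 1)
  set f : Eu n → ℝ := fun z => V z + (-a + (-(M * ρ ^ (n - 2))) * (‖z‖ ^ (n - 2))⁻¹)
  have hd : ∀ z : Eu n, ρ ≤ ‖z‖ → ContDiffAt ℝ 2 V z ∧ ContDiffAt ℝ 2 (fun z : Eu n => (‖z‖ ^ (n - 2))⁻¹) z ∧
      z ≠ 0 := fun z hz => by
    have hz0 : z ≠ 0 := norm_pos_iff.mp (hρ0.trans_le hz)
    exact ⟨h.contDiffAt z (hρ.trans_le hz), contDiffAt_inv_norm_pow _ hz0, hz0⟩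
  have hfd : ∀ z : Eu n, ρ ≤ ‖z‖ → ContDiffAt ℝ 2 f z := fun z hz =>
    (hd z hz).1.add (contDiffAt_const.add (contDiffAt_const.mul (hd z hz).2.1))
  set K : Set (Eu n) := {z | ‖z‖ ∈ Icc ρ R}
  have hKi : ∀ z ∈ K, z ∉ interior K → ‖z‖ = ρ ∨ ‖z‖ = R := fun z hz hzi => by
    by_contra! hne
    refine hzi (mem_interior.mpr ⟨{z | ‖z‖ ∈ Ioo ρ R}, fun w hw => ⟨hw.1.le, hw.2.le⟩,
      isOpen_Ioo.preimage continuous_norm, lt_of_le_of_ne hz.1 (Ne.symm hne.1),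
      lt_of_le_of_ne hz.2 hne.2⟩)
  have hpos : ∀ z : Eu n, ρ ≤ ‖z‖ → 0 ≤ M * ρ ^ (n - 2) * (‖z‖ ^ (n - 2))⁻¹ := fun z hz => by positivity
  have hmax := le_of_flatLap_eq_zero hn (isCompact_annulus ρ R) (f := f) (c := ε)
    (fun z hz => (hfd z hz.1).continuousAt.continuousWithinAt)
    (fun z hz => hfd z (interior_subset hz).1)
    (fun z hz => by
      obtain ⟨h1, h2, h3⟩ := hd z (interior_subset hz).1
      rw [flatLap_add h1 (contDiffAt_const.add (contDiffAt_const.mul h2)),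
        flatLap_add contDiffAt_const (contDiffAt_const.mul h2), flatLap_const, flatLap_const_mul _ h2,
        flatLap_inv_norm_pow hn h3, h.flatLap_eq_zero z (hρ.trans_le (interior_subset hz).1)]
      ring)
    (fun z hz hzi => by
      rcases hKi z hz hzi with h1 | h1
      · have h2 := hM z h1
        have h3 : M * ρ ^ (n - 2) * (‖z‖ ^ (n - 2))⁻¹ = M := by rw [h1]; field_simp
        simp only [f]; linarith
      · have h2 := (abs_le.mp (hC z (by rw [h1]; exact le_max_left _ _))).2
        have h3 := hpos z hz.1
        simp only [f]; linarith)
    y ⟨hy, (le_add_of_nonneg_right zero_le_one).trans (le_max_right _ _)⟩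
  simp only [f] at hmax
  linarith

theorem abs_sub_le (hn : 3 ≤ n) (h : IsHarmonicEnd r a V) {ρ M : ℝ} (hρ0 : 0 < ρ) (hρ : r < ρ)
    (hM0 : 0 ≤ M) (hM : ∀ y, ‖y‖ = ρ → |V y - a| ≤ M) {y : Eu n} (hy : ρ ≤ ‖y‖) :
    |V y - a| ≤ M * ρ ^ (n - 2) * (‖y‖ ^ (n - 2))⁻¹ := by
  have h1 := h.sub_le hn hρ0 hρ hM0 (fun z hz => (abs_le.mp (hM z hz)).2) hy
  have h2 := h.neg.sub_le hn hρ0 hρ hM0 (fun z hz => by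
    have := (abs_le.mp (hM z hz)).1; linarith) hy
  exact abs_le.mpr ⟨by linarith, h1⟩

end IsHarmonicEnd

/-- The Laplacian commutes, up to a factor, with translations, reflections and dilations. -/
theorem flatLap_comp_affine {f : Eu n → ℝ} (y : Eu n) (L : Eu n →L[ℝ] Eu n) {s : Fin n → ℝ} {c : ℝ}
    (hs : ∀ i, s i * s i = c) (hL : ∀ i, L (EuclideanSpace.single i 1) = s i • EuclideanSpace.single i 1)
    {x : Eu n} (hf : ContDiffAt ℝ 2 f (y + L x)) :
    flatLap (fun z => f (y + L z)) x = c * flatLap f (y + L x) := by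
  have h1 : ∀ {g : Eu n → ℝ} {z : Eu n} (i : Fin n), DifferentiableAt ℝ g (y + L z) →
      pd i (fun z => g (y + L z)) z = s i * pd i g (y + L z) := fun {g z} i hg => by
    have h2 : HasFDerivAt (fun z => g (y + L z)) ((fderiv ℝ g (y + L z)).comp L) z :=
      hg.hasFDerivAt.comp z (L.hasFDerivAt.const_add y)
    rw [pd_eq_of_hasFDerivAt h2]
    simp [hL, pd]
  have hc : ContinuousAt (fun z => y + L z) x := by fun_prop
  simp only [flatLap, Finset.mul_sum]
  refine Finset.sum_congr rfl fun i _ => ?_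
  have h2 : pd i (fun z => f (y + L z)) =ᶠ[𝓝 x] fun z => s i * pd i f (y + L z) := by
    filter_upwards [hc.eventually (eventually_differentiableAt two_ne_zero hf)] with z hz using h1 i hz
  have h3 := (contDiffAt_pd_one i hf).differentiableAt one_ne_zero
  have h4 : DifferentiableAt ℝ (fun z => pd i f (y + L z)) x :=
    DifferentiableAt.comp (g := pd i f) x h3 (by fun_prop : DifferentiableAt ℝ (fun z => y + L z) x)
  rw [pd_congr i h2, pd_const_mul i _ h4, h1 i h3, ← mul_assoc, hs]

/-- A gradient bound for harmonic functions, as a bound for differences: the odd part of `f` with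
respect to the reflection `xᵢ ↦ -xᵢ` is compared with a harmonic polynomial on a half ball. -/
theorem sub_le_of_flatLap_eq_zero (hn : 3 ≤ n) {f : Eu n → ℝ} {y : Eu n} {d M : ℝ} (hd : 0 < d)
    (hf : ∀ z ∈ Metric.closedBall y d, ContDiffAt ℝ 2 f z)
    (hL : ∀ z ∈ Metric.closedBall y d, flatLap f z = 0)
    (hM : ∀ z ∈ Metric.closedBall y d, |f z| ≤ M) (i : Fin n) {τ : ℝ} (hτ0 : 0 ≤ τ) (hτ : τ ≤ d) :
    f (y + τ • EuclideanSpace.single i 1) - f (y - τ • EuclideanSpace.single i 1) ≤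
      2 * (M * n / d) * τ := by
  set e : Eu n := EuclideanSpace.single i 1
  have hM0 : 0 ≤ M := (abs_nonneg _).trans (hM y (Metric.mem_closedBall_self hd.le))
  set P : Eu n →L[ℝ] Eu n := ContinuousLinearMap.id ℝ (Eu n) -
    (2 : ℝ) • (EuclideanSpace.proj i : Eu n →L[ℝ] ℝ).smulRight e with hP
  have hPx : ∀ x, P x = x - (2 * x i) • e := fun x => by simp [hP, smul_smul]
  have hPnorm : ∀ x, ‖P x‖ = ‖x‖ := fun x => by
    have h1 : ∀ j, P x j ^ 2 = x j ^ 2 := fun j => by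
      rw [hPx]
      by_cases hj : j = i
      · subst hj; simp [e]; ring
      · simp [e, hj]
    rw [EuclideanSpace.norm_eq, EuclideanSpace.norm_eq]
    congr 1
    exact Finset.sum_congr rfl fun j _ => by
      rw [Real.norm_eq_abs, Real.norm_eq_abs, sq_abs, sq_abs, h1]
  have hPe : ∀ j, P (EuclideanSpace.single j 1) =
      (if j = i then (-1 : ℝ) else 1) • EuclideanSpace.single j 1 := fun j => by
    rw [hPx]
    by_cases hj : j = i
    · subst hj
      simp only [e, PiLp.single_apply]
      norm_num
      rw [two_smul]; abel
    · simp [hj, Ne.symm hj]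
  have hid : ∀ j, (ContinuousLinearMap.id ℝ (Eu n)) (EuclideanSpace.single j 1) =
      (1 : ℝ) • EuclideanSpace.single j 1 := fun j => by simp
  have hmem : ∀ x : Eu n, ‖x‖ ≤ d → y + x ∈ Metric.closedBall y d := fun x hx => by
    simpa [Metric.mem_closedBall, dist_eq_norm] using hx
  set q : Eu n → ℝ := fun x => ‖x‖ ^ 2 + ((-n) * (x i * x i) + n * d * x i)
  set K : Set (Eu n) := {x | ‖x‖ ≤ d ∧ 0 ≤ x i}
  have hK : IsCompact K := (isCompact_closedBall (0 : Eu n) d).of_isClosed_subset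
    ((isClosed_le continuous_norm continuous_const).inter
      (isClosed_le continuous_const (contDiff_coord i).continuous)) fun x hx => by simpa using hx.1
  set F : Eu n → ℝ := fun x => f (y + ContinuousLinearMap.id ℝ (Eu n) x) +
    (-1 * f (y + P x) + (-(2 * M / d ^ 2)) * q x)
  have hsq : ∀ x : Eu n, ContDiffAt ℝ 2 (fun x : Eu n => ‖x‖ ^ 2) x := fun x =>
    (contDiff_norm_sq ℝ).contDiffAt
  have hc : ∀ x : Eu n, ContDiffAt ℝ 2 (fun x : Eu n => x i) x := fun x => (contDiff_coord i).contDiffAt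
  have hq1 : ∀ x : Eu n, ContDiffAt ℝ 2 (fun x : Eu n => (-n : ℝ) * (x i * x i)) x := fun x =>
    contDiffAt_const.mul ((hc x).mul (hc x))
  have hq2 : ∀ x : Eu n, ContDiffAt ℝ 2 (fun x : Eu n => n * d * x i) x := fun x =>
    contDiffAt_const.mul (hc x)
  have hq : ∀ x, ContDiffAt ℝ 2 q x := fun x => (hsq x).add ((hq1 x).add (hq2 x))
  have hLq : ∀ x, flatLap q x = 0 := fun x => by
    have h1 : flatLap (fun x : Eu n => x i) x = 0 := by
      have : ∀ j, pd j (fun x : Eu n => x i) = fun _ => if j = i then 1 else 0 := fun j =>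
        funext fun x => pd_coord j i x
      simp only [flatLap, this]
      exact Finset.sum_eq_zero fun j _ => by simp [pd]
    have h2 : flatLap (fun x : Eu n => x i * x i) x = 2 := by
      have h3 : ∀ j, pd j (fun x : Eu n => x i * x i) = fun x => (if j = i then 2 else 0) * x i :=
        fun j => funext fun x => by
          rw [pd_mul j (differentiableAt_coord i x) (differentiableAt_coord i x), pd_coord]
          split_ifs <;> ring
      simp only [flatLap, h3, pd_const_mul _ _ (differentiableAt_coord i x), pd_coord]
      simp
    rw [flatLap_add (hsq x) ((hq1 x).add (hq2 x)), flatLap_add (hq1 x) (hq2 x), flatLap_normSq,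
      flatLap_const_mul _ ((hc x).mul (hc x)), flatLap_const_mul _ (hc x), h1, h2]
    ring
  have hf1 : ∀ x, ‖x‖ ≤ d → ContDiffAt ℝ 2 (fun x => f (y + ContinuousLinearMap.id ℝ (Eu n) x)) x :=
    fun x hx => by
      have h : ContDiffAt ℝ 2 (fun x => y + ContinuousLinearMap.id ℝ (Eu n) x) x :=
        (contDiff_const.add (ContinuousLinearMap.id ℝ (Eu n)).contDiff).contDiffAt
      have h2 : ContDiffAt ℝ 2 f (y + ContinuousLinearMap.id ℝ (Eu n) x) := hf _ (hmem x hx)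
      exact h2.comp x h
  have hf2 : ∀ x, ‖x‖ ≤ d → ContDiffAt ℝ 2 (fun x => f (y + P x)) x := fun x hx =>
    (hf _ (hmem _ ((hPnorm x).trans_le hx))).comp x (contDiff_const.add P.contDiff).contDiffAt
  have hF : ∀ x, ‖x‖ ≤ d → ContDiffAt ℝ 2 F x := fun x hx =>
    (hf1 x hx).add ((contDiffAt_const.mul (hf2 x hx)).add (contDiffAt_const.mul (hq x)))
  have hmax := le_of_flatLap_eq_zero hn hK (f := F) (c := 0)
    (fun x hx => (hF x hx.1).continuousAt.continuousWithinAt)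
    (fun x hx => hF x (interior_subset hx).1)
    (fun x hx => by
      have hx1 := (interior_subset hx).1
      rw [flatLap_add (hf1 x hx1) ((contDiffAt_const.mul (hf2 x hx1)).add (contDiffAt_const.mul (hq x))),
        flatLap_add (contDiffAt_const.mul (hf2 x hx1)) (contDiffAt_const.mul (hq x)),
        flatLap_const_mul _ (hf2 x hx1), flatLap_const_mul _ (hq x), hLq,
        flatLap_comp_affine y _ (s := fun _ => 1) (c := 1) (by simp) hid (hf _ (hmem x hx1)),
        flatLap_comp_affine y P (s := fun j => if j = i then -1 else 1) (c := 1)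
          (fun j => by split_ifs <;> norm_num) hPe (hf _ (hmem _ ((hPnorm x).trans_le hx1))),
        ContinuousLinearMap.id_apply, hL _ (hmem x hx1), hL _ (hmem _ ((hPnorm x).trans_le hx1))]
      ring)
    (fun x hx hxi => by
      have h1 : ‖x‖ = d ∨ x i = 0 := by
        by_contra! hne
        refine hxi (mem_interior.mpr ⟨{x | ‖x‖ < d ∧ 0 < x i}, fun w hw => ⟨hw.1.le, hw.2.le⟩,
          (isOpen_lt continuous_norm continuous_const).inter
            (isOpen_lt continuous_const (contDiff_coord i).continuous), lt_of_le_of_ne hx.1 hne.1,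
          lt_of_le_of_ne hx.2 (Ne.symm hne.2)⟩)
      have hxd : x i ≤ d := (le_abs_self _).trans ((PiLp.norm_apply_le x i).trans hx.1)
      rcases h1 with h1 | h1
      · have h2 : d ^ 2 ≤ q x := by
          have : 0 ≤ (n : ℝ) * (x i * (d - x i)) :=
            mul_nonneg (Nat.cast_nonneg n) (mul_nonneg hx.2 (sub_nonneg.mpr hxd))
          simp only [q, h1]; linarith
        have h3 : 2 * M ≤ 2 * M / d ^ 2 * q x := by
          rw [div_mul_eq_mul_div, le_div_iff₀ (by positivity)]
          exact mul_le_mul_of_nonneg_left h2 (by positivity)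
        have h4 := (abs_le.mp (hM _ (hmem x hx.1))).2
        have h5 := (abs_le.mp (hM _ (hmem _ ((hPnorm x).trans_le hx.1)))).1
        simp only [F, ContinuousLinearMap.id_apply]
        linarith
      · have h2 : P x = x := by rw [hPx, h1]; simp
        have h3 : 0 ≤ 2 * M / d ^ 2 * q x := by
          refine mul_nonneg (by positivity) ?_
          simp only [q, h1]; simp
        simp only [F, ContinuousLinearMap.id_apply, h2]
        linarith)
    (τ • e) ⟨by simpa [e, norm_smul, abs_of_nonneg hτ0] using hτ, by simpa [e] using hτ0⟩
  have h1 : P (τ • e) = -(τ • e) := by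
    rw [hPx]; simp [e]; module
  have h2 : q (τ • e) ≤ n * d * τ := by
    have h3 : (τ • e) i = τ := by simp [e]
    have h4 : ‖τ • e‖ = τ := by simp [e, norm_smul, abs_of_nonneg hτ0]
    have h5 : (1 : ℝ) ≤ n := by exact_mod_cast (by omega : 1 ≤ n)
    simp only [q, h3, h4]
    nlinarith [mul_nonneg hτ0 hτ0]
  have h3 : 2 * M / d ^ 2 * q (τ • e) ≤ 2 * (M * n / d) * τ := by
    calc 2 * M / d ^ 2 * q (τ • e) ≤ 2 * M / d ^ 2 * (n * d * τ) := by gcongr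
      _ = 2 * (M * n / d) * τ := by field_simp
  simp only [F, ContinuousLinearMap.id_apply, h1, ← sub_eq_add_neg] at hmax
  linarith

/-- A function on `{|y| > r}` which is a uniform limit of harmonic functions, and which tends to `a` at
infinity. -/
structure IsHarmonicLimit (r a : ℝ) (W : Eu n → ℝ) : Prop where
  contDiffAt : ∀ y, r < ‖y‖ → ContDiffAt ℝ 1 W y
  limit : Tendsto W (Bornology.cobounded (Eu n)) (𝓝 a)
  approx : ∀ ε > 0, ∃ V α, IsHarmonicEnd r α V ∧ ∀ y, r < ‖y‖ → |V y - W y| ≤ ε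

theorem cobounded_neBot (hn : 3 ≤ n) : (Bornology.cobounded (Eu n)).NeBot := by
  have : Nonempty (Fin n) := ⟨⟨0, by omega⟩⟩
  infer_instance

theorem eventually_norm_gt (r : ℝ) : ∀ᶠ y in Bornology.cobounded (Eu n), r < ‖y‖ :=
  tendsto_norm_cobounded_atTop.eventually (eventually_gt_atTop r)

namespace IsHarmonicLimit

variable {r a : ℝ} {W : Eu n → ℝ}

theorem continuousOn (h : IsHarmonicLimit r a W) : ContinuousOn W {y | r < ‖y‖} := fun y hy =>
  (h.contDiffAt y hy).continuousAt.continuousWithinAt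

theorem neg (h : IsHarmonicLimit r a W) : IsHarmonicLimit r (-a) (fun y => -W y) where
  contDiffAt y hy := (h.contDiffAt y hy).neg
  limit := h.limit.neg
  approx ε hε := by
    obtain ⟨V, α, hV, hVW⟩ := h.approx ε hε
    refine ⟨_, _, hV.neg, fun y hy => ?_⟩
    rw [← abs_neg]
    simpa [add_comm, sub_eq_add_neg] using hVW y hy

theorem exists_approx (hn : 3 ≤ n) (h : IsHarmonicLimit r a W) {ε : ℝ} (hε : 0 < ε) :
    ∃ V α, IsHarmonicEnd r α V ∧ (∀ y, r < ‖y‖ → |V y - W y| ≤ ε) ∧ |α - a| ≤ ε := by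
  obtain ⟨V, α, hV, hVW⟩ := h.approx ε hε
  have := cobounded_neBot hn
  exact ⟨V, α, hV, hVW, le_of_tendsto (hV.limit.sub h.limit).abs
    ((eventually_norm_gt r).mono fun y hy => hVW y hy)⟩

/-- The form of the spherical means is inherited from the approximations: their coefficients `B`
converge, as they are determined by the mean over a single sphere. -/
theorem exists_sphereIntegral_eq (hn : 3 ≤ n) (hr : 0 ≤ r) (h : IsHarmonicLimit r a W) :
    ∃ B, ∀ σ, r < σ → sphereIntegral W σ = a * sphereArea n + B * (σ ^ (n - 2))⁻¹ := by
  set q : ℝ → ℝ := fun σ => (sphereIntegral W σ - a * sphereArea n) * σ ^ (n - 2)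
  have hA : 0 ≤ sphereArea n := measureReal_nonneg
  have hq : ∀ σ, r < σ → ∀ τ, r < τ → q σ = q τ := fun σ hσ τ hτ => by
    refine eq_of_abs_sub_nonpos (le_of_forall_pos_le_add fun ε hε => ?_)
    have hσ0 : 0 < σ := hr.trans_lt hσ
    have hτ0 : 0 < τ := hr.trans_lt hτ
    set Q : ℝ := 2 * sphereArea n * σ ^ (n - 2) + 2 * sphereArea n * τ ^ (n - 2)
    have hQ : 0 ≤ Q := by positivity
    obtain ⟨V, α, hV, hVW, hα⟩ := h.exists_approx hn (show 0 < ε / (Q + 1) by positivity)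
    obtain ⟨B, hB⟩ := hV.exists_sphereIntegral_eq hn hr
    have key : ∀ s, r < s → |q s - B| ≤ ε / (Q + 1) * (2 * sphereArea n * s ^ (n - 2)) := fun s hs => by
      have hs0 : 0 < s := hr.trans_lt hs
      have h1 := abs_sphereIntegral_le (f := fun y => V y - W y) hs0.le fun y hy =>
        hVW y (by rw [hy]; exact hs)
      rw [sphereIntegral_sub hr hV.continuousOn h.continuousOn hs, hB s hs] at h1
      have h2 : q s - B = (-(α * sphereArea n + B * (s ^ (n - 2))⁻¹ - sphereIntegral W s) +
          (α - a) * sphereArea n) * s ^ (n - 2) := by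
        simp only [q]; field_simp; ring
      rw [h2, abs_mul, abs_of_pos (pow_pos hs0 _)]
      have h3 : |(α - a) * sphereArea n| ≤ ε / (Q + 1) * sphereArea n := by
        rw [abs_mul, abs_of_nonneg hA]; exact mul_le_mul_of_nonneg_right hα hA
      calc _ ≤ (ε / (Q + 1) * sphereArea n + ε / (Q + 1) * sphereArea n) * s ^ (n - 2) := by
            gcongr
            exact (abs_add_le _ _).trans (add_le_add (by rwa [abs_neg]) h3)
        _ = _ := by ring
    have h1 := key σ hσ
    have h2 := key τ hτ
    have h3 : ε / (Q + 1) * Q ≤ ε := by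
      rw [div_mul_eq_mul_div, div_le_iff₀ (by positivity)]; nlinarith
    have h4 : |q σ - q τ| ≤ |q σ - B| + |q τ - B| := by
      rw [abs_sub_comm (q τ)]; exact abs_sub_le _ _ _
    have h5 : ε / (Q + 1) * Q = ε / (Q + 1) * (2 * sphereArea n * σ ^ (n - 2)) +
      ε / (Q + 1) * (2 * sphereArea n * τ ^ (n - 2)) := mul_add _ _ _
    linarith
  refine ⟨q (r + 1), fun σ hσ => ?_⟩
  have hσ0 : 0 < σ := hr.trans_lt hσ
  rw [← hq σ hσ _ (lt_add_one r)]
  simp only [q]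
  field_simp
  ring

/-- The decay towards the limit at infinity is like `|y|^(2-n)`. -/
theorem exists_abs_sub_le (hn : 3 ≤ n) (hr : 0 ≤ r) (h : IsHarmonicLimit r a W) {ρ : ℝ}
    (hρ : r < ρ) : ∃ C, 0 ≤ C ∧ ∀ y, ρ ≤ ‖y‖ → |W y - a| ≤ C * (‖y‖ ^ (n - 2))⁻¹ := by
  have hρ0 : 0 < ρ := hr.trans_lt hρ
  have hS : IsCompact (Metric.sphere (0 : Eu n) ρ) := isCompact_sphere _ _
  obtain ⟨M, hM⟩ := hS.exists_bound_of_continuousOn (f := fun y => W y - a)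
    ((h.continuousOn.mono fun y hy => by
      rw [mem_sphere_zero_iff_norm] at hy; rw [mem_ofPred_eq, hy]; exact hρ).sub continuousOn_const)
  refine ⟨max M 0 * ρ ^ (n - 2), by positivity, fun y hy => ?_⟩
  have hy0 : 0 < ‖y‖ := hρ0.trans_le hy
  refine le_of_forall_pos_le_add fun ε hε => ?_
  set Q := 2 + 2 * ρ ^ (n - 2) * (‖y‖ ^ (n - 2))⁻¹
  have hQ : 0 < Q := by positivity
  obtain ⟨V, α, hV, hVW, hα⟩ := h.exists_approx hn (show 0 < ε / Q by positivity)
  have h1 := hV.abs_sub_le hn hρ0 hρ (M := max M 0 + 2 * (ε / Q)) (by positivity) (fun z hz => by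
    have h2 : |W z - a| ≤ M := hM z (by simpa using hz)
    have h3 := hVW z (by rw [hz]; exact hρ)
    have h4 : |V z - α| ≤ |V z - W z| + |W z - a| + |α - a| := by
      rw [show V z - α = (V z - W z) + (W z - a) + -(α - a) by ring]
      refine (abs_add_le _ _).trans ?_
      rw [abs_neg]
      exact add_le_add (abs_add_le _ _) le_rfl
    have h5 := le_max_left M 0
    linarith) hy
  have h3 := hVW y (hρ.trans_le hy)
  have h4 : |W y - a| ≤ |V y - W y| + |V y - α| + |α - a| := by
    rw [show W y - a = -(V y - W y) + (V y - α) + (α - a) by ring]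
    refine (abs_add_le _ _).trans (add_le_add ((abs_add_le _ _).trans ?_) le_rfl)
    rw [abs_neg]
  have h5 : ε / Q * Q = ε := div_mul_cancel₀ _ hQ.ne'
  have h6 : (max M 0 + 2 * (ε / Q)) * ρ ^ (n - 2) * (‖y‖ ^ (n - 2))⁻¹ =
      max M 0 * ρ ^ (n - 2) * (‖y‖ ^ (n - 2))⁻¹ + (ε / Q * Q - 2 * (ε / Q)) := by
    simp only [Q]; ring
  linarith

/-- The gradient bound for harmonic functions passes to the limit, although the gradients of the
approximations are not known to converge. -/
theorem pd_le (hn : 3 ≤ n) (h : IsHarmonicLimit r a W) {y : Eu n} {d M : ℝ} (hd : 0 < d)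
    (hB : ∀ z ∈ Metric.closedBall y d, r < ‖z‖) (hM : ∀ z ∈ Metric.closedBall y d, |W z - a| ≤ M)
    (i : Fin n) : pd i W y ≤ M * n / d := by
  set e : Eu n := EuclideanSpace.single i 1
  have he : ‖e‖ = 1 := by simp [e]
  -- the difference quotients of `W` inherit the bound from the approximations
  have hquot : ∀ τ, 0 ≤ τ → τ ≤ d → W (y + τ • e) - W (y - τ • e) ≤ 2 * (M * n / d) * τ :=
    fun τ hτ0 hτ => by
    refine le_of_forall_pos_le_add fun ε hε => ?_
    set Q := 2 + 4 * (n / d) * τ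
    have hQ : 0 < Q := by positivity
    obtain ⟨V, α, hV, hVW, hα⟩ := h.exists_approx hn (show 0 < ε / Q by positivity)
    have h1 := sub_le_of_flatLap_eq_zero hn (f := fun z => V z + -α) (y := y) (M := M + 2 * (ε / Q)) hd
      (fun z hz => (hV.contDiffAt z (hB z hz)).add contDiffAt_const)
      (fun z hz => by
        rw [flatLap_add (hV.contDiffAt z (hB z hz)) contDiffAt_const, flatLap_const, add_zero]
        exact hV.flatLap_eq_zero z (hB z hz))
      (fun z hz => by
        have h2 := hM z hz
        have h3 := hVW z (hB z hz)
        rw [show V z + -α = (V z - W z) + (W z - a) + -(α - a) by ring]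
        refine (abs_add_le _ _).trans ?_
        rw [abs_neg]
        have := abs_add_le (V z - W z) (W z - a)
        linarith) i hτ0 hτ
    have hmem : ∀ s : ℝ, |s| ≤ d → y + s • e ∈ Metric.closedBall y d := fun s hs => by
      simpa [Metric.mem_closedBall, dist_eq_norm, norm_smul, he] using hs
    have h2 := abs_le.mp (hVW _ (hB _ (hmem τ (by rwa [abs_of_nonneg hτ0]))))
    have h3 := abs_le.mp (hVW _ (hB _ (hmem (-τ) (by rwa [abs_neg, abs_of_nonneg hτ0]))))
    rw [neg_smul, ← sub_eq_add_neg] at h3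
    have h5 : ε / Q * Q = ε := div_mul_cancel₀ _ hQ.ne'
    have h6 : 2 * ((M + 2 * (ε / Q)) * n / d) * τ =
      2 * (M * n / d) * τ + (ε / Q * Q - 2 * (ε / Q)) := by simp only [Q]; ring
    linarith [h2.1, h2.2, h3.1, h3.2]
  have hy := (h.contDiffAt y (hB y (Metric.mem_closedBall_self hd.le))).differentiableAt one_ne_zero
  have hline : ∀ v : Eu n, HasDerivAt (fun τ : ℝ => W (y + τ • v)) (fderiv ℝ W y v) 0 := fun v => by
    have h1 : HasFDerivAt W (fderiv ℝ W y) (y + (0 : ℝ) • v) := by simpa using hy.hasFDerivAt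
    exact h1.comp_hasDerivAt (0 : ℝ) (hasDerivAt_line y v 0)
  have hder : HasDerivAt (fun τ : ℝ => W (y + τ • e) - W (y + τ • -e)) (2 * pd i W y) 0 := by
    refine ((hline e).sub (hline (-e))).congr_deriv ?_
    rw [map_neg, pd]; ring
  have hslope : Tendsto (slope (fun τ : ℝ => W (y + τ • e) - W (y + τ • -e)) 0) (𝓝[>] 0)
      (𝓝 (2 * pd i W y)) := (hasDerivAt_iff_tendsto_slope.mp hder).mono_left
    (nhdsWithin_mono (0 : ℝ) (fun τ (hτ : 0 < τ) => hτ.ne' : Ioi (0 : ℝ) ⊆ {0}ᶜ))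
  have hle : 2 * pd i W y ≤ 2 * (M * n / d) := by
    refine le_of_tendsto hslope ?_
    filter_upwards [Ioo_mem_nhdsGT hd] with τ hτ
    rw [slope_def_field, sub_zero, div_le_iff₀ hτ.1]
    have := hquot τ hτ.1.le hτ.2.le
    simpa [sub_eq_add_neg] using this
  linarith

theorem abs_pd_le (hn : 3 ≤ n) (h : IsHarmonicLimit r a W) {y : Eu n} {d M : ℝ} (hd : 0 < d)
    (hB : ∀ z ∈ Metric.closedBall y d, r < ‖z‖) (hM : ∀ z ∈ Metric.closedBall y d, |W z - a| ≤ M)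
    (i : Fin n) : |pd i W y| ≤ M * n / d := by
  have hy := (h.contDiffAt y (hB y (Metric.mem_closedBall_self hd.le))).differentiableAt one_ne_zero
  have h1 := h.neg.pd_le hn hd hB (M := M) (fun z hz => by
    rw [← abs_neg, neg_sub]; simpa [add_comm, sub_eq_add_neg] using hM z hz) i
  have h2 := pd_const_mul i (-1) hy
  simp only [neg_one_mul] at h2
  rw [h2] at h1
  exact abs_le.mpr ⟨by linarith, h.pd_le hn hd hB hM i⟩

/-- The gradient decays like `|y|^(1-n)`. -/
theorem exists_abs_radialDeriv_le (hn : 3 ≤ n) (hr : 0 ≤ r) (h : IsHarmonicLimit r a W) :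
    ∃ C ρ, r < ρ ∧ 0 ≤ C ∧ ∀ y, ρ ≤ ‖y‖ → |radialDeriv W y| ≤ C * (‖y‖ ^ (n - 1))⁻¹ := by
  obtain ⟨C, hC0, hC⟩ := h.exists_abs_sub_le hn hr (lt_add_one r)
  refine ⟨n * (C * 2 ^ (n - 2) * n * 2), 2 * (r + 1), by linarith, by positivity, fun y hy => ?_⟩
  have hy0 : 0 < ‖y‖ := by linarith
  have hball : ∀ z ∈ Metric.closedBall y (‖y‖ / 2), ‖y‖ / 2 ≤ ‖z‖ := fun z hz => by
    rw [Metric.mem_closedBall, dist_eq_norm] at hz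
    have := norm_sub_norm_le y z
    rw [norm_sub_rev] at this
    linarith
  have hp := h.abs_pd_le hn (M := C * 2 ^ (n - 2) * (‖y‖ ^ (n - 2))⁻¹) (half_pos hy0)
    (fun z hz => by have := hball z hz; linarith) (fun z hz => by
      have h1 := hball z hz
      refine (hC z (by linarith)).trans ?_
      rw [mul_assoc]
      refine mul_le_mul_of_nonneg_left ?_ hC0
      have h2 : ((‖y‖ / 2) ^ (n - 2))⁻¹ = 2 ^ (n - 2) * (‖y‖ ^ (n - 2))⁻¹ := by
        rw [div_pow, inv_div, div_eq_mul_inv]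
      rw [← h2]
      gcongr)
  rw [radialDeriv, fderiv_eq_sum_pd]
  refine (Finset.abs_sum_le_sum_abs _ _).trans ?_
  refine (Finset.sum_le_sum (g := fun _ => C * 2 ^ (n - 2) * n * 2 * (‖y‖ ^ (n - 1))⁻¹) fun i _ => ?_).trans ?_
  · rw [abs_mul]
    have h1 : |(‖y‖⁻¹ • y) i| ≤ 1 := by
      refine (PiLp.norm_apply_le (‖y‖⁻¹ • y) i).trans ?_
      rw [norm_smul, norm_inv, norm_norm, inv_mul_cancel₀ hy0.ne']
    refine (mul_le_mul h1 (hp i) (abs_nonneg _) zero_le_one).trans (le_of_eq ?_)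
    rw [show n - 1 = n - 2 + 1 by omega, pow_succ]
    field_simp
  · simp [mul_assoc]

end IsHarmonicLimit

end Exterior

/-! ### The mass of a conformally flat end -/

section Mass

variable {n : ℕ}

namespace IsHarmonicLimit

variable {r a b : ℝ} {V W : Eu n → ℝ}

theorem const_mul (c : ℝ) (h : IsHarmonicLimit r a W) :
    IsHarmonicLimit r (c * a) (fun y => c * W y) where
  contDiffAt y hy := contDiffAt_const.mul (h.contDiffAt y hy)
  limit := h.limit.const_mul c
  approx ε hε := by
    obtain ⟨V, α, hV, hVW⟩ := h.approx (ε / (|c| + 1)) (by positivity)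
    refine ⟨fun y => c * V y, c * α, ⟨fun y hy => contDiffAt_const.mul (hV.contDiffAt y hy),
      fun y hy => by rw [flatLap_const_mul c (hV.contDiffAt y hy), hV.flatLap_eq_zero y hy, mul_zero],
      hV.limit.const_mul c⟩, fun y hy => ?_⟩
    rw [← mul_sub, abs_mul]
    have h1 := hVW y hy
    rw [le_div_iff₀ (by positivity)] at h1
    nlinarith [abs_nonneg c, abs_nonneg (V y - W y)]

theorem add (hV : IsHarmonicLimit r b V) (hW : IsHarmonicLimit r a W) :
    IsHarmonicLimit r (b + a) (fun y => V y + W y) where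
  contDiffAt y hy := (hV.contDiffAt y hy).add (hW.contDiffAt y hy)
  limit := hV.limit.add hW.limit
  approx ε hε := by
    obtain ⟨V', β, hV', hVV⟩ := hV.approx (ε / 2) (by positivity)
    obtain ⟨W', α, hW', hWW⟩ := hW.approx (ε / 2) (by positivity)
    refine ⟨fun y => V' y + W' y, β + α, ⟨fun y hy => (hV'.contDiffAt y hy).add (hW'.contDiffAt y hy),
      fun y hy => by
        rw [flatLap_add (hV'.contDiffAt y hy) (hW'.contDiffAt y hy), hV'.flatLap_eq_zero y hy,
          hW'.flatLap_eq_zero y hy, add_zero],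
      hV'.limit.add hW'.limit⟩, fun y hy => ?_⟩
    have h1 := hVV y hy
    have h2 := hWW y hy
    rw [add_sub_add_comm]
    exact (abs_add_le _ _).trans (by linarith)

theorem comp_smul {lam : ℝ} (hlam : 0 < lam) (h : IsHarmonicLimit r a W) :
    IsHarmonicLimit (lam * r) a (fun y => W (lam⁻¹ • y)) := by
  have hnorm : ∀ y : Eu n, lam * r < ‖y‖ → r < ‖lam⁻¹ • y‖ := fun y hy => by
    rw [norm_smul, norm_inv, Real.norm_of_nonneg hlam.le, inv_mul_eq_div, lt_div_iff₀ hlam]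
    linarith
  have hlim : Tendsto (fun y : Eu n => lam⁻¹ • y) (Bornology.cobounded _) (Bornology.cobounded _) := by
    refine tendsto_norm_atTop_iff_cobounded.mp ?_
    simp only [norm_smul]
    exact tendsto_norm_cobounded_atTop.const_mul_atTop (norm_pos_iff.mpr (inv_ne_zero hlam.ne'))
  refine ⟨fun y hy => ?_, h.limit.comp hlim, fun ε hε => ?_⟩
  · exact (h.contDiffAt _ (hnorm y hy)).comp y (contDiff_const_smul lam⁻¹).contDiffAt
  · obtain ⟨V, α, hV, hVW⟩ := h.approx ε hε
    refine ⟨fun y => V (lam⁻¹ • y), α, ⟨fun y hy => ?_, fun y hy => ?_, hV.limit.comp hlim⟩,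
      fun y hy => hVW _ (hnorm y hy)⟩
    · exact (hV.contDiffAt _ (hnorm y hy)).comp y (contDiff_const_smul lam⁻¹).contDiffAt
    · have h1 := flatLap_comp_affine (f := V) 0 (lam⁻¹ • ContinuousLinearMap.id ℝ (Eu n))
        (s := fun _ => lam⁻¹) (x := y) (fun _ => rfl) (fun i => by simp)
        (by simpa using hV.contDiffAt _ (hnorm y hy))
      simpa [hV.flatLap_eq_zero _ (hnorm y hy)] using h1

end IsHarmonicLimit

theorem continuousOn_radialDeriv {f : Eu n → ℝ} {r : ℝ} (hr : 0 ≤ r)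
    (hf : ∀ y, r < ‖y‖ → ContDiffAt ℝ 1 f y) : ContinuousOn (radialDeriv f) {y | r < ‖y‖} :=
  fun y hy => (((hf y hy).fderiv_right (m := 0) (by norm_num)).continuousAt.continuousWithinAt).clm_apply
    ((continuous_norm.continuousWithinAt.inv₀ (hr.trans_lt hy).ne').smul continuousWithinAt_id)

/-- For a conformally flat metric only the derivative of the conformal factor enters the flux. -/
theorem admFlux_eq {G : Eu n → Matrix (Fin n) (Fin n) ℝ} {w : Eu n → ℝ} {r σ : ℝ} (hr : 0 ≤ r)
    (hσ : r < σ) (hG : ∀ y, r < ‖y‖ → G y = w y • 1)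
    (hw : ∀ y, r < ‖y‖ → DifferentiableAt ℝ w y) :
    admFlux G σ = (1 - n) * (σ ^ (n - 1) * sphereIntegral (radialDeriv w) σ) := by
  have hσ0 : 0 < σ := hr.trans_lt hσ
  rw [← mul_left_comm, admFlux, ← sphereIntegral_const_mul]
  congr 1
  refine integral_congr_ae (Eventually.of_forall fun θ => ?_)
  have hy : r < ‖σ • (θ : Eu n)‖ := by rwa [norm_smul_sphere hσ0.le]
  have hpd : ∀ i j k, pd k (fun z => G z i j) (σ • (θ : Eu n)) =
      (1 : Matrix (Fin n) (Fin n) ℝ) i j * pd k w (σ • (θ : Eu n)) := fun i j k => by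
    rw [← pd_const_mul k _ (hw _ hy)]
    refine pd_congr k ?_
    filter_upwards [(isOpen_lt continuous_const continuous_norm).mem_nhds hy] with z hz
    rw [hG z hz, Matrix.smul_apply, smul_eq_mul, mul_comm]
  simp only [hpd, radialDeriv_smul w hσ0, fderiv_eq_sum_pd w _ (θ : Eu n), Matrix.one_apply_eq,
    one_mul, Matrix.one_apply, sub_mul, Finset.sum_sub_distrib, ite_mul, zero_mul,
    Finset.sum_ite_eq, Finset.mem_univ, if_true, Finset.sum_const, Finset.card_univ,
    Fintype.card_fin, nsmul_eq_mul]
  congr 1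
  · exact Finset.sum_congr rfl fun i _ => by ring
  · congr 1
    exact Finset.sum_congr rfl fun i _ => by ring

/-- The flux of a harmonic function, from its spherical means. -/
theorem sphereIntegral_radialDeriv_eq (hn : 3 ≤ n) {W : Eu n → ℝ} {r a b σ : ℝ} (hr : 0 ≤ r)
    (hW : ∀ y, r < ‖y‖ → ContDiffAt ℝ 1 W y)
    (hb : ∀ σ, r < σ → sphereIntegral W σ = sphereArea n * (a + b * (σ ^ (n - 2))⁻¹)) (hσ : r < σ) :
    σ ^ (n - 1) * sphereIntegral (radialDeriv W) σ = -((n - 2) * b * sphereArea n) := by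
  have hσ0 : 0 < σ := hr.trans_lt hσ
  have h1 : HasDerivAt (fun σ => sphereArea n * (a + b * (σ ^ (n - 2))⁻¹))
      (sphereArea n * (b * (-(((n - 2 : ℕ) : ℝ) * (σ ^ (n - 2 + 1))⁻¹)))) σ :=
    (((hasDerivAt_inv_pow (n - 2) hσ0.ne').const_mul b).const_add a).const_mul _
  have h2 := (hasDerivAt_sphereIntegral hr hW hσ).unique (h1.congr_of_eventuallyEq (by
    filter_upwards [isOpen_Ioi.mem_nhds hσ] with s hs using hb s hs))
  rw [h2, show n - 2 + 1 = n - 1 by omega, Nat.cast_sub (by omega : 2 ≤ n)]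
  field_simp
  push_cast
  ring

/-- The mass, in asymptotically Euclidean coordinates. -/
theorem tendsto_admFlux (hn : 3 ≤ n) {W : Eu n → ℝ} {r b : ℝ} (hr : 0 ≤ r)
    (h : IsHarmonicLimit r 1 W) (hpos : ∀ y, r < ‖y‖ → 0 < W y)
    (hb : ∀ σ, r < σ → sphereIntegral W σ = sphereArea n * (1 + b * (σ ^ (n - 2))⁻¹))
    {G : Eu n → Matrix (Fin n) (Fin n) ℝ}
    (hG : ∀ y, r < ‖y‖ → G y = (W y ^ (4 / ((n : ℝ) - 2))) • 1) :
    Tendsto (fun σ => 1 / (2 * ((n : ℝ) - 1) * sphereArea n) * admFlux G σ) atTop (𝓝 (2 * b)) := by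
  have hn3 : (3 : ℝ) ≤ n := by exact_mod_cast hn
  have hA := sphereArea_pos hn
  set p : ℝ := 4 / ((n : ℝ) - 2) with hp
  have hp2 : p * (n - 2) = 4 := div_mul_cancel₀ _ (by linarith)
  set w : Eu n → ℝ := fun y => W y ^ p
  have hw : ∀ y, r < ‖y‖ → ContDiffAt ℝ 1 w y := fun y hy =>
    (h.contDiffAt y hy).rpow_const_of_ne (hpos y hy).ne'
  have hwd : ∀ y, r < ‖y‖ → radialDeriv w y = p * W y ^ (p - 1) * radialDeriv W y := fun y hy => by
    have h1 := (((h.contDiffAt y hy).differentiableAt one_ne_zero).hasFDerivAt.rpow_const (p := p)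
      (Or.inl (hpos y hy).ne')).fderiv
    rw [radialDeriv, show fderiv ℝ w y = _ from h1]
    rfl
  obtain ⟨C, ρ, hρ, hC0, hC⟩ := h.exists_abs_radialDeriv_le hn hr
  have hcw := continuousOn_radialDeriv hr hw
  have hcW : ContinuousOn (fun y => p * radialDeriv W y) {y | r < ‖y‖} :=
    continuousOn_const.mul (continuousOn_radialDeriv hr h.contDiffAt)
  have hpow : Tendsto (fun y => p * (W y ^ (p - 1) - 1)) (Bornology.cobounded _) (𝓝 0) := by
    have := ((h.limit.rpow_const (p := p - 1) (Or.inl one_ne_zero)).sub_const 1).const_mul p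
    simpa using this
  have hlim : Tendsto (fun σ => σ ^ (n - 1) * sphereIntegral (radialDeriv w) σ) atTop
      (𝓝 (p * -((n - 2) * b * sphereArea n))) := by
    rw [Metric.tendsto_atTop]
    intro ε hε
    obtain ⟨D, hD⟩ := exists_forall_norm_of_tendsto hpow
      (show 0 < ε / (2 * (C * sphereArea n + 1)) by positivity)
    refine ⟨max D ρ, fun σ hσ => ?_⟩
    have hσρ : ρ ≤ σ := (le_max_right _ _).trans hσ
    have hσr : r < σ := hρ.trans_le hσρ
    have hσ0 : 0 < σ := hr.trans_lt hσr
    rw [Real.dist_eq, ← sphereIntegral_radialDeriv_eq hn hr h.contDiffAt hb hσr, mul_left_comm p,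
      ← sphereIntegral_const_mul p, ← mul_sub, ← sphereIntegral_sub hr hcw hcW hσr, abs_mul,
      abs_of_pos (pow_pos hσ0 _)]
    have h1 := abs_sphereIntegral_le hσ0.le (f := fun y => radialDeriv w y - p * radialDeriv W y)
      (C := ε / (2 * (C * sphereArea n + 1)) * (C * (σ ^ (n - 1))⁻¹)) fun y hy => by
        rw [hwd y (by rw [hy]; exact hσr), ← sub_mul, abs_mul]
        have h2 := hD y (by rw [hy]; exact (le_max_left _ _).trans hσ)
        have h3 := hC y (by rw [hy]; exact hσρ)
        rw [hy] at h3
        rw [sub_zero, mul_sub, mul_one] at h2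
        exact mul_le_mul h2 h3 (abs_nonneg _) (by positivity)
    calc σ ^ (n - 1) * |sphereIntegral (fun y => radialDeriv w y - p * radialDeriv W y) σ|
        ≤ σ ^ (n - 1) * (ε / (2 * (C * sphereArea n + 1)) * (C * (σ ^ (n - 1))⁻¹) * sphereArea n) := by
          gcongr
      _ = ε * ((C * sphereArea n) / (2 * (C * sphereArea n + 1))) := by
          field_simp
      _ < ε * 1 := by
          have : 0 ≤ C * sphereArea n := by positivity
          refine mul_lt_mul_of_pos_left ?_ hε
          rw [div_lt_one (by positivity)]
          linarith
      _ = ε := mul_one _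
  have h2 := (hlim.const_mul (1 - (n : ℝ))).const_mul (1 / (2 * ((n : ℝ) - 1) * sphereArea n))
  have h3 : 1 / (2 * ((n : ℝ) - 1) * sphereArea n) *
      ((1 - (n : ℝ)) * (p * -((n - 2) * b * sphereArea n))) = 2 * b := by
    have : (n : ℝ) - 1 ≠ 0 := by linarith
    field_simp
    linear_combination (b * (n - 1)) * hp2
  rw [h3] at h2
  refine h2.congr' ?_
  filter_upwards [eventually_gt_atTop r] with σ hσ
  rw [admFlux_eq hr hσ hG fun y hy => (hw y hy).differentiableAt one_ne_zero]

/-- An end on which the metric is `W^(4/(n-2)) δ`, with `W = a + b |y|^(2-n) + …`, has the mass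
`2ab`. -/
theorem isCoordADMMass_of_isHarmonicLimit (hn : 3 ≤ n) {W : Eu n → ℝ} {r a b : ℝ} (hr : 0 ≤ r)
    (ha : 0 < a) (h : IsHarmonicLimit r a W) (hpos : ∀ y, r < ‖y‖ → 0 < W y)
    (hb : ∀ σ, r < σ → sphereIntegral W σ = sphereArea n * (a + b * (σ ^ (n - 2))⁻¹))
    {G : Eu n → Matrix (Fin n) (Fin n) ℝ}
    (hG : ∀ y, r < ‖y‖ → G y = (W y ^ (4 / ((n : ℝ) - 2))) • 1) :
    IsCoordADMMass G (2 * a * b) := by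
  have hn3 : (3 : ℝ) ≤ n := by exact_mod_cast hn
  set p : ℝ := 4 / ((n : ℝ) - 2) with hp
  -- in the coordinates `lam • y` the conformal factor is `a⁻¹ W`, as `lam ^ (n - 2) = a ^ 2`
  set lam : ℝ := a ^ (2 / ((n : ℝ) - 2)) with hlam
  have hlam0 : 0 < lam := Real.rpow_pos_of_pos ha _
  have hlam2 : lam ^ 2 = a ^ p := by
    rw [hlam, ← Real.rpow_natCast, ← Real.rpow_mul ha.le, hp]
    congr 1
    push_cast
    ring
  have hlamn : lam ^ (n - 2) = a ^ 2 := by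
    rw [hlam, ← Real.rpow_natCast, ← Real.rpow_mul ha.le, ← Real.rpow_natCast a 2]
    congr 1
    rw [Nat.cast_sub (by omega : 2 ≤ n)]
    push_cast
    exact div_mul_cancel₀ _ (by linarith)
  set W' : Eu n → ℝ := fun y => a⁻¹ * W (lam⁻¹ • y)
  have hW' : IsHarmonicLimit (lam * r) 1 W' := by
    have := (h.comp_smul hlam0).const_mul a⁻¹
    rwa [inv_mul_cancel₀ ha.ne'] at this
  have hnorm : ∀ y : Eu n, lam * r < ‖y‖ → r < ‖lam⁻¹ • y‖ := fun y hy => by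
    rw [norm_smul, norm_inv, Real.norm_of_nonneg hlam0.le, inv_mul_eq_div, lt_div_iff₀ hlam0]
    linarith
  have hpos' : ∀ y, lam * r < ‖y‖ → 0 < W' y := fun y hy =>
    mul_pos (inv_pos.mpr ha) (hpos _ (hnorm y hy))
  have hG' : ∀ y, lam * r < ‖y‖ → rescale lam G y = (W' y ^ p) • 1 := fun y hy => by
    rw [rescale, hG _ (hnorm y hy), smul_smul, hlam2,
      Real.mul_rpow (inv_nonneg.mpr ha.le) (hpos _ (hnorm y hy)).le, Real.inv_rpow ha.le]
  refine ⟨lam, hlam0, fun i j => ?_, ?_⟩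
  · have h1 : Tendsto (fun y => W' y ^ p * (1 : Matrix (Fin n) (Fin n) ℝ) i j)
        (Bornology.cobounded _) (𝓝 ((1 : Matrix (Fin n) (Fin n) ℝ) i j)) := by
      simpa using (hW'.limit.rpow_const (p := p) (Or.inl one_ne_zero)).mul_const
        ((1 : Matrix (Fin n) (Fin n) ℝ) i j)
    refine h1.congr' ?_
    filter_upwards [eventually_norm_gt (lam * r)] with y hy
    rw [hG' y hy, Matrix.smul_apply, smul_eq_mul]
  · rw [mul_assoc 2 a b]
    refine tendsto_admFlux hn (by positivity) hW' hpos' (fun σ hσ => ?_) hG'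
    have hσ0 : 0 < σ := lt_of_le_of_lt (by positivity) hσ
    have h1 : sphereIntegral W' σ = a⁻¹ * sphereIntegral W (lam⁻¹ * σ) := by
      rw [sphereIntegral_const_mul]
      simp only [sphereIntegral, mul_smul]
    rw [h1, hb _ (by rw [inv_mul_eq_div, lt_div_iff₀ hlam0]; linarith), mul_pow, inv_pow, hlamn]
    field_simp

end Mass

/-! ### Harmonic functions in a harmonically flat end -/

section FlatEnd

variable {n : ℕ}

/-- Comparison of `flatLap` with the Laplacian of Mathlib. -/
theorem flatLap_eq_zero_of_harmonicAt {U : Eu n → ℝ} {y : Eu n}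
    (h : InnerProductSpace.HarmonicAt U y) : flatLap U y = 0 := by
  have h0 := h.2.self_of_nhds
  rw [InnerProductSpace.laplacian_eq_iteratedFDeriv_orthonormalBasis U
    (EuclideanSpace.basisFun (Fin n) ℝ)] at h0
  rw [flatLap]
  refine Eq.trans (Finset.sum_congr rfl fun i _ => ?_) h0
  have hd : DifferentiableAt ℝ (fderiv ℝ U) y :=
    (h.1.fderiv_right (m := 1) (by norm_num)).differentiableAt one_ne_zero
  have h1 : pd i (pd i U) y = _ :=
    pd_eq_of_hasFDerivAt (hd.hasFDerivAt.clm_apply (hasFDerivAt_const (EuclideanSpace.single i 1) y)) i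
  rw [h1, iteratedFDeriv_two_apply]
  simp

variable {M : Type*} [TopologicalSpace M] [ChartedSpace (Eu n) M] [IsManifold (𝓡 n) ∞ M]

/-- On the part `|y| > ρ` of the end `h = U^(4/(n-2)) δ`, with a harmonic function `U ∈ (0, 2]` that
tends to `1`. -/
structure IsFlatFactor (E : DistinguishedEnd n M) (h : FormField n M) (ρ : ℝ) (U : Eu n → ℝ) :
    Prop where
  le : E.R ≤ ρ
  contDiffAt : ∀ y, ρ < ‖y‖ → ContDiffAt ℝ 2 U y
  flatLap_eq_zero : ∀ y, ρ < ‖y‖ → flatLap U y = 0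
  pos : ∀ y, ρ < ‖y‖ → 0 < U y
  le_two : ∀ y, ρ < ‖y‖ → U y ≤ 2
  limit : Tendsto U (Bornology.cobounded (Eu n)) (𝓝 1)
  coeff_eq : ∀ y, ρ < ‖y‖ →
    coeff h E.chart y = (U y ^ (4 / ((n : ℝ) - 2))) • (1 : Matrix (Fin n) (Fin n) ℝ)

theorem exists_isFlatFactor {E : DistinguishedEnd n M} {h : FormField n M}
    (hh : E.IsHarmonicallyFlat h) : ∃ ρ U, IsFlatFactor E h ρ U := by
  obtain ⟨U, hU, hpos, hlim, hc⟩ := hh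
  obtain ⟨D, hD⟩ := exists_forall_norm_of_tendsto hlim one_pos
  have hR : ∀ y : Eu n, max E.R D < ‖y‖ → E.R < ‖y‖ := fun y hy => (le_max_left _ _).trans_lt hy
  exact ⟨max E.R D, U, le_max_left _ _, fun y hy => (hU y (hR y hy)).1,
    fun y hy => flatLap_eq_zero_of_harmonicAt (hU y (hR y hy)), fun y hy => hpos y (hR y hy),
    fun y hy => by
      have := (abs_le.mp (hD y ((le_max_right _ _).trans hy.le))).2
      linarith,
    hlim, fun y hy => hc y (hR y hy)⟩

namespace IsFlatFactor

variable {E : DistinguishedEnd n M} {g : C1Metric n M} {ρ r a : ℝ} {U : Eu n → ℝ} {f : M → ℝ}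

theorem isHarmonicEnd (hn : 3 ≤ n) (hU : IsFlatFactor E g.inner ρ U) (hr : ρ ≤ r)
    (hf : IsC2HarmonicOn g.inner f (E.beyond r)) (ha : E.HasLimit f a) :
    IsHarmonicEnd r a (fun y => U y * f (E.chart.symm y)) := by
  have key : ∀ y, r < ‖y‖ → ContDiffAt ℝ 2 (fun z => f (E.chart.symm z)) y ∧
      lapOp (coeff g.inner E.chart) (fun z => f (E.chart.symm z)) y = 0 := fun y hy =>
    hf _ E.smooth y (E.mem_target (hU.le.trans_lt (hr.trans_lt hy))) (E.symm_mem_beyond hy)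
  refine ⟨fun y hy => (hU.contDiffAt y (hr.trans_lt hy)).mul (key y hy).1, fun y hy => ?_, ?_⟩
  · have hyt := E.mem_target (hU.le.trans_lt (hr.trans_lt hy))
    refine flatLap_mul_eq_zero hn (G := coeff g.inner E.chart) (hU.contDiffAt y (hr.trans_lt hy))
      (hU.pos y (hr.trans_lt hy)) (hU.flatLap_eq_zero y (hr.trans_lt hy)) ?_ (key y hy).1 ?_
    · filter_upwards [(isOpen_lt continuous_const continuous_norm).mem_nhds
        (show y ∈ {z : Eu n | r < ‖z‖} from hy)] with z hz
      exact hU.coeff_eq z (hr.trans_lt hz)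
    · rw [coordLaplacian_eq_lapOp (fun i j => contDiffAt_coeff E.smooth g hyt i j)
        (posDef_coeff E.smooth g hyt).det_pos (key y hy).1]
      exact (key y hy).2
  · have := hU.limit.mul ha
    rwa [one_mul] at this

theorem isHarmonicLimit (hn : 3 ≤ n) (hU : IsFlatFactor E g.inner ρ U) (hr : ρ ≤ r)
    (hf : ∀ y, r < ‖y‖ → ContDiffAt ℝ 1 (fun z => f (E.chart.symm z)) y) (ha : E.HasLimit f a)
    (happ : ∀ ε > 0, ∃ f' α, IsC2HarmonicOn g.inner f' (E.beyond r) ∧ E.HasLimit f' α ∧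
      ∀ x ∈ E.beyond r, |f' x - f x| ≤ ε) :
    IsHarmonicLimit r a (fun y => U y * f (E.chart.symm y)) := by
  refine ⟨fun y hy => ((hU.contDiffAt y (hr.trans_lt hy)).of_le one_le_two).mul (hf y hy), ?_,
    fun ε hε => ?_⟩
  · have := hU.limit.mul ha
    rwa [one_mul] at this
  · obtain ⟨f', α, hf', hα, hff⟩ := happ (ε / 2) (by positivity)
    refine ⟨_, α, hU.isHarmonicEnd hn hr hf' hα, fun y hy => ?_⟩
    have hy' := hr.trans_lt hy
    rw [← mul_sub, abs_mul, abs_of_pos (hU.pos y hy')]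
    calc U y * |f' (E.chart.symm y) - f (E.chart.symm y)| ≤ 2 * (ε / 2) :=
          mul_le_mul (hU.le_two y hy') (hff _ (E.symm_mem_beyond hy)) (abs_nonneg _) zero_le_two
      _ = ε := by ring

end IsFlatFactor

end FlatEnd

namespace ConformalFlow

variable {n : ℕ} {M : Type*} [TopologicalSpace M] [T2Space M] [ConnectedSpace M]
  [ChartedSpace (Eu n) M] [IsManifold (𝓡 n) ∞ M] {E : DistinguishedEnd n M} (F : ConformalFlow E)
  {S : Hypersurface E} {χ : S.Double → ℝ} {t r ρ : ℝ} {U : Eu n → ℝ}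

/-- The conformal factor of `g_t` in the end, approximated by means of Riemann sums. -/
theorem isHarmonicLimit_u (hn : 3 ≤ n) (hU : IsFlatFactor E (F.g 0).inner ρ U) (ht : 0 ≤ t)
    (hr : ρ ≤ r) (hrS : E.beyond r ⊆ (F.Sig t).outside) :
    IsHarmonicLimit r (Real.exp (-t)) (fun y => U y * F.u t (E.chart.symm y)) := by
  refine hU.isHarmonicLimit hn hr
    (fun y hy => F.contDiffAt_u hn ht E.smooth (E.mem_target (hU.le.trans_lt (hr.trans_lt hy))))
    (F.hasLimit_u hn ht) fun ε hε => ?_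
  obtain ⟨N, hN⟩ := ((Metric.tendstoUniformly_iff.mp (F.tendstoUniformly_riemannSum hn ht)) ε hε).exists
  refine ⟨_, _, F.isC2HarmonicOn_riemannSum ht
    (fun s hs hst => hrS.trans (F.encloses s t hs hst.le)) N, F.hasLimit_riemannSum ht N,
    fun x _ => ?_⟩
  have := (hN x).le
  rwa [Real.dist_eq, abs_sub_comm] at this

/-- The velocities `v_s` converge to the potential of `χ`, uniformly outside `S`, as `s` tends to `t`
on the side `X` of `t`. -/
structure VelocityTendsto (t : ℝ) (X : Set ℝ) (χ : S.Double → ℝ) : Prop where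
  exists_lt : ∀ N ∈ 𝓝 t, ∃ s ∈ N ∩ X, ∃ s' ∈ N ∩ X, s < s'
  nonneg : ∃ N ∈ 𝓝 t, ∀ s ∈ N ∩ X, 0 ≤ s
  abs_sub_le : ∀ ε > 0, ∃ N ∈ 𝓝 t, ∀ s ∈ N ∩ X, ∀ s' ∈ N ∩ X, ∀ q ∈ Ioo s s',
    ∀ x ∈ S.outside, |F.v q x - F.potential t χ x| ≤ ε

theorem velocityTendsto_right (hn : 3 ≤ n) (ht : 0 ≤ t)
    (h : Hypersurface.ConvergesTo F.Sig (𝓝[>] t) S) (hχ : S.IsClosingFunction (F.g t).inner χ) :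
    F.VelocityTendsto t (Ici t) χ where
  exists_lt N hN := by
    obtain ⟨u, hu, hN'⟩ := mem_nhdsGE_iff_exists_Ico_subset.mp (mem_nhdsWithin_of_mem_nhds hN)
    rw [mem_Ioi] at hu
    exact ⟨t, ⟨mem_of_mem_nhds hN, self_mem_Ici⟩, (t + u) / 2,
      ⟨hN' ⟨by linarith, by linarith⟩, by rw [mem_Ici]; linarith⟩, by linarith⟩
  nonneg := ⟨univ, univ_mem, fun s hs => ht.trans hs.2⟩
  abs_sub_le ε hε := by
    obtain ⟨u, hu, hN⟩ := mem_nhdsGT_iff_exists_Ioo_subset.mp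
      (F.eventually_abs_v_sub_potential_le_right hn ht h hχ hε)
    exact ⟨Iio u, Iio_mem_nhds hu, fun s hs s' hs' q hq x _ =>
      hN ⟨lt_of_le_of_lt hs.2 hq.1, hq.2.trans hs'.1⟩ x⟩

theorem velocityTendsto_left (hn : 3 ≤ n) (ht : 0 < t)
    (h : Hypersurface.ConvergesTo F.Sig (𝓝[<] t) S) (hχ : S.IsClosingFunction (F.g t).inner χ) :
    F.VelocityTendsto t (Iic t) χ where
  exists_lt N hN := by
    obtain ⟨l, hl, hN'⟩ := mem_nhdsLE_iff_exists_Ioc_subset.mp (mem_nhdsWithin_of_mem_nhds hN)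
    rw [mem_Iio] at hl
    exact ⟨(l + t) / 2, ⟨hN' ⟨by linarith, by linarith⟩, by rw [mem_Iic]; linarith⟩, t,
      ⟨mem_of_mem_nhds hN, self_mem_Iic⟩, by linarith⟩
  nonneg := ⟨Ioi 0, Ioi_mem_nhds ht, fun s hs => le_of_lt hs.1⟩
  abs_sub_le ε hε := by
    obtain ⟨l, hl, hN⟩ := mem_nhdsLT_iff_exists_Ioo_subset.mp
      (F.eventually_abs_v_sub_potential_le_left hn ht h hχ hε)
    exact ⟨Ioi l, Ioi_mem_nhds hl, fun s hs s' hs' q hq x hx =>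
      hN ⟨lt_trans hs.1 hq.1, lt_of_lt_of_le hq.2 hs'.2⟩ x hx⟩

/-- The potential is approximated by the velocities. -/
theorem isHarmonicLimit_potential (hn : 3 ≤ n) (hU : IsFlatFactor E (F.g 0).inner ρ U) (ht : 0 ≤ t)
    (hr : ρ ≤ r) (hrS : E.beyond r ⊆ S.outside) {T : ℝ} (hT : t < T)
    (hrT : E.beyond r ⊆ (F.Sig T).outside) (hχ : S.IsClosingFunction (F.g t).inner χ) {X : Set ℝ}
    (hX : F.VelocityTendsto t X χ) :
    IsHarmonicLimit r (-Real.exp (-t)) (fun y => U y * F.potential t χ (E.chart.symm y)) := by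
  refine hU.isHarmonicLimit hn hr (fun y hy => ?_) (F.hasLimit_potential hn ht hχ) fun ε hε => ?_
  · have hyt := E.mem_target (hU.le.trans_lt (hr.trans_lt hy))
    have h1 := (hχ.isC2HarmonicOn_sheetDiff _ E.smooth y hyt (hrS (E.symm_mem_beyond hy))).1
    exact (h1.of_le one_le_two).neg.mul (F.contDiffAt_u hn ht E.smooth hyt)
  · obtain ⟨N, hN, hNε⟩ := hX.abs_sub_le ε hε
    obtain ⟨N', hN', hN0⟩ := hX.nonneg
    obtain ⟨s, hs, s', hs', hss⟩ := hX.exists_lt (N ∩ N' ∩ Iio T)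
      (inter_mem (inter_mem hN hN') (Iio_mem_nhds hT))
    obtain ⟨q, hq⟩ := exists_between hss
    have hq0 : 0 ≤ q := (hN0 s ⟨hs.1.1.2, hs.2⟩).trans hq.1.le
    exact ⟨F.v q, _, (F.dirichlet q hq0).isC2HarmonicOn.mono
      (hrT.trans (F.encloses q T hq0 (hq.2.trans hs'.1.2).le)), (F.dirichlet q hq0).limit,
      fun x hx => hNε s ⟨hs.1.1.1, hs.2⟩ s' ⟨hs'.1.1.1, hs'.2⟩ q hq x (hrS hx)⟩

/-- The expansions at infinity of the conformal factors. -/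
theorem exists_expansion (hn : 3 ≤ n) (hU : IsFlatFactor E (F.g 0).inner ρ U) :
    ∃ b : ℝ → ℝ, ∀ t, 0 ≤ t → ∀ r, ρ ≤ r → E.beyond r ⊆ (F.Sig t).outside → ∀ σ, r < σ →
      sphereIntegral (fun y => U y * F.u t (E.chart.symm y)) σ =
        sphereArea n * (Real.exp (-t) + b t * (σ ^ (n - 2))⁻¹) := by
  have hA := (sphereArea_pos hn).ne'
  have hρ0 : 0 ≤ ρ := E.R_pos.le.trans hU.le
  suffices h : ∀ t, ∃ b, 0 ≤ t → ∀ r, ρ ≤ r → E.beyond r ⊆ (F.Sig t).outside → ∀ σ, r < σ →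
      sphereIntegral (fun y => U y * F.u t (E.chart.symm y)) σ =
        sphereArea n * (Real.exp (-t) + b * (σ ^ (n - 2))⁻¹) by
    choose b hb using h
    exact ⟨b, hb⟩
  intro t
  by_cases ht : 0 ≤ t
  · have key : ∀ r, ρ ≤ r → E.beyond r ⊆ (F.Sig t).outside → ∃ B, ∀ σ, r < σ →
        sphereIntegral (fun y => U y * F.u t (E.chart.symm y)) σ =
          sphereArea n * (Real.exp (-t) + B * (σ ^ (n - 2))⁻¹) := fun r hr hrS => by
      obtain ⟨B, hB⟩ := (F.isHarmonicLimit_u hn hU ht hr hrS).exists_sphereIntegral_eq hn (hρ0.trans hr)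
      refine ⟨B / sphereArea n, fun σ hσ => ?_⟩
      rw [hB σ hσ]
      field_simp
    obtain ⟨r₀, -, hr₀, -⟩ := (F.Sig t).exists_isCompact_diff hn
    obtain ⟨B, hB⟩ := key (max r₀ ρ) (le_max_right _ _)
      (fun x hx => hr₀ (image_mono (fun y hy => (le_max_left r₀ ρ).trans_lt hy) hx))
    refine ⟨B, fun _ r hr hrS σ hσ => ?_⟩
    obtain ⟨B', hB'⟩ := key r hr hrS
    set τ := max (max r₀ ρ) r + 1 with hτ
    have h1 := hB τ ((le_max_left _ _).trans_lt (lt_add_one _))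
    rw [hB' τ ((le_max_right _ _).trans_lt (lt_add_one _))] at h1
    have hτ0 : (τ ^ (n - 2))⁻¹ ≠ 0 := by
      have : 0 < τ := by
        have := (hρ0.trans hr).trans (le_max_right (max r₀ ρ) r)
        linarith
      positivity
    have h2 : B' = B := mul_right_cancel₀ hτ0 (add_left_cancel (mul_left_cancel₀ hA h1))
    rw [hB' σ hσ, h2]
  · exact ⟨0, fun h => absurd h ht⟩

theorem isADMMass (hn : 3 ≤ n) (hU : IsFlatFactor E (F.g 0).inner ρ U) (ht : 0 ≤ t) (hr : ρ ≤ r)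
    (hrS : E.beyond r ⊆ (F.Sig t).outside) {b : ℝ}
    (hb : ∀ σ, r < σ → sphereIntegral (fun y => U y * F.u t (E.chart.symm y)) σ =
      sphereArea n * (Real.exp (-t) + b * (σ ^ (n - 2))⁻¹)) :
    E.IsADMMass (F.g t).inner (2 * Real.exp (-t) * b) := by
  refine isCoordADMMass_of_isHarmonicLimit hn ((E.R_pos.le.trans hU.le).trans hr) (Real.exp_pos _)
    (F.isHarmonicLimit_u hn hU ht hr hrS)
    (fun y hy => mul_pos (hU.pos y (hr.trans_lt hy)) (F.u_pos t ht _)) hb fun y hy => ?_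
  rw [F.conformal_eq t ht, coeff_conformal, hU.coeff_eq y (hr.trans_lt hy), smul_smul, mul_comm,
    Real.mul_rpow (hU.pos y (hr.trans_lt hy)).le (F.u_pos t ht _).le]

/-- Near infinity the closing function is `(1 + (χ - χ ∘ reflection)) / 2`, so that the conformal
factor of the closed double is half the difference of those of `g_t` and of the potential. -/
theorem isClosedDoubleMass (hn : 3 ≤ n) (hU : IsFlatFactor E (F.g 0).inner ρ U) (ht : 0 ≤ t)
    (hr : ρ ≤ r) (hrt : E.beyond r ⊆ (F.Sig t).outside) (hrS : E.beyond r ⊆ S.outside)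
    (hχ : S.IsClosingFunction (F.g t).inner χ) {b c : ℝ}
    (hb : ∀ σ, r < σ → sphereIntegral (fun y => U y * F.u t (E.chart.symm y)) σ =
      sphereArea n * (Real.exp (-t) + b * (σ ^ (n - 2))⁻¹))
    (hV : IsHarmonicLimit r (-Real.exp (-t)) (fun y => U y * F.potential t χ (E.chart.symm y)))
    (hc : ∀ σ, r < σ → sphereIntegral (fun y => U y * F.potential t χ (E.chart.symm y)) σ =
      sphereArea n * (-Real.exp (-t) + c * (σ ^ (n - 2))⁻¹)) :
    S.IsClosedDoubleMass (F.g t).inner χ (Real.exp (-t) * (b - c)) := by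
  have hr0 : 0 ≤ r := (E.R_pos.le.trans hU.le).trans hr
  have hW := F.isHarmonicLimit_u hn hU ht hr hrt
  have hsum : ∀ y : Eu n, r < ‖y‖ → S.sheet χ true (E.chart.symm y) =
      (1 / 2) * (1 + S.sheetDiff χ (E.chart.symm y)) := fun y hy => by
    have := hχ.sheet_add_sheet hn (hU.le.trans hr) hrS (E.symm_mem_beyond hy)
    rw [Hypersurface.sheetDiff]
    linarith
  have hsheet : ∀ y : Eu n, r < ‖y‖ → 0 < S.sheet χ true (E.chart.symm y) := fun y hy => by
    have := hχ.sheetDiff_nonneg hn (E.chart.symm y)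
    rw [hsum y hy]
    positivity
  have hlim : IsHarmonicLimit r (Real.exp (-t)) (fun y => (1 / 2) *
      (U y * F.u t (E.chart.symm y) + -(U y * F.potential t χ (E.chart.symm y)))) := by
    have := (hW.add hV.neg).const_mul (1 / 2)
    rwa [neg_neg, show 1 / 2 * (Real.exp (-t) + Real.exp (-t)) = Real.exp (-t) by ring] at this
  have heq : ∀ y : Eu n, r < ‖y‖ → (1 / 2) *
      (U y * F.u t (E.chart.symm y) + -(U y * F.potential t χ (E.chart.symm y))) =
      U y * (S.sheet χ true (E.chart.symm y) * F.u t (E.chart.symm y)) := fun y hy => by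
    rw [hsum y hy, potential]
    ring
  have hmass := isCoordADMMass_of_isHarmonicLimit hn hr0 (Real.exp_pos (-t)) hlim
    (b := (b - c) / 2) (G := coeff (conformal (S.sheet χ true) (F.g t).inner) E.chart)
    (fun y hy => by
      rw [heq y hy]
      exact mul_pos (hU.pos y (hr.trans_lt hy)) (mul_pos (hsheet y hy) (F.u_pos t ht _)))
    (fun σ hσ => by
      rw [sphereIntegral_const_mul]
      simp only [← sub_eq_add_neg]
      rw [sphereIntegral_sub hr0 hW.continuousOn hV.continuousOn hσ, hb σ hσ, hc σ hσ]
      ring)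
    (fun y hy => by
      rw [heq y hy, coeff_conformal, F.conformal_eq t ht, coeff_conformal,
        hU.coeff_eq y (hr.trans_lt hy), smul_smul, smul_smul,
        Real.mul_rpow (hU.pos y (hr.trans_lt hy)).le (mul_pos (hsheet y hy) (F.u_pos t ht _)).le,
        Real.mul_rpow (hsheet y hy).le (F.u_pos t ht _).le]
      congr 1
      ring)
  rwa [show 2 * Real.exp (-t) * ((b - c) / 2) = Real.exp (-t) * (b - c) by ring] at hmass

end ConformalFlow

/-! ### Strict one-sided derivatives -/

section OneSided

variable {f g : ℝ → ℝ} {f' g' t : ℝ} {X : Set ℝ}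

theorem prod_nhdsWithin_le (t : ℝ) (X : Set ℝ) : 𝓝[X] t ×ˢ 𝓝[X] t ≤ 𝓝 (t, t) := by
  rw [nhds_prod_eq]
  exact prod_mono nhdsWithin_le_nhds nhdsWithin_le_nhds

theorem hasDerivWithinAt_of_hasDerivAtFilter (ht : t ∈ X)
    (h : HasDerivAtFilter f f' (𝓝[X] t ×ˢ 𝓝[X] t)) : HasDerivWithinAt f f' X t :=
  h.mono (prod_mono le_rfl (pure_le_nhdsWithin ht))

/-- The product rule. The filter `𝓝[X] t ×ˢ 𝓝[X] t` encodes strict differentiability at `t`, as seen from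
`X`. -/
theorem hasDerivAtFilter_mul (ht : t ∈ X) (hf : HasDerivAtFilter f f' (𝓝[X] t ×ˢ 𝓝[X] t))
    (hg : HasDerivAtFilter g g' (𝓝[X] t ×ˢ 𝓝[X] t)) :
    HasDerivAtFilter (fun s => f s * g s) (f' * g t + f t * g') (𝓝[X] t ×ˢ 𝓝[X] t) := by
  have h1 : HasStrictFDerivAt (fun p : ℝ × ℝ => p.1 * p.2) _ (f t, g t) :=
    (hasStrictFDerivAt_fst (𝕜 := ℝ) (p := (f t, g t))).mul hasStrictFDerivAt_snd
  have hc := (hasDerivWithinAt_of_hasDerivAtFilter ht hf).continuousWithinAt.tendsto.prodMk_nhds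
    (hasDerivWithinAt_of_hasDerivAtFilter ht hg).continuousWithinAt.tendsto
  have h2 := HasFDerivAtFilter.comp h1 (hf.hasFDerivAtFilter.prodMk hg.hasFDerivAtFilter)
    (by rw [nhds_prod_eq]; exact hc.prodMap hc)
  have h3 := h2.hasDerivAtFilter
  refine Eq.subst (motive := fun d => HasDerivAtFilter (fun s => f s * g s) d _) ?_ h3
  simp
  ring

/-- A function with a strict one-sided derivative has a derivative which is continuous at that point,
from that side and along the set where it exists. -/
theorem tendsto_deriv_of_hasDerivAtFilter {Y : Set ℝ} (hY : IsOpen Y) (hYX : Y ⊆ X)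
    (h : HasDerivAtFilter f f' (𝓝[X] t ×ˢ 𝓝[X] t)) :
    Tendsto (deriv f) (𝓝[{s | s ∈ Y ∧ DifferentiableAt ℝ f s}] t) (𝓝 f') := by
  rw [Metric.tendsto_nhds]
  intro ε hε
  have h1 := (hasDerivAtFilter_iff_isLittleO.mp h).def (half_pos hε)
  obtain ⟨p, hp, q, hq, hpq⟩ := eventually_prod_iff.mp h1
  have hle : 𝓝[{s | s ∈ Y ∧ DifferentiableAt ℝ f s}] t ≤ 𝓝[X] t :=
    nhdsWithin_mono _ fun s hs => hYX hs.1
  filter_upwards [hle hq, hle (eventually_eventually_nhdsWithin.mpr hp), self_mem_nhdsWithin]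
    with s hqs hps hs
  have hX : X ∈ 𝓝 s := mem_of_superset (hY.mem_nhds hs.1) hYX
  rw [nhdsWithin_eq_nhds.mpr hX] at hps
  have h2 : Tendsto (slope f s) (𝓝[≠] s) (𝓝 (deriv f s)) := hasDerivAt_iff_tendsto_slope.mp
    hs.2.hasDerivAt
  have h3 : |deriv f s - f'| ≤ ε / 2 := by
    refine le_of_tendsto (h2.sub_const f').abs ?_
    filter_upwards [nhdsWithin_le_nhds hps, self_mem_nhdsWithin] with z hz hzs
    have hzs' : z - s ≠ 0 := sub_ne_zero.mpr hzs
    have h4 := hpq hz hqs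
    simp only [smul_eq_mul, Real.norm_eq_abs] at h4
    have h5 : slope f s z - f' = (f z - f s - (z - s) * f') / (z - s) := by
      rw [slope_def_field]
      field_simp
    rw [h5, abs_div, div_le_iff₀ (abs_pos.mpr hzs')]
    exact h4
  rw [Real.dist_eq]
  linarith

theorem hasDerivAtFilter_of_forall_abs_sub_le
    (h : ∀ ε > 0, ∃ N ∈ 𝓝 t, ∀ s ∈ N ∩ X, ∀ s' ∈ N ∩ X, s ≤ s' →
      |f s' - f s - (s' - s) * f'| ≤ ε * (s' - s)) :
    HasDerivAtFilter f f' (𝓝[X] t ×ˢ 𝓝[X] t) := by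
  refine hasDerivAtFilter_iff_isLittleO.mpr (Asymptotics.IsLittleO.of_bound fun ε hε => ?_)
  obtain ⟨N, hN, hNε⟩ := h ε hε
  have hmem : N ∩ X ∈ 𝓝[X] t := inter_mem (mem_nhdsWithin_of_mem_nhds hN) self_mem_nhdsWithin
  filter_upwards [prod_mem_prod hmem hmem] with p hp
  rw [smul_eq_mul, Real.norm_eq_abs, Real.norm_eq_abs]
  rcases le_total p.2 p.1 with hle | hle
  · rw [abs_of_nonneg (sub_nonneg.mpr hle)]
    exact hNε _ hp.2 _ hp.1 hle
  · rw [abs_sub_comm p.1, abs_of_nonneg (sub_nonneg.mpr hle), ← abs_neg]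
    convert hNε _ hp.1 _ hp.2 hle using 2
    ring

end OneSided

/-! ### The derivative of the mass -/

namespace ConformalFlow

variable {n : ℕ} {M : Type*} [TopologicalSpace M] [T2Space M] [ConnectedSpace M]
  [ChartedSpace (Eu n) M] [IsManifold (𝓡 n) ∞ M] {E : DistinguishedEnd n M} (F : ConformalFlow E)
  {S : Hypersurface E} {χ : S.Double → ℝ} {t r ρ : ℝ} {U : Eu n → ℝ}

/-- The spherical means of the conformal factors are strictly differentiable in time, from one side;
the derivative is the spherical mean of the potential. -/
theorem hasDerivAtFilter_sphereIntegral (hn : 3 ≤ n) (hU : IsFlatFactor E (F.g 0).inner ρ U)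
    (hr : ρ ≤ r) (hrS : E.beyond r ⊆ S.outside) {T : ℝ} (hT : t < T)
    (hrT : E.beyond r ⊆ (F.Sig T).outside)
    (hV : IsHarmonicLimit r (-Real.exp (-t)) (fun y => U y * F.potential t χ (E.chart.symm y)))
    {X : Set ℝ} (hX : F.VelocityTendsto t X χ) {σ : ℝ} (hσ : r < σ) :
    HasDerivAtFilter (fun s => sphereIntegral (fun y => U y * F.u s (E.chart.symm y)) σ)
      (sphereIntegral (fun y => U y * F.potential t χ (E.chart.symm y)) σ)
      (𝓝[X] t ×ˢ 𝓝[X] t) := by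
  have hr0 : 0 ≤ r := (E.R_pos.le.trans hU.le).trans hr
  have hA := sphereArea_pos hn
  refine hasDerivAtFilter_of_forall_abs_sub_le fun ε hε => ?_
  obtain ⟨N, hN, hNε⟩ := hX.abs_sub_le (ε / (2 * sphereArea n)) (by positivity)
  obtain ⟨N', hN', hN0⟩ := hX.nonneg
  refine ⟨N ∩ N' ∩ Iio T, inter_mem (inter_mem hN hN') (Iio_mem_nhds hT),
    fun s hs s' hs' hss => ?_⟩
  have hs0 : 0 ≤ s := hN0 s ⟨hs.1.1.2, hs.2⟩
  have hW : ∀ q, 0 ≤ q → q < T →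
      ContinuousOn (fun y => U y * F.u q (E.chart.symm y)) {y | r < ‖y‖} := fun q hq hqT =>
    (F.isHarmonicLimit_u hn hU hq hr (hrT.trans (F.encloses q T hq hqT.le))).continuousOn
  have hcs := hW s hs0 hs.1.2
  have hcs' := hW s' (hs0.trans hss) hs'.1.2
  rw [← sphereIntegral_sub hr0 hcs' hcs hσ, ← sphereIntegral_const_mul,
    ← sphereIntegral_sub (f := fun y => U y * F.u s' (E.chart.symm y) - U y * F.u s (E.chart.symm y))
      (g := fun y => (s' - s) * (U y * F.potential t χ (E.chart.symm y))) hr0 (hcs'.sub hcs)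
      (continuousOn_const.mul hV.continuousOn) hσ]
  refine (abs_sphereIntegral_le (C := 2 * ((s' - s) * (ε / (2 * sphereArea n)))) (hr0.trans hσ.le)
    fun y hy => ?_).trans (le_of_eq (by field_simp))
  have hy' : r < ‖y‖ := by rwa [hy]
  set x := E.chart.symm y
  have hx : x ∈ S.outside := hrS (E.symm_mem_beyond hy')
  set P := F.potential t χ x
  have h1 := F.u_sub_mem hn hs0 hss (x := x) (c := P - ε / (2 * sphereArea n))
    (C := P + ε / (2 * sphereArea n))
    (fun q hq => by
      have := (abs_le.mp (hNε s ⟨hs.1.1.1, hs.2⟩ s' ⟨hs'.1.1.1, hs'.2⟩ q hq x hx)).1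
      linarith)
    (fun q hq => by
      have := (abs_le.mp (hNε s ⟨hs.1.1.1, hs.2⟩ s' ⟨hs'.1.1.1, hs'.2⟩ q hq x hx)).2
      linarith)
  have h2 : |F.u s' x - F.u s x - (s' - s) * P| ≤ (s' - s) * (ε / (2 * sphereArea n)) :=
    abs_le.mpr ⟨by linarith [h1.1], by linarith [h1.2]⟩
  rw [show U y * F.u s' x - U y * F.u s x - (s' - s) * (U y * P) =
    U y * (F.u s' x - F.u s x - (s' - s) * P) by ring, abs_mul,
    abs_of_pos (hU.pos y (hr.trans_lt hy'))]
  exact mul_le_mul (hU.le_two y (hr.trans_lt hy')) h2 (abs_nonneg _) zero_le_two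

/-- The closed double through `S` has a mass `mt`, and `-2 mt` is the derivative of the mass from
each side from which the velocities converge to the potential of `χ`. -/
theorem exists_isClosedDoubleMass (hn : 3 ≤ n) (hU : IsFlatFactor E (F.g 0).inner ρ U) {b : ℝ → ℝ}
    (hb : ∀ t, 0 ≤ t → ∀ r, ρ ≤ r → E.beyond r ⊆ (F.Sig t).outside → ∀ σ, r < σ →
      sphereIntegral (fun y => U y * F.u t (E.chart.symm y)) σ =
        sphereArea n * (Real.exp (-t) + b t * (σ ^ (n - 2))⁻¹))
    (ht : 0 ≤ t) (hχ : S.IsClosingFunction (F.g t).inner χ) {X₀ : Set ℝ}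
    (hX₀ : F.VelocityTendsto t X₀ χ) :
    ∃ mt, S.IsClosedDoubleMass (F.g t).inner χ mt ∧ ∀ X, t ∈ X → F.VelocityTendsto t X χ →
      HasDerivAtFilter (fun s => 2 * Real.exp (-s) * b s) (-2 * mt) (𝓝[X] t ×ˢ 𝓝[X] t) := by
  have hA := sphereArea_pos hn
  have hT : t < t + 1 := lt_add_one t
  obtain ⟨r₁, -, hr₁, -⟩ := (F.Sig (t + 1)).exists_isCompact_diff hn
  obtain ⟨r₂, -, hr₂, -⟩ := S.exists_isCompact_diff hn
  set r := max ρ (max r₁ r₂)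
  have hr : ρ ≤ r := le_max_left _ _
  have hr0 : 0 ≤ r := (E.R_pos.le.trans hU.le).trans hr
  have hrT : E.beyond r ⊆ (F.Sig (t + 1)).outside := fun x hx => hr₁ (image_mono
    (fun y hy => ((le_max_left r₁ r₂).trans (le_max_right ρ _)).trans_lt hy) hx)
  have hrS : E.beyond r ⊆ S.outside := fun x hx => hr₂ (image_mono
    (fun y hy => ((le_max_right r₁ r₂).trans (le_max_right ρ _)).trans_lt hy) hx)
  have hrs : ∀ s, 0 ≤ s → s ≤ t + 1 → E.beyond r ⊆ (F.Sig s).outside := fun s hs hsT =>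
    hrT.trans (F.encloses s (t + 1) hs hsT)
  have hV := F.isHarmonicLimit_potential hn hU ht hr hrS hT hrT hχ hX₀
  obtain ⟨c, hc⟩ : ∃ c, ∀ σ, r < σ →
      sphereIntegral (fun y => U y * F.potential t χ (E.chart.symm y)) σ =
        sphereArea n * (-Real.exp (-t) + c * (σ ^ (n - 2))⁻¹) := by
    obtain ⟨B, hB⟩ := hV.exists_sphereIntegral_eq hn hr0
    refine ⟨B / sphereArea n, fun σ hσ => ?_⟩
    rw [hB σ hσ]
    field_simp
  refine ⟨_, F.isClosedDoubleMass hn hU ht hr (hrs t ht hT.le) hrS hχ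
    (hb t ht r hr (hrs t ht hT.le)) hV hc, fun X htX hX => ?_⟩
  have hσ : r < r + 1 := lt_add_one r
  have hσ0 : 0 < r + 1 := by linarith
  set σ := r + 1
  have hder := F.hasDerivAtFilter_sphereIntegral hn hU hr hrS hT hrT hV hX hσ
  have hexp : HasDerivAtFilter (fun s => Real.exp (-s)) (-Real.exp (-t)) (𝓝[X] t ×ˢ 𝓝[X] t) := by
    have h1 : HasStrictDerivAt (fun s => Real.exp (-s)) (-Real.exp (-t)) t := by
      simpa using (hasStrictDerivAt_neg t).exp
    exact h1.mono (prod_nhdsWithin_le t X)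
  have hconst : ∀ a : ℝ, HasDerivAtFilter (fun _ => a) 0 (𝓝[X] t ×ˢ 𝓝[X] t) := fun a =>
    (hasStrictDerivAt_const t a).mono (prod_nhdsWithin_le t X)
  have hbder := hasDerivAtFilter_mul htX (hconst (σ ^ (n - 2)))
    ((hasDerivAtFilter_mul htX (hconst (sphereArea n)⁻¹) hder).sub hexp)
  have hm := hasDerivAtFilter_mul htX (hasDerivAtFilter_mul htX (hconst 2) hexp) hbder
  have hbs : ∀ s, 0 ≤ s → s ≤ t + 1 → σ ^ (n - 2) * ((sphereArea n)⁻¹ *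
      sphereIntegral (fun y => U y * F.u s (E.chart.symm y)) σ - Real.exp (-s)) = b s :=
    fun s hs hsT => by
      rw [hb s hs r hr (hrs s hs hsT) σ hσ]
      field_simp
      ring
  obtain ⟨N, hN, hN0⟩ := hX.nonneg
  have hmem : N ∩ Iio (t + 1) ∩ X ∈ 𝓝[X] t := inter_mem
    (mem_nhdsWithin_of_mem_nhds (inter_mem hN (Iio_mem_nhds hT))) self_mem_nhdsWithin
  have hm' : HasDerivAtFilter (fun s => 2 * Real.exp (-s) * b s) _ (𝓝[X] t ×ˢ 𝓝[X] t) :=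
    hm.congr_of_eventuallyEq (by
      filter_upwards [prod_mem_prod hmem hmem] with p hp
      have h1 := hbs p.1 (hN0 _ ⟨hp.1.1.1, hp.1.2⟩) (le_of_lt hp.1.1.2)
      have h2 := hbs p.2 (hN0 _ ⟨hp.2.1.1, hp.2.2⟩) (le_of_lt hp.2.1.2)
      simp only [Prod.map, Pi.sub_apply, h1, h2])
  convert hm' using 1
  have h1 := hbs t ht hT.le
  simp only [Pi.sub_apply, h1]
  rw [hc σ hσ]
  field_simp
  ring

end ConformalFlow

end ConfFlow

end

theorem mainTheorem5 {n : ℕ} (hn : 3 ≤ n) {M : Type*} [TopologicalSpace M] [T2Space M]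
    [SecondCountableTopology M] [ConnectedSpace M] [ChartedSpace (ConfFlow.Eu n) M]
    [IsManifold (𝓡 n) ∞ M] (E : ConfFlow.DistinguishedEnd n M) (F : ConfFlow.ConformalFlow E)
    (hF : E.IsHarmonicallyFlat (F.g 0).inner) :
    ∃ m : ℝ → ℝ, (∀ t, 0 ≤ t → E.IsADMMass (F.g t).inner (m t)) ∧
      -- times which are not jump times
      (∀ t, 0 ≤ t → ¬ F.IsJumpTime t →
        ∀ χ, (F.Sig t).IsClosingFunction (F.g t).inner χ →
          ∃ mt, (F.Sig t).IsClosedDoubleMass (F.g t).inner χ mt ∧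
            HasDerivWithinAt m (-2 * mt) (Ici 0) t) ∧
      -- the right side, where `Sp` is the hypersurface after `t`
      (∀ t, 0 ≤ t → ∀ Sp : ConfFlow.Hypersurface E,
        ConfFlow.Hypersurface.ConvergesTo F.Sig (𝓝[>] t) Sp →
        ∀ χ, Sp.IsClosingFunction (F.g t).inner χ →
          ∃ mt, Sp.IsClosedDoubleMass (F.g t).inner χ mt ∧
            HasDerivWithinAt m (-2 * mt) (Ici t) t ∧
            Tendsto (deriv m) (𝓝[{s | t < s ∧ DifferentiableAt ℝ m s}] t) (𝓝 (-2 * mt))) ∧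
      -- the left side, where `Sm` is the hypersurface before `t`
      (∀ t, 0 < t → ∀ Sm : ConfFlow.Hypersurface E,
        ConfFlow.Hypersurface.ConvergesTo F.Sig (𝓝[<] t) Sm →
        ∀ χ, Sm.IsClosingFunction (F.g t).inner χ →
          ∃ mt, Sm.IsClosedDoubleMass (F.g t).inner χ mt ∧
            HasDerivWithinAt m (-2 * mt) (Iic t) t ∧
            Tendsto (deriv m) (𝓝[{s | s < t ∧ DifferentiableAt ℝ m s}] t) (𝓝 (-2 * mt))) := by
  obtain ⟨ρ, U, hU⟩ := ConfFlow.exists_isFlatFactor hF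
  obtain ⟨b, hb⟩ := F.exists_expansion hn hU
  refine ⟨fun s => 2 * Real.exp (-s) * b s, fun t ht => ?_, fun t ht hjump χ hχ => ?_,
    fun t ht S hS χ hχ => ?_, fun t ht S hS χ hχ => ?_⟩
  · obtain ⟨r, -, hr, -⟩ := (F.Sig t).exists_isCompact_diff hn
    have hr' : E.beyond (max ρ r) ⊆ (F.Sig t).outside := fun x hx => hr (image_mono
      (fun y hy => (le_max_right ρ r).trans_lt hy) hx)
    exact F.isADMMass hn hU ht (le_max_left _ _) hr' (hb t ht _ (le_max_left _ _) hr')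
  · have hconv := not_not.mp hjump
    have hright : ConfFlow.Hypersurface.ConvergesTo F.Sig (𝓝[>] t) (F.Sig t) := fun N hN hS =>
      nhdsWithin_mono t (fun s hs => ht.trans (le_of_lt hs)) (hconv N hN hS)
    have hVr := F.velocityTendsto_right hn ht hright hχ
    obtain ⟨mt, hmt, hd⟩ := F.exists_isClosedDoubleMass hn hU hb ht hχ hVr
    have hdr := ConfFlow.hasDerivWithinAt_of_hasDerivAtFilter self_mem_Ici (hd _ self_mem_Ici hVr)
    refine ⟨mt, hmt, ?_⟩
    rcases ht.eq_or_lt with rfl | ht0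
    · exact hdr
    have hleft : ConfFlow.Hypersurface.ConvergesTo F.Sig (𝓝[<] t) (F.Sig t) := fun N hN hS => by
      have h1 := hconv N hN hS
      rw [nhdsWithin_eq_nhds.mpr (Ici_mem_nhds ht0)] at h1
      exact nhdsWithin_le_nhds h1
    have hVl := F.velocityTendsto_left hn ht0 hleft hχ
    have hdl := ConfFlow.hasDerivWithinAt_of_hasDerivAtFilter self_mem_Iic (hd _ self_mem_Iic hVl)
    exact (hdl.union hdr).mono (by rw [Iic_union_Ici]; exact subset_univ _)
  · have hV := F.velocityTendsto_right hn ht hS hχ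
    obtain ⟨mt, hmt, hd⟩ := F.exists_isClosedDoubleMass hn hU hb ht hχ hV
    have h := hd _ self_mem_Ici hV
    exact ⟨mt, hmt, ConfFlow.hasDerivWithinAt_of_hasDerivAtFilter self_mem_Ici h,
      ConfFlow.tendsto_deriv_of_hasDerivAtFilter isOpen_Ioi Ioi_subset_Ici_self h⟩
  · have hV := F.velocityTendsto_left hn ht hS hχ
    obtain ⟨mt, hmt, hd⟩ := F.exists_isClosedDoubleMass hn hU hb ht.le hχ hV
    have h := hd _ self_mem_Iic hV
    exact ⟨mt, hmt, ConfFlow.hasDerivWithinAt_of_hasDerivAtFilter self_mem_Iic h,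
      ConfFlow.tendsto_deriv_of_hasDerivAtFilter isOpen_Iio Iio_subset_Iic_self h⟩
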